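/- **Conventions.** Languages are sets $L\subseteq\{0,1\}^*$. A *postselected circuit* on $n$ qubits consists of a computational basis state $|\mathbf x\rangle$ in which the qubits are prepared, a list of gates, an output qubit $\mathcal O$, and a set $\mathcal P$ of other qubits (the postselection register) with a required bitstring $\mathbf p$. After the gates the qubits are measured in the computational basis. A family $\{C_w\}$ of such circuits, one for each $w\in\{0,1\}^*$, *decides* $L$ if there is a constant $0<\varepsilon<\tfrac12$ such that for all $w$: $\Pr(\mathcal P_w=\mathbf p_w)>0$; if $w\in L$ then $\Pr(\mathcal O_w=1\mid\mathcal P_w=\mathbf p_w)\ge 1-\varepsilon$; if $w\notin L$ then $\Pr(\mathcal O_w=0\mid\mathcal P_w=\mathbf p_w)\ge 1-\varepsilon$. **PostBQP** is the class of languages decided by families of postselected circuits over the universal gate set consisting of the Hadamard gate, the phase gate $\mathrm{diag}(1,i)$, the controlled-NOT gate and the Toffoli gate, where a Turing machine computes a description of $C_w$ from $w$ in time polynomial in $|w|$. **PostXQP** is the class of languages decided by families of postselected circuits whose gates are Heisenberg exchange gates $$U_{ij}(\theta)=e^{i\theta E_{ij}}=\cos\theta\cdot\mathbf 1+i\sin\theta\cdot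 E_{ij},\qquad i\neq j,\ \theta\in\mathbb R,$$ where $E_{ij}$ is the SWAP of qubits $i$ and $j$, such that: 1. (uniformity) a Turing machine, given $w$ and $k\in\mathbb N$ in unary, computes in time polynomial in $|w|+k$ a description of $C_w$ that is exact except that each angle $\theta$ is replaced by $\arg(a+bi)$ for integers $a,b$ (in binary, $\arg 0=0$) with $|e^{i\theta}-e^{i\arg(a+bi)}|\le 2^{-k}$; 2. the postselection succeeds with at least inverse exponential probability: there is a polynomial $q$ such that $\Pr(\mathcal P_w=\mathbf p_w)\ge 2^{-q(|w|)}$ for all $w$. **PostXQP(θ)** is defined in the same way, with all gates restricted to integer powers $U_{ij}(\theta)^m=U_{ij}(m\theta)$, $m\in\mathbb N$. For $\theta=\pi/4$ these are the powers of $\sqrt{\mathrm{SWAP}}$. **Theorem.** $\mathsf{PostXQP}(\pi/4)=\mathsf{PostXQP}=\mathsf{PostBQP}$. -/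

import Mathlib

/-! # Postselected exchange circuits and postselected quantum polynomial time

Languages are sets of finite bitstrings. A family of circuits assigns a circuit `C w` to every
bitstring `w`; it is uniform if a description of `C w` is produced by a polynomial-time Turing
machine. -/

namespace XQP

/-! ## States, registers, circuits -/

/-- Amplitude vectors of `n` qubits in the computational basis (`false` is `0`, `true` is `1`). -/
abbrev State (n : ℕ) : Type := (Fin n → Bool) → ℂ

/-- The computational basis state `|x⟩`. -/
def ket {n : ℕ} (x : Fin n → Bool) : State n := fun y => if y = x then 1 else 0

/-- The part of a postselected circuit other than its gates: the number of qubits, the basis state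
in which they are prepared, the output qubit, and the postselection register with the values
required on it (`post q = some b`: qubit `q` is postselected on the outcome `b`; `post q = none`:
qubit `q` is not postselected). The output qubit is not in the postselection register. -/
structure Register where
  n : ℕ
  input : Fin n → Bool
  output : Fin n
  post : Fin n → Option Bool
  post_output : post output = none

/-- A postselected circuit whose gates on `n` qubits have type `G n`; the first gate of the list is
applied first. -/
structure Circuit (G : ℕ → Type) extends Register where
  gates : List (G n)

/-- The measurement outcome `x` has the required values on the postselection register. -/
def Register.Selected (R : Register) (x : Fin R.n → Bool) : Prop :=
  ∀ q b, R.post q = some b → x q = b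

open Classical in
/-- The probability, in the final state `ψ`, that the postselection succeeds. -/
noncomputable def Register.postProb (R : Register) (ψ : State R.n) : ℝ :=
  ∑ x : Fin R.n → Bool with R.Selected x, ‖ψ x‖ ^ 2

open Classical in
/-- The probability, in the final state `ψ`, that the postselection succeeds and the output qubit
is measured to be `v`. -/
noncomputable def Register.jointProb (R : Register) (ψ : State R.n) (v : Bool) : ℝ :=
  ∑ x : Fin R.n → Bool with R.Selected x ∧ x R.output = v, ‖ψ x‖ ^ 2

/-- The probability that the output qubit is measured to be `v`, conditioned on the success of the
postselection. It is used only where `postProb` is positive. -/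
noncomputable def Register.condProb (R : Register) (ψ : State R.n) (v : Bool) : ℝ :=
  R.jointProb ψ v / R.postProb ψ

/-- The postselected final states `ψ w` decide membership of `w` in `L` with bounded error: the
postselection has positive probability, and conditioned on it the output is right with probability
at least `1 - ε`, for some constant error tolerance `0 < ε < 1/2`. -/
def Decides (R : List Bool → Register) (ψ : ∀ w, State (R w).n) (L : Language Bool) : Prop :=
  ∃ ε : ℝ, 0 < ε ∧ ε < 1 / 2 ∧ ∀ w : List Bool,
    0 < (R w).postProb (ψ w) ∧
    (w ∈ L → 1 - ε ≤ (R w).condProb (ψ w) true) ∧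
    (w ∉ L → 1 - ε ≤ (R w).condProb (ψ w) false)

/-! ## Descriptions of circuits as strings -/

/-- The finite alphabet of circuit descriptions. -/
inductive Symbol
  | bit (b : Bool)
  | free
  | out
  | post (b : Bool)
  | tick
  | sep
  | exchange
  | hadamard
  | phase
  | cnot
  | toffoli
  deriving DecidableEq, Fintype

/-- A qubit index, in unary. -/
def encodeWire {n : ℕ} (q : Fin n) : List Symbol :=
  List.replicate q.val Symbol.tick ++ [Symbol.sep]

/-- An integer: its sign, then its absolute value in binary. -/
def encodeInt (z : ℤ) : List Symbol :=
  Symbol.bit (decide (z < 0)) :: (Computability.encodeNat z.natAbs).map Symbol.bit ++ [Symbol.sep]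

/-- A register: for every qubit, its initial value and its role in the measurement. -/
def Register.encode (R : Register) : List Symbol :=
  (List.finRange R.n).flatMap fun q =>
    [Symbol.bit (R.input q),
      if q = R.output then Symbol.out
      else match R.post q with
        | none => Symbol.free
        | some b => Symbol.post b]

/-- A circuit: its register, followed by its list of gates. -/
def Circuit.encode {G : ℕ → Type} (e : ∀ {n : ℕ}, G n → List Symbol) (C : Circuit G) :
    List Symbol :=
  C.toRegister.encode ++ C.gates.flatMap e

/-! ## Exchange circuits -/

/-- A Heisenberg exchange gate on two distinct qubits, with a parameter of type `α`. The gates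
proper have a real angle as their parameter, the gates in a description a pair of integers. -/
structure ExchangeGate (α : Type) (n : ℕ) where
  i : Fin n
  j : Fin n
  ne : i ≠ j
  angle : α

/-- The `SWAP` operation `E_ij`. -/
def swap {n : ℕ} (i j : Fin n) (ψ : State n) : State n := fun x => ψ (x ∘ Equiv.swap i j)

/-- `U_ij(θ) = exp (i θ E_ij) = cos θ + i sin θ E_ij`. -/
noncomputable def ExchangeGate.apply {n : ℕ} (g : ExchangeGate ℝ n) (ψ : State n) : State n :=
  fun x => (Real.cos g.angle : ℂ) * ψ x + Complex.I * (Real.sin g.angle : ℂ) * swap g.i g.j ψ x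

/-- A postselected `XQP` circuit: preparation of a computational basis state, exchange gates with
arbitrary real angles, measurement in the computational basis. -/
abbrev XQPCircuit : Type := Circuit (ExchangeGate ℝ)

/-- The state of an `XQP` circuit before the measurement. -/
noncomputable def XQPCircuit.final (C : XQPCircuit) : State C.n :=
  C.gates.foldl (fun ψ g => g.apply ψ) (ket C.input)

/-- An exchange gate as it stands in a description, with the pair of integers `(a, b)` for the
angle `arg (a + b i)`. -/
def encodeExchangeGate {n : ℕ} (g : ExchangeGate (ℤ × ℤ) n) : List Symbol :=
  Symbol.exchange ::
    (encodeWire g.i ++ encodeWire g.j ++ encodeInt g.angle.1 ++ encodeInt g.angle.2)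

/-- The angle `arg (a + b i)` denoted by the pair of integers `p = (a, b)`. -/
noncomputable def denotedAngle (p : ℤ × ℤ) : ℝ := Complex.arg ((p.1 : ℂ) + (p.2 : ℂ) * Complex.I)

/-- The gate `d` of a description gives the gate `g` up to precision `δ`: the qubits are the same,
and `exp (iθ)` is within `δ` of its true value. -/
def GateApprox (δ : ℝ) {n : ℕ} (d : ExchangeGate (ℤ × ℤ) n) (g : ExchangeGate ℝ n) : Prop :=
  d.i = g.i ∧ d.j = g.j ∧
    ‖Complex.exp ((denotedAngle d.angle : ℂ) * Complex.I) -
      Complex.exp ((g.angle : ℂ) * Complex.I)‖ ≤ δ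

/-- A family of postselected `XQP` circuits is uniform if a polynomial-time Turing machine, given
`w` and `k` (in unary), outputs a description of `C w` in which the register and the qubits of each
gate are exact and the angles have precision `2 ^ (-k)`. -/
def UniformXQP (C : List Bool → XQPCircuit) : Prop :=
  ∃ D : ∀ w : List Bool, ℕ → List (ExchangeGate (ℤ × ℤ) (C w).n),
    (∀ w k, List.Forall₂ (GateApprox ((2 : ℝ)⁻¹ ^ k)) (D w k) (C w).gates) ∧
    Nonempty (Turing.TM2ComputableInPolyTime
      (Computability.encodingProd (Computability.encodingList Bool)
        Computability.unaryEncodingNat).encode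
      (Circuit.encode encodeExchangeGate)
      (fun p : List Bool × ℕ =>
        (⟨(C p.1).toRegister, D p.1 p.2⟩ : Circuit (ExchangeGate (ℤ × ℤ)))))

/-- The postselection succeeds with probability at least `2 ^ (-q |w|)` for some polynomial `q`.
For uniform families with finitely many angles `θ`, each with `exp (iθ)` algebraic (such as the
multiples of `π / 4`), this follows from its being positive. -/
def InverseExponential (C : List Bool → XQPCircuit) : Prop :=
  ∃ q : Polynomial ℕ, ∀ w : List Bool,
    (2 : ℝ)⁻¹ ^ (q.eval w.length) ≤ (C w).toRegister.postProb (C w).final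

/-- The languages decided by uniform families of postselected `XQP` circuits all of whose angles
lie in `A`. -/
def PostXQPWith (A : Set ℝ) : Set (Language Bool) :=
  {L | ∃ C : List Bool → XQPCircuit,
    UniformXQP C ∧ InverseExponential C ∧ (∀ w, ∀ g ∈ (C w).gates, g.angle ∈ A) ∧
    Decides (fun w => (C w).toRegister) (fun w => (C w).final) L}

/-- `PostXQP`: all angles are allowed. -/
def PostXQP : Set (Language Bool) := PostXQPWith Set.univ

/-- `PostXQP(θ)`: the gates are the powers `U_ij(θ) ^ m = U_ij(m θ)`. -/
def PostXQPAngle (θ : ℝ) : Set (Language Bool) := PostXQPWith {x | ∃ m : ℕ, x = m * θ}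

/-! ## General quantum circuits -/

/-- Gates of the universal set consisting of the Hadamard gate, the phase gate `diag (1, i)`, the
controlled NOT gate (control `c`, target `t`) and the Toffoli gate (controls `c₁`, `c₂`,
target `t`). -/
inductive QGate (n : ℕ) : Type
  | hadamard (q : Fin n)
  | phase (q : Fin n)
  | cnot (c t : Fin n) (h : c ≠ t)
  | toffoli (c₁ c₂ t : Fin n) (h₁₂ : c₁ ≠ c₂) (h₁ : c₁ ≠ t) (h₂ : c₂ ≠ t)

/-- The bitstring `x` with its `t`-th bit flipped. -/
def flip {n : ℕ} (t : Fin n) (x : Fin n → Bool) : Fin n → Bool := Function.update x t (!x t)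

/-- The action of the gates on states. -/
noncomputable def QGate.apply {n : ℕ} : QGate n → State n → State n
  | .hadamard q, ψ => fun x =>
      ((Real.sqrt 2 : ℝ) : ℂ)⁻¹ * (ψ (Function.update x q false) +
        (if x q then -1 else 1) * ψ (Function.update x q true))
  | .phase q, ψ => fun x => (if x q then Complex.I else 1) * ψ x
  | .cnot c t _, ψ => fun x => if x c then ψ (flip t x) else ψ x
  | .toffoli c₁ c₂ t _ _ _, ψ => fun x => if x c₁ && x c₂ then ψ (flip t x) else ψ x

/-- The description of a gate. -/
def QGate.encode {n : ℕ} : QGate n → List Symbol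
  | .hadamard q => Symbol.hadamard :: encodeWire q
  | .phase q => Symbol.phase :: encodeWire q
  | .cnot c t _ => Symbol.cnot :: (encodeWire c ++ encodeWire t)
  | .toffoli c₁ c₂ t _ _ _ => Symbol.toffoli :: (encodeWire c₁ ++ encodeWire c₂ ++ encodeWire t)

/-- A postselected quantum circuit. -/
abbrev QCircuit : Type := Circuit QGate

/-- The state of a quantum circuit before the measurement. -/
noncomputable def QCircuit.final (C : QCircuit) : State C.n :=
  C.gates.foldl (fun ψ g => g.apply ψ) (ket C.input)

/-- A family of postselected quantum circuits is uniform if a polynomial-time Turing machine, given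
`w`, outputs the description of `C w`. -/
def UniformQ (C : List Bool → QCircuit) : Prop :=
  Nonempty (Turing.TM2ComputableInPolyTime
    (Computability.encodingList Bool).encode (Circuit.encode QGate.encode) C)

/-- `PostBQP`: the languages decided by uniform families of postselected quantum circuits. -/
def PostBQP : Set (Language Bool) :=
  {L | ∃ C : List Bool → QCircuit,
    UniformQ C ∧ Decides (fun w => (C w).toRegister) (fun w => (C w).final) L}

end XQP

/-! # Postselected exchange circuits decide exactly the languages in `PostBQP`

`PostXQPAngle (π / 4) ⊆ PostXQP` is immediate, so the theorem amounts to two simulations. Both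
translate a circuit gate by gate into *gadgets*: short lists of gates that act on the given wires
and on fresh ancillas, each of which is prepared in some value and postselected on the same value.
What counts is the operator that a gadget induces on the given wires, and a nonzero constant factor
is harmless, since the conditional probabilities do not change under scaling of the final state.

**From general circuits to exchange circuits** (`postBQP_subset`). Exchange gates commute with the
Hamming weight, so the qubit `q` is encoded in the pair of wires `2 q`, `2 q + 1` with opposite
values (`enc`). An exchange gate between a wire and an ancilla, followed by postselection, acts on
the wire as a diagonal operator: the amplitude of one of the two values is multiplied by `±1 + i`
and that of the other by `±1` (`Impl.fil`). Two of these filters make the phase gate or its inverse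
(`Impl.ph`, `Impl.phInv`). On a dual-rail pair, `√SWAP` is `(1 + i X) / √2`, and between two inverse
phase gates it becomes the Hadamard gate (`Impl.hp`). A phase flip between two `√SWAP`s gives, up to
phase gates, the controlled `Z` gate (`Impl.cz`), hence the controlled NOT gate (`Impl.cx`). The
doubly controlled `Z` gate comes from interference in an ancilla pair (`Impl.cczCore`,
`Impl.cczFix`), and with Hadamard gates it becomes the Toffoli gate (`Impl.tof`). All angles are
`π / 4` or `3 π / 4`, which are denoted exactly by the pairs `(1, 1)` and `(-1, 1)`. Each gadget
multiplies the state by a constant of absolute value at least `2 ^ (-28)` (`exists_impl_dualRail`).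
As the amplitudes of a general circuit are Gaussian integers up to powers of `√2`, a positive
success probability is at least `2 ^ (-N)` for `N` gates (`half_pow_le_postProb`). So the success
probability of the exchange circuit is at least inverse exponential.

**From exchange circuits to general circuits** (`postXQP_subset`). An exchange gate with the angle
`arg (a + b i)`, for integers `a` and `b`, is a multiple of `a + b i E`, where `E` is the swap of
the two qubits. This operator is implemented exactly, whatever the size of `a` and `b`
(`Impl.exchange`): entangled ancillas carry one branch in which the qubits will be swapped and one
in which they will not, the amplitudes of the branches are made proportional to `b` and `a` by a
Horner-like scheme that reads their binary digits (`Impl.double`, `Impl.addUp`), and projecting the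
control back to `0` adds the two branches up. It remains to compare the circuit that has the denoted
angles with the one that has the true angles. A gate at most doubles the sup norm of the difference
of the states (`norm_foldl_sub_le`), so errors of `2 ^ (-k)` in the angles become errors of at most
`2 ^ (poly - k)` in the probabilities (`error_bound_le`). Because the success probability is at
least `2 ^ (-q)`, a polynomial precision `k = c (n + 1) ^ d` keeps the conditional probabilities
away from `1 / 2` (`le_condProb_of_close`).

**Uniformity.** Both translations have to be carried out by polynomial-time stack machines.
`computable_comp` composes two machines. Machines are not written by hand: `Prog` is a small
language of structured programs on stacks, `Run` its big-step semantics with running times, and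
`computable_of_run` compiles a program to a machine. A compiler for circuits is a single loop over
the items of a description (`computable_of_handles`). It emits the gates and the register entries of
the gadgets on two separate stacks, and counts the qubits in order to name fresh ancillas. The fact
that ancillas are only ever appended makes the emitted text agree with the encoding of the circuit
whose register is `Register.extend`.

To compose gadgets without bookkeeping of dimensions, states are regarded as functions of the values
of infinitely many wires that depend on finitely many of them only (`Amp`, `DependsBelow`).
`Impl U G Ψ Φ` says that the gadget `G` maps the amplitude `Ψ` to `Φ`, and the rules `Impl.seq` and
`Impl.wrap` account for the ancillas. -/

namespace XQP

open Turing

/-! ### Runs of stack machines -/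

section Reaches

variable {K : Type} [DecidableEq K] {Γ : K → Type} {Λ σ : Type}

/-- The machine `M` gets from `a` to `b` in at most `n` steps. -/
def ReachesIn (M : Λ → TM2.Stmt Γ Λ σ) (n : ℕ) (a b : TM2.Cfg Γ Λ σ) : Prop :=
  ∃ m ≤ n, (_root_.flip bind (TM2.step M))^[m] (some a) = some b

variable {M : Λ → TM2.Stmt Γ Λ σ}

/-- A machine that has halted makes no further steps. -/
theorem iterate_step_none (m : ℕ) : (_root_.flip bind (TM2.step M))^[m] none = none := by
  induction m with
  | zero => rfl
  | succ m ih => rw [Function.iterate_succ_apply]; exact ih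

theorem ReachesIn.refl (a : TM2.Cfg Γ Λ σ) : ReachesIn M 0 a a := ⟨0, le_rfl, rfl⟩

theorem ReachesIn.mono {n n' : ℕ} {a b : TM2.Cfg Γ Λ σ} (h : ReachesIn M n a b) (hn : n ≤ n') :
    ReachesIn M n' a b := by
  obtain ⟨m, hm, h⟩ := h
  exact ⟨m, hm.trans hn, h⟩

theorem ReachesIn.trans {n n' : ℕ} {a b c : TM2.Cfg Γ Λ σ} (h : ReachesIn M n a b)
    (h' : ReachesIn M n' b c) : ReachesIn M (n + n') a c := by
  obtain ⟨m, hm, h⟩ := h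
  obtain ⟨m', hm', h'⟩ := h'
  exact ⟨m' + m, by omega, by rw [Function.iterate_add_apply, h, h']⟩

theorem ReachesIn.step {n : ℕ} {l : Λ} {v : σ} {S : ∀ k, List (Γ k)} {c : TM2.Cfg Γ Λ σ}
    (h : ReachesIn M n (TM2.stepAux (M l) v S) c) : ReachesIn M (n + 1) ⟨some l, v, S⟩ c := by
  obtain ⟨m, hm, h⟩ := h
  exact ⟨m + 1, by omega, by rw [Function.iterate_succ_apply]; exact h⟩

end Reaches

/-- The store in which all stacks but `k` are empty. -/
def single {K : Type} [DecidableEq K] {Γ : K → Type} (k : K) (l : List (Γ k)) :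
    ∀ k, List (Γ k) := fun k' => if h : k' = k then h ▸ l else []

theorem initList_eq (tm : FinTM2) (s : List (tm.Γ tm.k₀)) :
    initList tm s = ⟨some tm.main, tm.initialState, single tm.k₀ s⟩ := by
  unfold initList single
  congr 1
  funext k
  by_cases h : k = tm.k₀
  · subst h; simp
  · simp [h]

theorem haltList_eq (tm : FinTM2) (s : List (tm.Γ tm.k₁)) :
    haltList tm s = ⟨none, tm.initialState, single tm.k₁ s⟩ := by
  unfold haltList single
  congr 1
  funext k
  by_cases h : k = tm.k₁
  · subst h; simp
  · simp [h]

/-- A machine that maps `ea a` to `eb (f a)` within a polynomial number of steps proves that `f` is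
computable in polynomial time. -/
theorem computable_of_reachesIn {α β αΓ βΓ : Type} {ea : α → List αΓ} {eb : β → List βΓ}
    {f : α → β} (tm : FinTM2) (i : tm.Γ tm.k₀ ≃ αΓ) (o : tm.Γ tm.k₁ ≃ βΓ) (p : Polynomial ℕ)
    (h : ∀ a, ReachesIn tm.m (p.eval (ea a).length)
      ⟨some tm.main, tm.initialState, single tm.k₀ ((ea a).map i.symm)⟩
      ⟨none, tm.initialState, single tm.k₁ ((eb (f a)).map o.symm)⟩) :
    Nonempty (TM2ComputableInPolyTime ea eb f) := by
  unfold ReachesIn at h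
  choose m hm h using h
  refine ⟨⟨⟨tm, i, o⟩, p, fun a => ⟨⟨m a, ?_⟩, hm a⟩⟩⟩
  have := h a
  simp only [Option.map_some, initList_eq, haltList_eq]
  exact this

theorem reachesIn_of_computable {α β αΓ βΓ : Type} {ea : α → List αΓ} {eb : β → List βΓ}
    {f : α → β} (h : TM2ComputableInPolyTime ea eb f) (a : α) :
    ReachesIn h.tm.m (h.time.eval (ea a).length)
      ⟨some h.tm.main, h.tm.initialState,
        single h.tm.k₀ ((ea a).map h.inputAlphabet.symm)⟩
      ⟨none, h.tm.initialState, single h.tm.k₁ ((eb (f a)).map h.outputAlphabet.symm)⟩ := by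
  have := h.outputsFun a
  refine ⟨this.steps, this.steps_le_m, ?_⟩
  have := this.evals_in_steps
  simp only [Option.map_some, initList_eq, haltList_eq] at this
  exact this

/-! ### The output of a machine is at most linear in its running time -/

section Pushes

variable {K : Type} [DecidableEq K] {Γ : K → Type} {Λ σ : Type}

/-- An upper bound on the number of symbols pushed in one execution of a statement. -/
def pushes : TM2.Stmt Γ Λ σ → ℕ
  | .push _ _ q => pushes q + 1
  | .peek _ _ q => pushes q
  | .pop _ _ q => pushes q
  | .load _ q => pushes q
  | .branch _ q₁ q₂ => max (pushes q₁) (pushes q₂)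
  | .goto _ => 0
  | .halt => 0

/-- One execution of a statement lengthens a stack by at most the number of symbols it pushes. -/
theorem length_stepAux_le (q : TM2.Stmt Γ Λ σ) (v : σ) (S : ∀ k, List (Γ k)) (k : K) :
    ((TM2.stepAux q v S).stk k).length ≤ (S k).length + pushes q := by
  induction q generalizing v S with
  | push k' f q ih =>
    refine (ih _ _).trans ?_
    by_cases h : k = k'
    · subst h; simp [pushes]; omega
    · simp [pushes, h]
  | peek k' f q ih => exact ih _ _
  | pop k' f q ih =>
    refine (ih _ _).trans ?_
    by_cases h : k = k'
    · subst h; simp [pushes]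
    · simp [pushes, h]
  | load f q ih => exact ih _ _
  | branch f q₁ q₂ ih₁ ih₂ =>
    simp only [TM2.stepAux, pushes]
    cases f v
    · exact (ih₂ _ _).trans (by simp)
    · exact (ih₁ _ _).trans (by simp)
  | goto l => simp [TM2.stepAux, pushes]
  | halt => simp [TM2.stepAux, pushes]

theorem length_le_of_reachesIn [Fintype Λ] {M : Λ → TM2.Stmt Γ Λ σ} {n : ℕ}
    {a b : TM2.Cfg Γ Λ σ} (h : ReachesIn M n a b) (k : K) :
    (b.stk k).length ≤ (a.stk k).length + n * Finset.univ.sup (fun l => pushes (M l)) := by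
  obtain ⟨m, hm, h⟩ := h
  set c := Finset.univ.sup (fun l => pushes (M l)) with hc
  have key : ∀ m (a : TM2.Cfg Γ Λ σ), (_root_.flip bind (TM2.step M))^[m] (some a) = some b →
      (b.stk k).length ≤ (a.stk k).length + m * c := by
    intro m
    induction m with
    | zero => intro a h; cases h; simp
    | succ m ih =>
      rintro ⟨l, v, S⟩ h
      rw [Function.iterate_succ_apply] at h
      cases l with
      | none =>
        have h' : (_root_.flip bind (TM2.step M))^[m] none = some b := h
        rw [iterate_step_none] at h'
        cases h'
      | some l =>
        have h1 := ih (TM2.stepAux (M l) v S) h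
        have h2 := length_stepAux_le (M l) v S k
        have h3 : pushes (M l) ≤ c := Finset.le_sup (f := fun l => pushes (M l)) (Finset.mem_univ l)
        have : (m + 1) * c = m * c + c := by ring
        simp only at *
        omega
  refine (key m a h).trans ?_
  have := Nat.mul_le_mul_right c hm
  omega

end Pushes

theorem polynomial_eval_mono (p : Polynomial ℕ) : Monotone fun n => p.eval n := by
  intro a b h
  simp only [Polynomial.eval_eq_sum_range]
  exact Finset.sum_le_sum fun i _ => Nat.mul_le_mul_left _ (Nat.pow_le_pow_left h i)

/-- The length of the output of a polynomial-time function is polynomially bounded. -/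
theorem exists_output_bound {α β αΓ βΓ : Type} {ea : α → List αΓ} {eb : β → List βΓ}
    {f : α → β} (h : TM2ComputableInPolyTime ea eb f) :
    ∃ p : Polynomial ℕ, ∀ a, (eb (f a)).length ≤ p.eval (ea a).length := by
  let _ := h.tm.ΛFin
  refine ⟨Polynomial.X + h.time * Polynomial.C
    (Finset.univ.sup fun l => pushes (h.tm.m l)), fun a => ?_⟩
  have := length_le_of_reachesIn (reachesIn_of_computable h a) h.tm.k₁
  simp only [Polynomial.eval_add, Polynomial.eval_X, Polynomial.eval_mul, Polynomial.eval_C]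
  refine le_trans ?_ (this.trans (Nat.add_le_add_right ?_ _))
  · simp [single]
  · simp only [single]
    split_ifs with h'
    · have : ∀ (k : h.tm.K) (h' : k = h.tm.k₀) (l : List (h.tm.Γ h.tm.k₀)),
          (h' ▸ l : List (h.tm.Γ k)).length = l.length := by
        intro k h' l; subst h'; rfl
      rw [this _ h']; simp
    · simp

/-! ### Composition of polynomial-time functions -/

section Comp

variable (M₁ M₂ : FinTM2)

/-- The stacks of the composed machine: those of both machines, and one to reverse the
intermediate string. -/
def CompΓ : M₁.K ⊕ Option M₂.K → Type
  | .inl k => M₁.Γ k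
  | .inr (some k) => M₂.Γ k
  | .inr none => M₂.Γ M₂.k₀

/-- The labels of the composed machine: those of both machines and those of the transfer of the
intermediate string. In the label `(b, o)` of the transfer, `b` tells whether the string is on its
way out of or into the reversing stack, and `o` is the symbol about to be pushed, if any. -/
abbrev CompΛ : Type := M₁.Λ ⊕ M₂.Λ ⊕ Bool × Option (M₂.Γ M₂.k₀)

/-- The local states of the composed machine. -/
abbrev Compσ : Type := M₁.σ × M₂.σ × Option (M₂.Γ M₂.k₀)

variable {M₁ M₂}

/-- The store of the composed machine, assembled from its parts. -/
def compStore (S₁ : ∀ k, List (M₁.Γ k)) (S₂ : ∀ k, List (M₂.Γ k)) (T : List (M₂.Γ M₂.k₀)) :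
    ∀ k, List (CompΓ M₁ M₂ k)
  | .inl k => S₁ k
  | .inr (some k) => S₂ k
  | .inr none => T

theorem update_compStore_inl (S₁ : ∀ k, List (M₁.Γ k)) (S₂ : ∀ k, List (M₂.Γ k))
    (T : List (M₂.Γ M₂.k₀)) (k : M₁.K) (l : List (M₁.Γ k)) :
    Function.update (β := fun k => List (CompΓ M₁ M₂ k)) (compStore S₁ S₂ T) (Sum.inl k) l =
      compStore (Function.update S₁ k l) S₂ T := by
  funext k'
  rcases k' with k' | k' | k'
  · by_cases h : k' = k
    · subst h
      exact (Function.update_self (β := fun k => List (CompΓ M₁ M₂ k)) (Sum.inl k') l _).trans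
        (Function.update_self k' l S₁).symm
    · refine (dif_neg (by simpa using h)).trans ?_
      exact (dif_neg h : Function.update S₁ k l k' = _).symm
  · exact dif_neg (by simp)
  · exact dif_neg (by simp)

theorem update_compStore_some (S₁ : ∀ k, List (M₁.Γ k)) (S₂ : ∀ k, List (M₂.Γ k))
    (T : List (M₂.Γ M₂.k₀)) (k : M₂.K) (l : List (M₂.Γ k)) :
    Function.update (β := fun k => List (CompΓ M₁ M₂ k)) (compStore S₁ S₂ T)
      (Sum.inr (some k)) l = compStore S₁ (Function.update S₂ k l) T := by
  funext k'
  rcases k' with k' | k' | k'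
  · exact dif_neg (by simp)
  · exact dif_neg (by simp)
  · by_cases h : k' = k
    · subst h
      exact (Function.update_self (β := fun k => List (CompΓ M₁ M₂ k)) (Sum.inr (some k')) l
        _).trans (Function.update_self k' l S₂).symm
    · refine (dif_neg (by simpa using h)).trans ?_
      exact (dif_neg h : Function.update S₂ k l k' = _).symm

theorem update_compStore_none (S₁ : ∀ k, List (M₁.Γ k)) (S₂ : ∀ k, List (M₂.Γ k))
    (T l : List (M₂.Γ M₂.k₀)) :
    Function.update (β := fun k => List (CompΓ M₁ M₂ k)) (compStore S₁ S₂ T)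
      (Sum.inr none) l = compStore S₁ S₂ l := by
  funext k'
  rcases k' with k' | k' | k'
  · exact dif_neg (by simp)
  · exact Function.update_self (β := fun k => List (CompΓ M₁ M₂ k)) (Sum.inr none) l _
  · exact dif_neg (by simp)

/-- The statements of the first machine as statements of the composed machine: instead of halting,
the transfer is started. -/
def embedFst : TM2.Stmt M₁.Γ M₁.Λ M₁.σ → TM2.Stmt (CompΓ M₁ M₂) (CompΛ M₁ M₂) (Compσ M₁ M₂)
  | .push k f q => .push (Sum.inl k) (fun v => f v.1) (embedFst q)
  | .peek k f q => .peek (Sum.inl k) (fun v o => (f v.1 o, v.2)) (embedFst q)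
  | .pop k f q => .pop (Sum.inl k) (fun v o => (f v.1 o, v.2)) (embedFst q)
  | .load f q => .load (fun v => (f v.1, v.2)) (embedFst q)
  | .branch f q₁ q₂ => .branch (fun v => f v.1) (embedFst q₁) (embedFst q₂)
  | .goto l => .goto (fun v => Sum.inl (l v.1))
  | .halt => .goto (fun _ => Sum.inr (Sum.inr (false, none)))

/-- The statements of the second machine as statements of the composed machine. -/
def embedSnd : TM2.Stmt M₂.Γ M₂.Λ M₂.σ → TM2.Stmt (CompΓ M₁ M₂) (CompΛ M₁ M₂) (Compσ M₁ M₂)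
  | .push k f q => .push (Sum.inr (some k)) (fun v => f v.2.1) (embedSnd q)
  | .peek k f q => .peek (Sum.inr (some k)) (fun v o => (v.1, f v.2.1 o, v.2.2)) (embedSnd q)
  | .pop k f q => .pop (Sum.inr (some k)) (fun v o => (v.1, f v.2.1 o, v.2.2)) (embedSnd q)
  | .load f q => .load (fun v => (v.1, f v.2.1, v.2.2)) (embedSnd q)
  | .branch f q₁ q₂ => .branch (fun v => f v.2.1) (embedSnd q₁) (embedSnd q₂)
  | .goto l => .goto (fun v => Sum.inr (Sum.inl (l v.2.1)))
  | .halt => .halt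

/-- Configurations of the first machine as configurations of the composed machine. -/
def cfgFst (w : M₂.σ × Option (M₂.Γ M₂.k₀)) (S₂ : ∀ k, List (M₂.Γ k)) (T : List (M₂.Γ M₂.k₀))
    (c : TM2.Cfg M₁.Γ M₁.Λ M₁.σ) : TM2.Cfg (CompΓ M₁ M₂) (CompΛ M₁ M₂) (Compσ M₁ M₂) :=
  ⟨some (c.l.elim (Sum.inr (Sum.inr (false, none))) Sum.inl), (c.var, w), compStore c.stk S₂ T⟩

/-- Configurations of the second machine as configurations of the composed machine. -/
def cfgSnd (u : M₁.σ) (w : Option (M₂.Γ M₂.k₀)) (S₁ : ∀ k, List (M₁.Γ k))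
    (T : List (M₂.Γ M₂.k₀)) (c : TM2.Cfg M₂.Γ M₂.Λ M₂.σ) :
    TM2.Cfg (CompΓ M₁ M₂) (CompΛ M₁ M₂) (Compσ M₁ M₂) :=
  ⟨c.l.map (fun l => Sum.inr (Sum.inl l)), (u, c.var, w), compStore S₁ c.stk T⟩

theorem stepAux_embedFst (q : TM2.Stmt M₁.Γ M₁.Λ M₁.σ) (v : M₁.σ)
    (w : M₂.σ × Option (M₂.Γ M₂.k₀)) (S₁ : ∀ k, List (M₁.Γ k)) (S₂ : ∀ k, List (M₂.Γ k))
    (T : List (M₂.Γ M₂.k₀)) :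
    TM2.stepAux (embedFst q) (v, w) (compStore S₁ S₂ T) =
      cfgFst w S₂ T (TM2.stepAux q v S₁) := by
  induction q generalizing v S₁ with
  | push k f q ih =>
    simp only [embedFst, TM2.stepAux]
    rw [← ih, ← update_compStore_inl]; rfl
  | peek k f q ih => simp only [embedFst, TM2.stepAux]; rw [← ih]; rfl
  | pop k f q ih =>
    simp only [embedFst, TM2.stepAux]
    rw [← ih, ← update_compStore_inl]; rfl
  | load f q ih => simp only [embedFst, TM2.stepAux]; rw [← ih]
  | branch f q₁ q₂ ih₁ ih₂ =>
    simp only [embedFst, TM2.stepAux]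
    cases f v
    · simpa using ih₂ v S₁
    · simpa using ih₁ v S₁
  | goto l => rfl
  | halt => rfl

theorem stepAux_embedSnd (q : TM2.Stmt M₂.Γ M₂.Λ M₂.σ) (u : M₁.σ) (v : M₂.σ)
    (w : Option (M₂.Γ M₂.k₀)) (S₁ : ∀ k, List (M₁.Γ k)) (S₂ : ∀ k, List (M₂.Γ k))
    (T : List (M₂.Γ M₂.k₀)) :
    TM2.stepAux (embedSnd q) (u, v, w) (compStore S₁ S₂ T) =
      cfgSnd u w S₁ T (TM2.stepAux q v S₂) := by
  induction q generalizing v S₂ with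
  | push k f q ih =>
    simp only [embedSnd, TM2.stepAux]
    rw [← ih, ← update_compStore_some]; rfl
  | peek k f q ih => simp only [embedSnd, TM2.stepAux]; rw [← ih]; rfl
  | pop k f q ih =>
    simp only [embedSnd, TM2.stepAux]
    rw [← ih, ← update_compStore_some]; rfl
  | load f q ih => simp only [embedSnd, TM2.stepAux]; rw [← ih]
  | branch f q₁ q₂ ih₁ ih₂ =>
    simp only [embedSnd, TM2.stepAux]
    cases f v
    · simpa using ih₂ v S₂
    · simpa using ih₁ v S₂
  | goto l => rfl
  | halt => rfl

/-- The program of the composed machine. -/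
def compStmt (e : M₁.Γ M₁.k₁ ≃ M₂.Γ M₂.k₀) :
    CompΛ M₁ M₂ → TM2.Stmt (CompΓ M₁ M₂) (CompΛ M₁ M₂) (Compσ M₁ M₂)
  | .inl l => embedFst (M₁.m l)
  | .inr (.inl l) => embedSnd (M₂.m l)
  | .inr (.inr (false, none)) =>
    .pop (Sum.inl M₁.k₁) (fun v o => (v.1, v.2.1, Option.map e o)) <|
      .goto fun v => v.2.2.elim (Sum.inr (Sum.inr (true, none)))
        fun x => Sum.inr (Sum.inr (false, some x))
  | .inr (.inr (false, some x)) =>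
    .push (Sum.inr none) (fun _ => x) (.goto fun _ => Sum.inr (Sum.inr (false, none)))
  | .inr (.inr (true, none)) =>
    .pop (Sum.inr none) (fun v o => (v.1, v.2.1, o)) <|
      .goto fun v => v.2.2.elim (Sum.inr (Sum.inl M₂.main))
        fun x => Sum.inr (Sum.inr (true, some x))
  | .inr (.inr (true, some x)) =>
    .push (Sum.inr (some M₂.k₀)) (fun _ => x) (.goto fun _ => Sum.inr (Sum.inr (true, none)))

variable (e : M₁.Γ M₁.k₁ ≃ M₂.Γ M₂.k₀)

/-- The composed machine simulates the first machine step by step. Its other stacks are not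
affected. -/
theorem reachesIn_cfgFst {n : ℕ} {c d : TM2.Cfg M₁.Γ M₁.Λ M₁.σ} (h : ReachesIn M₁.m n c d)
    (w : M₂.σ × Option (M₂.Γ M₂.k₀)) (S₂ : ∀ k, List (M₂.Γ k))
    (T : List (M₂.Γ M₂.k₀)) :
    ReachesIn (compStmt e) n (cfgFst w S₂ T c) (cfgFst w S₂ T d) := by
  obtain ⟨m, hm, h⟩ := h
  refine ReachesIn.mono ?_ hm
  clear hm
  induction m generalizing c with
  | zero => cases h; exact ReachesIn.refl _
  | succ m ih =>
    rw [Function.iterate_succ_apply] at h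
    obtain ⟨l, v, S⟩ := c
    cases l with
    | none =>
      have h' : (_root_.flip bind (TM2.step M₁.m))^[m] none = some d := h
      rw [iterate_step_none] at h'
      cases h'
    | some l =>
      have h1 := ih (c := TM2.stepAux (M₁.m l) v S) h
      rw [← stepAux_embedFst] at h1
      exact h1.step

/-- The composed machine simulates the second machine step by step. Its other stacks are not
affected. -/
theorem reachesIn_cfgSnd {n : ℕ} {c d : TM2.Cfg M₂.Γ M₂.Λ M₂.σ} (h : ReachesIn M₂.m n c d)
    (u : M₁.σ) (w : Option (M₂.Γ M₂.k₀)) (S₁ : ∀ k, List (M₁.Γ k)) (T : List (M₂.Γ M₂.k₀)) :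
    ReachesIn (compStmt e) n (cfgSnd u w S₁ T c) (cfgSnd u w S₁ T d) := by
  obtain ⟨m, hm, h⟩ := h
  refine ReachesIn.mono ?_ hm
  clear hm
  induction m generalizing c with
  | zero => cases h; exact ReachesIn.refl _
  | succ m ih =>
    rw [Function.iterate_succ_apply] at h
    obtain ⟨l, v, S⟩ := c
    cases l with
    | none =>
      have h' : (_root_.flip bind (TM2.step M₂.m))^[m] none = some d := h
      rw [iterate_step_none] at h'
      cases h'
    | some l =>
      have h1 := ih (c := TM2.stepAux (M₂.m l) v S) h
      rw [← stepAux_embedSnd] at h1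
      exact h1.step

theorem single_self {K : Type} [DecidableEq K] {Γ : K → Type} (k : K) (l : List (Γ k)) :
    single k l k = l := by simp [single]

theorem update_single {K : Type} [DecidableEq K] {Γ : K → Type} (k : K) (l l' : List (Γ k)) :
    Function.update (single k l) k l' = single k l' := by
  funext k'
  by_cases h : k' = k
  · subst h; simp [single]
  · simp [single, h]

theorem single_nil {K : Type} [DecidableEq K] {Γ : K → Type} (k : K) :
    single (Γ := Γ) k [] = fun _ => [] := by
  funext k'
  by_cases h : k' = k
  · subst h; simp [single]
  · simp [single, h]

theorem single_compStore_inl (k : M₁.K) (l : List (M₁.Γ k)) :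
    single (Γ := CompΓ M₁ M₂) (Sum.inl k) l = compStore (single k l) (fun _ => []) [] := by
  funext k'
  rcases k' with k' | k' | k'
  · by_cases h : k' = k
    · subst h
      exact (single_self (Γ := CompΓ M₁ M₂) (Sum.inl k') l).trans (single_self k' l).symm
    · refine (dif_neg (by simpa using h)).trans ?_
      exact (dif_neg h : single k l k' = []).symm
  · exact dif_neg (by simp)
  · exact dif_neg (by simp)

theorem single_compStore_some (k : M₂.K) (l : List (M₂.Γ k)) :
    single (Γ := CompΓ M₁ M₂) (Sum.inr (some k)) l = compStore (fun _ => []) (single k l) [] := by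
  funext k'
  rcases k' with k' | k' | k'
  · exact dif_neg (by simp)
  · exact dif_neg (by simp)
  · by_cases h : k' = k
    · subst h
      exact (single_self (Γ := CompΓ M₁ M₂) (Sum.inr (some k')) l).trans (single_self k' l).symm
    · refine (dif_neg (by simpa using h)).trans ?_
      exact (dif_neg h : single k l k' = []).symm

/-- First half of the transfer: the output of the first machine is moved to the reversing stack. -/
theorem transfer_out (u : M₁.σ) (v : M₂.σ) (w : Option (M₂.Γ M₂.k₀)) (l : List (M₁.Γ M₁.k₁))
    (S₂ : ∀ k, List (M₂.Γ k)) (T : List (M₂.Γ M₂.k₀)) :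
    ReachesIn (compStmt e) (2 * l.length + 1)
      ⟨some (Sum.inr (Sum.inr (false, none))), (u, v, w), compStore (single M₁.k₁ l) S₂ T⟩
      ⟨some (Sum.inr (Sum.inr (true, none))), (u, v, none),
        compStore (fun _ => []) S₂ ((l.map e).reverse ++ T)⟩ := by
  have pop : ∀ l w T, TM2.stepAux (compStmt e (Sum.inr (Sum.inr (false, none)))) (u, v, w)
      (compStore (single M₁.k₁ l) S₂ T) =
      ⟨some ((Option.map e l.head?).elim (Sum.inr (Sum.inr (true, none)))
        fun x => Sum.inr (Sum.inr (false, some x))), (u, v, Option.map e l.head?),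
        compStore (single M₁.k₁ l.tail) S₂ T⟩ := by
    intro l w T
    have : TM2.stepAux (compStmt e (Sum.inr (Sum.inr (false, none)))) (u, v, w)
      (compStore (single M₁.k₁ l) S₂ T) =
      ⟨some ((Option.map e (single M₁.k₁ l M₁.k₁).head?).elim (Sum.inr (Sum.inr (true, none)))
        fun x => Sum.inr (Sum.inr (false, some x))),
        (u, v, Option.map e (single M₁.k₁ l M₁.k₁).head?),
        Function.update (β := fun k => List (CompΓ M₁ M₂ k)) (compStore (single M₁.k₁ l) S₂ T)
          (Sum.inl M₁.k₁) (single M₁.k₁ l M₁.k₁).tail⟩ := rfl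
    rw [this, update_compStore_inl, single_self, update_single]
  have push : ∀ x l w T, TM2.stepAux (compStmt e (Sum.inr (Sum.inr (false, some x)))) (u, v, w)
      (compStore (single M₁.k₁ l) S₂ T) =
      ⟨some (Sum.inr (Sum.inr (false, none))), (u, v, w),
        compStore (single M₁.k₁ l) S₂ (x :: T)⟩ := by
    intro x l w T
    have : TM2.stepAux (compStmt e (Sum.inr (Sum.inr (false, some x)))) (u, v, w)
      (compStore (single M₁.k₁ l) S₂ T) =
      ⟨some (Sum.inr (Sum.inr (false, none))), (u, v, w),
        Function.update (β := fun k => List (CompΓ M₁ M₂ k)) (compStore (single M₁.k₁ l) S₂ T)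
          (Sum.inr none) (x :: T)⟩ := rfl
    exact this.trans (congrArg _ (update_compStore_none _ _ _ _))
  induction l generalizing w T with
  | nil =>
    apply ReachesIn.step
    rw [pop, List.tail_nil, single_nil]
    exact ReachesIn.refl _
  | cons x l ih =>
    refine ReachesIn.mono (n := (2 * l.length + 1) + 1 + 1) ?_ (by simp; omega)
    apply ReachesIn.step
    rw [pop]
    apply ReachesIn.step
    simp only [List.head?_cons, Option.map_some, Option.elim_some, List.tail_cons]
    rw [push]
    have := ih (some (e x)) (e x :: T)
    simp only [List.map_cons, List.reverse_cons, List.append_assoc, List.singleton_append]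
    exact this

/-- Second half of the transfer: the string is moved to the input stack of the second machine. -/
theorem transfer_in (u : M₁.σ) (v : M₂.σ) (w : Option (M₂.Γ M₂.k₀)) (l : List (M₂.Γ M₂.k₀))
    (S₁ : ∀ k, List (M₁.Γ k)) (T : List (M₂.Γ M₂.k₀)) :
    ReachesIn (compStmt e) (2 * T.length + 1)
      ⟨some (Sum.inr (Sum.inr (true, none))), (u, v, w), compStore S₁ (single M₂.k₀ l) T⟩
      ⟨some (Sum.inr (Sum.inl M₂.main)), (u, v, none),
        compStore S₁ (single M₂.k₀ (T.reverse ++ l)) []⟩ := by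
  have pop : ∀ l w T, TM2.stepAux (compStmt e (Sum.inr (Sum.inr (true, none)))) (u, v, w)
      (compStore S₁ (single M₂.k₀ l) T) =
      ⟨some (T.head?.elim (Sum.inr (Sum.inl M₂.main))
        fun x => Sum.inr (Sum.inr (true, some x))), (u, v, T.head?),
        compStore S₁ (single M₂.k₀ l) T.tail⟩ := by
    intro l w T
    have : TM2.stepAux (compStmt e (Sum.inr (Sum.inr (true, none)))) (u, v, w)
      (compStore S₁ (single M₂.k₀ l) T) =
      ⟨some (T.head?.elim (Sum.inr (Sum.inl M₂.main))
        fun x => Sum.inr (Sum.inr (true, some x))), (u, v, T.head?),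
        Function.update (β := fun k => List (CompΓ M₁ M₂ k)) (compStore S₁ (single M₂.k₀ l) T)
          (Sum.inr none) T.tail⟩ := rfl
    exact this.trans (congrArg _ (update_compStore_none _ _ _ _))
  have push : ∀ x l w T, TM2.stepAux (compStmt e (Sum.inr (Sum.inr (true, some x)))) (u, v, w)
      (compStore S₁ (single M₂.k₀ l) T) =
      ⟨some (Sum.inr (Sum.inr (true, none))), (u, v, w),
        compStore S₁ (single M₂.k₀ (x :: l)) T⟩ := by
    intro x l w T
    have : TM2.stepAux (compStmt e (Sum.inr (Sum.inr (true, some x)))) (u, v, w)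
      (compStore S₁ (single M₂.k₀ l) T) =
      ⟨some (Sum.inr (Sum.inr (true, none))), (u, v, w),
        Function.update (β := fun k => List (CompΓ M₁ M₂ k)) (compStore S₁ (single M₂.k₀ l) T)
          (Sum.inr (some M₂.k₀)) (x :: single M₂.k₀ l M₂.k₀)⟩ := rfl
    rw [single_self] at this
    refine this.trans (congrArg _ ((update_compStore_some _ _ _ _ _).trans ?_))
    exact congrArg (fun S => compStore S₁ S T) (update_single _ _ _)
  induction T generalizing w l with
  | nil =>
    apply ReachesIn.step
    rw [pop]
    exact ReachesIn.refl _
  | cons x T ih =>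
    refine ReachesIn.mono (n := (2 * T.length + 1) + 1 + 1) ?_ (by simp; omega)
    apply ReachesIn.step
    rw [pop]
    apply ReachesIn.step
    simp only [List.head?_cons, Option.elim_some, List.tail_cons]
    rw [push]
    have := ih (some x) (x :: l)
    simp only [List.reverse_cons, List.append_assoc, List.singleton_append]
    exact this

/-- The composition of two machines: the first one runs on its own stacks, its output is moved to
the input stack of the second one, and the second one runs. -/
def compTM (e : M₁.Γ M₁.k₁ ≃ M₂.Γ M₂.k₀) : FinTM2 :=
  let _ := M₁.kFin
  let _ := M₂.kFin
  let _ := M₁.ΛFin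
  let _ := M₂.ΛFin
  let _ := M₁.σFin
  let _ := M₂.σFin
  let _ := M₂.Γk₀Fin
  { K := M₁.K ⊕ Option M₂.K
    k₀ := Sum.inl M₁.k₀
    k₁ := Sum.inr (some M₂.k₁)
    Γk₀Fin := M₁.Γk₀Fin
    Γ := CompΓ M₁ M₂
    Λ := CompΛ M₁ M₂
    main := Sum.inl M₁.main
    σ := Compσ M₁ M₂
    initialState := (M₁.initialState, M₂.initialState, none)
    m := compStmt e }

end Comp

/-- The composition of two functions computable in polynomial time is computable in polynomial
time. -/
theorem computable_comp {α β γ αΓ βΓ γΓ : Type} {ea : α → List αΓ} {eb : β → List βΓ}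
    {ec : γ → List γΓ} {f : α → β} {g : β → γ}
    (hf : Nonempty (TM2ComputableInPolyTime ea eb f))
    (hg : Nonempty (TM2ComputableInPolyTime eb ec g)) :
    Nonempty (TM2ComputableInPolyTime ea ec (g ∘ f)) := by
  obtain ⟨hf⟩ := hf
  obtain ⟨hg⟩ := hg
  obtain ⟨p, hp⟩ := exists_output_bound hf
  set e := hf.outputAlphabet.trans hg.inputAlphabet.symm with he
  -- the second machine runs for `hg.time` in the length of the intermediate string, at most `p`
  refine computable_of_reachesIn (compTM e) hf.inputAlphabet hg.outputAlphabet
    (hf.time + (2 * p + 1) + (2 * p + 1) + hg.time.comp p) fun a => ?_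
  have h1 := reachesIn_cfgFst e (reachesIn_of_computable hf a) (hg.tm.initialState, none)
    (fun _ => []) []
  have h2 := transfer_out e hf.tm.initialState hg.tm.initialState none
    ((eb (f a)).map hf.outputAlphabet.symm) (fun _ => []) []
  have h3 := transfer_in e hf.tm.initialState hg.tm.initialState none []
    (fun _ => []) ((((eb (f a)).map hf.outputAlphabet.symm).map e).reverse ++ [])
  have h4 := reachesIn_cfgSnd e (reachesIn_of_computable hg (f a)) hf.tm.initialState none
    (fun _ => []) []
  rw [single_nil] at h3
  have hmap : (((eb (f a)).map hf.outputAlphabet.symm).map e) =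
      (eb (f a)).map hg.inputAlphabet.symm := by
    rw [List.map_map]
    congr 1
    funext x
    simp [he]
  simp only [hmap, List.append_nil, List.reverse_reverse] at h2 h3
  have h := ((h1.trans h2).trans h3).trans h4
  simp only [cfgFst, cfgSnd, Option.elim, Option.map] at h
  rw [← single_compStore_inl, ← single_compStore_some] at h
  refine ReachesIn.mono h ?_
  have := polynomial_eval_mono hg.time (hp a)
  simp only [Polynomial.eval_add, Polynomial.eval_mul, Polynomial.eval_comp, List.length_map,
      List.length_reverse, Polynomial.eval_one, Polynomial.eval_ofNat]
  have := hp a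
  simp only at *
  omega

/-! ### Structured programs on stacks -/

section Prog

variable {K : Type} {Γ : K → Type}

/-- Structured programs on a family of stacks. `loop k halts body` pops a symbol from the stack `k`
(the result is `none` if the stack is empty), runs the body that belongs to the result, and
repeats this until a result with `halts` has been dealt with. -/
inductive Prog (Γ : K → Type) : Type
  | skip : Prog Γ
  | push (k : K) (a : Γ k) : Prog Γ
  | seq (p q : Prog Γ) : Prog Γ
  | loop (k : K) (halts : Option (Γ k) → Bool) (body : Option (Γ k) → Prog Γ) : Prog Γ

/-- The control positions of a program. -/
def Prog.Lab : Prog Γ → Type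
  | .skip => Unit
  | .push _ _ => Unit
  | .seq p q => p.Lab ⊕ q.Lab
  | .loop _ _ body => Option (Σ o, (body o).Lab)

/-- The control position at which a program starts. -/
def Prog.entry : (p : Prog Γ) → p.Lab
  | .skip => ()
  | .push _ _ => ()
  | .seq p _ => Sum.inl p.entry
  | .loop _ _ _ => none

theorem Prog.finite_lab [∀ k, Finite (Γ k)] (p : Prog Γ) : Finite p.Lab := by
  induction p with
  | skip => exact inferInstanceAs (Finite Unit)
  | push k a => exact inferInstanceAs (Finite Unit)
  | seq p q ihp ihq => exact inferInstanceAs (Finite (p.Lab ⊕ q.Lab))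
  | loop k halts body ih => exact inferInstanceAs (Finite (Option (Σ o, (body o).Lab)))

variable [DecidableEq K]

/-- `Run p s t s'`: the program `p`, started with the stacks `s`, ends after at most `t` steps with
the stacks `s'`. -/
inductive Run : Prog Γ → (∀ k, List (Γ k)) → ℕ → (∀ k, List (Γ k)) → Prop
  | skip (s) : Run .skip s 1 s
  | push (k a s) : Run (.push k a) s 1 (Function.update s k (a :: s k))
  | seq {p q s s' s'' t t'} (h : Run p s t s') (h' : Run q s' t' s'') :
      Run (.seq p q) s (t + t') s''
  | loop_last {k halts body s s' t} (hs : halts (s k).head? = true)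
      (h : Run (body (s k).head?) (Function.update s k (s k).tail) t s') :
      Run (.loop k halts body) s (t + 1) s'
  | loop_next {k halts body s s' s'' t t'} (hs : halts (s k).head? = false)
      (h : Run (body (s k).head?) (Function.update s k (s k).tail) t s')
      (h' : Run (.loop k halts body) s' t' s'') :
      Run (.loop k halts body) s (t + t' + 1) s''
  | mono {p s s' t t'} (h : Run p s t s') (ht : t ≤ t') : Run p s t' s'

theorem Run.congr {p : Prog Γ} {s s' u u' : ∀ k, List (Γ k)} {t t' : ℕ} (h : Run p s t s')
    (hs : s = u) (hs' : s' = u') (ht : t ≤ t') : Run p u t' u' := by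
  subst hs hs'
  exact h.mono ht

/-- A program pushes at most one symbol in each step. -/
theorem Run.length_le {p : Prog Γ} {s s' : ∀ k, List (Γ k)} {t : ℕ} (h : Run p s t s') (k : K) :
    (s' k).length ≤ (s k).length + t := by
  have hpop : ∀ (s : ∀ k, List (Γ k)) (k' : K),
      (Function.update s k' (s k').tail k).length ≤ (s k).length := by
    intro s k'
    by_cases h : k = k'
    · subst h; simp
    · simp [h]
  induction h with
  | skip s => simp
  | push k' a s =>
    by_cases h : k = k'
    · subst h; simp
    · simp [h]
  | seq h h' ih ih' => omega
  | @loop_last k' halts body s s' t hs h ih => have := hpop s k'; omega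
  | @loop_next k' halts body s s' s'' t t' hs h h' ih ih' => have := hpop s k'; omega
  | mono h ht ih => omega

/-- The local memory of the machine that runs a program: the result of the last pop. -/
abbrev LastPop (Γ : K → Type) : Type := Option (Σ k, Option (Γ k))

/-- The result of the last pop, if it was a pop from the stack `k`. -/
def LastPop.read (k : K) : LastPop Γ → Option (Γ k)
  | some ⟨k', o⟩ => if h : k' = k then h ▸ o else none
  | none => none

theorem LastPop.read_some (k : K) (o : Option (Γ k)) :
    LastPop.read k (some ⟨k, o⟩ : LastPop Γ) = o := by simp [LastPop.read]

/-- The machine code of a program, with control positions embedded by `em` in the labels of a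
machine, and continuing at `ex`. -/
def Prog.code {Λ : Type} : (p : Prog Γ) → (p.Lab → Λ) → Λ → p.Lab → TM2.Stmt Γ Λ (LastPop Γ)
  | .skip, _, ex, _ => .goto fun _ => ex
  | .push k a, _, ex, _ => .push k (fun _ => a) (.goto fun _ => ex)
  | .seq p q, em, ex, l => match l with
    | .inl l => p.code (fun l => em (.inl l)) (em (.inr q.entry)) l
    | .inr l => q.code (fun l => em (.inr l)) ex l
  | .loop k halts body, em, ex, l => match l with
    | none => .pop k (fun _ o => some ⟨k, o⟩)
        (.goto fun v => em (some ⟨v.read k, (body (v.read k)).entry⟩))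
    | some ⟨o, l⟩ =>
        (body o).code (fun l => em (some ⟨o, l⟩)) (if halts o then ex else em none) l

/-- Correctness of the compilation of programs: a machine that contains the code of `p` follows
every run of `p`, from the entry of `p` to the label `ex`, within the stated time. -/
theorem Run.reachesIn {Λ : Type} {M : Λ → TM2.Stmt Γ Λ (LastPop Γ)} {p : Prog Γ}
    {s s' : ∀ k, List (Γ k)} {t : ℕ} (h : Run p s t s') (em : p.Lab → Λ) (ex : Λ)
    (hM : ∀ l, M (em l) = p.code em ex l) (v : LastPop Γ) :
    ∃ v', ReachesIn M t ⟨some (em p.entry), v, s⟩ ⟨some ex, v', s'⟩ := by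
  induction h generalizing ex v with
  | skip s =>
    refine ⟨v, ReachesIn.step (n := 0) ?_⟩
    rw [hM]
    exact ReachesIn.refl _
  | push k a s =>
    refine ⟨v, ReachesIn.step (n := 0) ?_⟩
    rw [hM]
    exact ReachesIn.refl _
  | @seq p q s s' s'' t t' h h' ih ih' =>
    obtain ⟨v', h1⟩ := ih (fun l => em (.inl l)) (em (.inr q.entry)) (fun l => hM (.inl l)) v
    obtain ⟨v'', h2⟩ := ih' (fun l => em (.inr l)) ex (fun l => hM (.inr l)) v'
    exact ⟨v'', h1.trans h2⟩
  | @loop_last k halts body s s' t hs h ih =>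
    obtain ⟨v', h1⟩ := ih (fun l => em (some ⟨_, l⟩)) ex
      (fun l => (hM (some ⟨_, l⟩)).trans
        (congrArg (fun x => (body (s k).head?).code _ x l) (if_pos hs))) (some ⟨k, (s k).head?⟩)
    refine ⟨v', ReachesIn.step ?_⟩
    rw [hM]
    have key : ∀ o, o = (s k).head? → ReachesIn M t ⟨some (em (some ⟨o, (body o).entry⟩)),
        some ⟨k, (s k).head?⟩, Function.update s k (s k).tail⟩
        ⟨some ex, v', s'⟩ := by
      rintro _ rfl
      exact h1
    exact key _ (LastPop.read_some k _)
  | @loop_next k halts body s s' s'' t t' hs h h' ih ih' =>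
    obtain ⟨v', h1⟩ := ih (fun l => em (some ⟨_, l⟩)) (em none)
      (fun l => (hM (some ⟨_, l⟩)).trans
        (congrArg (fun x => (body (s k).head?).code _ x l) (if_neg (by simp [hs])))) (some ⟨k, (s k).head?⟩)
    obtain ⟨v'', h2⟩ := ih' em ex hM v'
    refine ⟨v'', ReachesIn.step ?_⟩
    rw [hM]
    have key : ∀ o, o = (s k).head? → ReachesIn M (t + t') ⟨some (em (some ⟨o, (body o).entry⟩)),
        some ⟨k, (s k).head?⟩, Function.update s k (s k).tail⟩
        ⟨some ex, v'', s''⟩ := by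
      rintro _ rfl
      exact h1.trans h2
    exact key _ (LastPop.read_some k _)
  | mono h ht ih =>
    obtain ⟨v', h1⟩ := ih em ex hM v
    exact ⟨v', h1.mono ht⟩

/-- The machine that runs a program. -/
noncomputable def Prog.toTM [Fintype K] [∀ k, Finite (Γ k)] (p : Prog Γ) (k₀ k₁ : K) : FinTM2 :=
  let _ : Fintype p.Lab := @Fintype.ofFinite _ p.finite_lab
  let _ : ∀ k, Fintype (Γ k) := fun _ => Fintype.ofFinite _
  -- the label `none` clears the local memory, as a halted machine has to be in its initial state
  { K := K
    k₀ := k₀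
    k₁ := k₁
    Γ := Γ
    Λ := Option p.Lab
    main := some p.entry
    σ := LastPop Γ
    initialState := none
    m := fun l => match l with
      | none => .load (fun _ => none) .halt
      | some l => p.code some none l }

/-- A program that computes a string function in polynomial time proves that the function is
computable in polynomial time. -/
theorem computable_of_run [Fintype K] [∀ k, Finite (Γ k)] {α β αΓ βΓ : Type}
    {ea : α → List αΓ} {eb : β → List βΓ} {f : α → β} (p : Prog Γ) (k₀ k₁ : K)
    (i : Γ k₀ ≃ αΓ) (o : Γ k₁ ≃ βΓ) (P : Polynomial ℕ)
    (h : ∀ a, ∃ t ≤ P.eval (ea a).length,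
      Run p (single k₀ ((ea a).map i.symm)) t (single k₁ ((eb (f a)).map o.symm))) :
    Nonempty (TM2ComputableInPolyTime ea eb f) := by
  refine computable_of_reachesIn (p.toTM k₀ k₁) i o (P + 1) fun a => ?_
  obtain ⟨t, ht, h⟩ := h a
  obtain ⟨v, h⟩ := h.reachesIn (M := (p.toTM k₀ k₁).m) some none (fun l => rfl) none
  have h' : ReachesIn (p.toTM k₀ k₁).m 1 ⟨some none, v, single k₁ ((eb (f a)).map o.symm)⟩
      ⟨none, none, single k₁ ((eb (f a)).map o.symm)⟩ :=
    ReachesIn.step (n := 0) (ReachesIn.refl _)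
  refine (h.trans h').mono ?_
  simp only [Polynomial.eval_add, Polynomial.eval_one]
  omega

/-! ### Derived programs -/

/-- Sequential composition of a list of programs. -/
def Prog.seqs : List (Prog Γ) → Prog Γ
  | [] => .skip
  | p :: l => .seq p (Prog.seqs l)

/-- Run `body a` for every symbol `a` popped from the stack `k` until it is empty. -/
def Prog.forEach (k : K) (body : Γ k → Prog Γ) : Prog Γ :=
  .loop k Option.isNone fun o => o.elim .skip body

/-- Empty the stack `k`. -/
def Prog.clear (k : K) : Prog Γ := Prog.forEach k fun _ => .skip

/-- The last round of a loop, with the popped symbol and the remaining stacks as variables. -/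
theorem Run.loop_exit {k : K} {halts : Option (Γ k) → Bool} {body : Option (Γ k) → Prog Γ}
    {s s₁ s' : ∀ k, List (Γ k)} {t : ℕ} (o : Option (Γ k)) (ho : (s k).head? = o)
    (hs₁ : Function.update s k (s k).tail = s₁) (hs : halts o = true)
    (h : Run (body o) s₁ t s') : Run (.loop k halts body) s (t + 1) s' := by
  subst ho hs₁
  exact .loop_last hs h

/-- A round of a loop other than the last one, with the popped symbol and the remaining stacks as
variables. -/
theorem Run.loop_again {k : K} {halts : Option (Γ k) → Bool} {body : Option (Γ k) → Prog Γ}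
    {s s₁ s' s'' : ∀ k, List (Γ k)} {t t' : ℕ} (o : Option (Γ k)) (ho : (s k).head? = o)
    (hs₁ : Function.update s k (s k).tail = s₁) (hs : halts o = false)
    (h : Run (body o) s₁ t s') (h' : Run (.loop k halts body) s' t' s'') :
    Run (.loop k halts body) s (t + t' + 1) s'' := by
  subst ho hs₁
  exact .loop_next hs h h'

/-- The rule for `forEach`: `S d l` are the stacks when the symbols `d` have been dealt with and the
symbols `l` are still to be popped. -/
theorem Run.forEach {k : K} {body : Γ k → Prog Γ}
    (S : List (Γ k) → List (Γ k) → ∀ k, List (Γ k)) (c : ℕ) (hS : ∀ d l, S d l k = l)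
    (d l : List (Γ k)) (h : ∀ d' a l', d' ++ a :: l' = d ++ l →
      Run (body a) (Function.update (S d' (a :: l')) k l') c (S (d' ++ [a]) l')) :
    Run (Prog.forEach k body) (S d l) (l.length * (c + 1) + 2) (S (d ++ l) []) := by
  induction l generalizing d with
  | nil =>
    refine .mono (.loop_exit (t := 1) none (by rw [hS]; rfl) (s₁ := S d []) ?_ rfl ?_)
      (by simp)
    · rw [hS]
      nth_rewrite 2 [← Function.update_eq_self k (S d [])]
      rw [hS]; rfl
    · rw [List.append_nil]
      exact .skip _
  | cons a l ih =>
    have e : d ++ a :: l = (d ++ [a]) ++ l := by simp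
    refine .mono (.loop_again (some a) (by rw [hS]; rfl) rfl rfl (t := c)
      (s' := S (d ++ [a]) l) ?_ (e ▸ ih (d ++ [a]) fun d' a' l' h' => h d' a' l' (h'.trans e.symm)))
      ?_
    · have := h d a l rfl
      rw [hS]
      exact this
    · simp only [List.length_cons]
      have : (l.length + 1) * (c + 1) = l.length * (c + 1) + (c + 1) := by ring
      omega

end Prog

/-! ### Homomorphisms of strings -/

section FlatMap

variable {A B : Type}

/-- The stacks of the program for homomorphisms: the input, and (with another alphabet) the output
and a work stack. -/
def HomΓ (A B : Type) : Option Bool → Type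
  | none => A
  | some _ => B

instance homΓ_finite [Finite A] [Finite B] (k : Option Bool) : Finite (HomΓ A B k) := by
  cases k <;> assumption

/-- The contents of the input, output and work stack. -/
def homStore (i : List A) (o w : List B) : ∀ k, List (HomΓ A B k)
  | none => i
  | some true => o
  | some false => w

theorem update_homStore_none (i l : List A) (o w : List B) :
    Function.update (β := fun k => List (HomΓ A B k)) (homStore i o w) none l =
      homStore l o w := by
  funext k; rcases k with _ | _ | _ <;> rfl

theorem update_homStore_true (i : List A) (o w l : List B) :
    Function.update (β := fun k => List (HomΓ A B k)) (homStore i o w) (some true) l =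
      homStore i l w := by
  funext k; rcases k with _ | _ | _ <;> rfl

theorem update_homStore_false (i : List A) (o w l : List B) :
    Function.update (β := fun k => List (HomΓ A B k)) (homStore i o w) (some false) l =
      homStore i o l := by
  funext k; rcases k with _ | _ | _ <;> rfl

/-- Push a string onto the work stack. -/
def pushWork : List B → Prog (HomΓ A B)
  | [] => .skip
  | b :: l => .seq (.push (some false) b) (pushWork l)

theorem run_pushWork (l : List B) (i : List A) (o w : List B) :
    Run (pushWork l) (homStore i o w) (l.length + 1) (homStore i o (l.reverse ++ w)) := by
  induction l generalizing w with
  | nil => exact .skip _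
  | cons b l ih =>
    have h1 : Run (Γ := HomΓ A B) (.push (some false) b) (homStore i o w) 1
        (homStore i o (b :: w)) :=
      update_homStore_false i o w (b :: w) ▸ Run.push (Γ := HomΓ A B) (some false) b (homStore i o w)
    have h2 := Run.seq h1 (ih (b :: w))
    simp only [List.reverse_cons, List.append_assoc, List.singleton_append]
    refine h2.mono ?_
    simp only [List.length_cons]; omega

/-- A homomorphism of strings is computable in polynomial time. -/
theorem computable_flatMap [Fintype A] [Fintype B] {α β : Type} {ea : α → List A}
    {eb : β → List B} {f : α → β} (h : A → List B) (hf : ∀ a, eb (f a) = (ea a).flatMap h) :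
    Nonempty (TM2ComputableInPolyTime ea eb f) := by
  obtain ⟨c, hc⟩ : ∃ c, ∀ a, (h a).length ≤ c :=
    ⟨Finset.univ.sup fun a => (h a).length, fun a => Finset.le_sup (f := fun a => (h a).length)
      (Finset.mem_univ a)⟩
  refine computable_of_run (Γ := HomΓ A B)
    (.seq (.forEach none fun a => pushWork (h a)) (.forEach (some false) fun b =>
      .push (some true) b)) none (some true) (Equiv.refl _) (Equiv.refl _)
    (.X * .C (c + 2) + 2 + (.X * .C c * 2 + 2)) fun a => ?_
  have e1 : ∀ l : List A, single (Γ := HomΓ A B) none l = homStore l [] [] := by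
    intro l; funext k; rcases k with _ | _ | _ <;> rfl
  have e2 : ∀ l : List B, single (Γ := HomΓ A B) (some true) l = homStore [] l [] := by
    intro l; funext k; rcases k with _ | _ | _ <;> rfl
  have b1 : ∀ (d : List A) (x : A) (l : List A), Run (Γ := HomΓ A B) (pushWork (h x))
      (Function.update (β := fun k => List (HomΓ A B k))
        (homStore (x :: l) [] (d.flatMap h).reverse) none l) (c + 1)
      (homStore l [] ((d ++ [x]).flatMap h).reverse) := by
    intro d x l
    rw [update_homStore_none]
    have := run_pushWork (h x) l [] (List.flatMap h d).reverse
    have e : (List.flatMap h (d ++ [x])).reverse = (h x).reverse ++ (List.flatMap h d).reverse := by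
      simp
    rw [e]
    exact this.mono (Nat.add_le_add_right (hc x) 1)
  have b2 : ∀ (d : List B) (x : B) (l : List B), Run (Γ := HomΓ A B) (.push (some true) x)
      (Function.update (β := fun k => List (HomΓ A B k))
        (homStore [] d.reverse (x :: l)) (some false) l) 1
      (homStore [] (d ++ [x]).reverse l) := by
    intro d x l
    rw [update_homStore_false]
    have e : (d ++ [x]).reverse = x :: d.reverse := by simp
    have h0 := Run.push (Γ := HomΓ A B) (some true) x (homStore [] d.reverse l)
    have h1 := update_homStore_true [] d.reverse l (x :: d.reverse) (A := A)
    rw [e]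
    exact h1 ▸ h0
  have h1 := Run.forEach (Γ := HomΓ A B) (k := none) (body := fun a => pushWork (h a))
    (fun d l => homStore l [] (List.flatMap h d).reverse) (c + 1) (fun d l => rfl) [] (ea a)
    (fun d x l _ => b1 d x l)
  have h2 := Run.forEach (Γ := HomΓ A B) (k := some false)
    (body := fun b => .push (some true) b)
    (fun d l => homStore [] (List.reverse (α := B) d) l) 1 (fun d l => rfl) []
    ((ea a).flatMap h).reverse (fun d x l _ => b2 d x l)
  have e3 : List.map (Equiv.refl A).symm (ea a) = ea a := List.map_id _
  have e4 : List.map (Equiv.refl B).symm (eb (f a)) = (ea a).flatMap h :=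
    (List.map_id _).trans (hf a)
  have h3 := h1.seq h2
  have e5 : List.reverse (α := B) ([] ++ (List.flatMap h (ea a)).reverse) =
      List.flatMap h (ea a) := by simp
  have e6 := e1 (ea a)
  have e7 := e2 ((ea a).flatMap h)
  have e8 : homStore (A := A) [] (List.reverse (α := B) ([] ++ (List.flatMap h (ea a)).reverse)) []
      = single (Γ := HomΓ A B) (some true) (List.map (Equiv.refl B).symm (eb (f a))) := by
    rw [e5, ← e7]
    exact congrArg _ e4.symm
  have e9 : homStore (ea a) [] [] = single (Γ := HomΓ A B) none
      (List.map (Equiv.refl A).symm (ea a)) := by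
    rw [← e6]
    exact congrArg _ e3.symm
  refine ⟨_, ?_, h3.congr e9 e8 le_rfl⟩
  · have : ∀ l : List A, (l.flatMap h).length ≤ l.length * c := by
      intro l
      induction l with
      | nil => simp
      | cons x l ih =>
        have := hc x
        simp only [List.flatMap_cons, List.length_append, List.length_cons, Nat.succ_mul]
        omega
    have := this (ea a)
    simp only [Polynomial.eval_add, Polynomial.eval_mul, Polynomial.eval_X, Polynomial.eval_C,
      Polynomial.eval_ofNat]
    have h5 : (List.length (α := HomΓ A B (some false)) (List.flatMap h (ea a)).reverse) ≤
      (ea a).length * c := by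
      refine le_trans (le_of_eq ?_) this
      exact List.length_reverse
    exact Nat.add_le_add le_rfl (Nat.add_le_add_right (Nat.mul_le_mul_right _ h5) _)

end FlatMap

/-! ### Programs on stacks with a common alphabet -/

section Uniform

variable {K C : Type} [DecidableEq K]

/-- Move the contents of the stack `k` to `k'`, reversing them. -/
def Prog.move (k k' : K) : Prog fun _ : K => C := .forEach k fun a => .push k' a

/-- Push a reversed copy of the contents of the stack `k` onto `k'`, with the help of the empty
stack `t`. -/
def Prog.copy (k k' t : K) : Prog fun _ : K => C :=
  .seq (.forEach k fun a => .seq (.push k' a) (.push t a)) (.move t k)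

/-- Push a string onto the stack `k`, the first symbol first. -/
def Prog.pushes (k : K) (l : List C) : Prog fun _ : K => C :=
  Prog.seqs (l.map fun a => .push k a)

theorem run_push (k : K) (a : C) (s : K → List C) :
    Run (Γ := fun _ => C) (.push k a) s 1 (Function.update s k (a :: s k)) := Run.push k a s

theorem run_move {k k' : K} (h : k' ≠ k) (s : K → List C) :
    Run (Prog.move k k') s ((s k).length * 2 + 2)
      (Function.update (Function.update s k' ((s k).reverse ++ s k')) k []) := by
  have := Run.forEach (Γ := fun _ => C) (k := k) (body := fun a => .push k' a)
    (fun d l => Function.update (Function.update s k' (d.reverse ++ s k')) k l) 1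
    (fun d l => by simp) [] (s k) ?_
  · refine this.congr ?_ rfl le_rfl
    simp
  · intro d a l _
    refine (run_push k' a _).congr rfl ?_ le_rfl
    funext j
    by_cases e1 : j = k
    · subst e1; simp [h.symm]
    · by_cases e2 : j = k'
      · subst e2; simp [h]
      · simp [e1, e2]

theorem run_copy {k k' t : K} (h : k' ≠ k) (ht : t ≠ k) (ht' : t ≠ k') (s : K → List C)
    (hs : s t = []) :
    Run (Prog.copy k k' t) s ((s k).length * 5 + 4)
      (Function.update s k' ((s k).reverse ++ s k')) := by
  have h1 := Run.forEach (Γ := fun _ => C) (k := k)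
    (body := fun a => .seq (.push k' a) (.push t a))
    (fun d l => Function.update (Function.update (Function.update s k' (d.reverse ++ s k')) t
      d.reverse) k l) 2 (fun d l => by simp) [] (s k) ?_
  · have h2 := run_move (C := C) (k := t) (k' := k) ht.symm (Function.update (Function.update
      (Function.update s k' (([] ++ s k).reverse ++ s k')) t ([] ++ s k).reverse) k [])
    refine (h1.seq h2).congr ?_ ?_ ?_
    · funext j
      by_cases e1 : j = k
      · subst e1; simp
      · by_cases e2 : j = t
        · subst e2; simp [e1, hs]
        · simp [e1, e2]
    · funext j
      by_cases e1 : j = k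
      · subst e1; simp [ht, ht.symm, h.symm]
      · by_cases e2 : j = t
        · subst e2; simp [e1, hs, ht']
        · by_cases e3 : j = k'
          · subst e3; simp [e1, e2]
          · simp [e1, e2, e3]
    · simp [ht]; omega
  · intro d a l _
    refine ((run_push k' a _).seq (run_push t a _)).congr rfl ?_ le_rfl
    funext j
    by_cases e1 : j = k
    · subst e1; simp [h.symm, ht.symm]
    · by_cases e2 : j = t
      · subst e2; simp [e1, ht']
      · by_cases e3 : j = k'
        · subst e3; simp [e1, e2]
        · simp [e1, e2, e3]

theorem run_clear (k : K) (s : K → List C) :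
    Run (Prog.clear (Γ := fun _ => C) k) s ((s k).length * 2 + 2) (Function.update s k []) := by
  have := Run.forEach (Γ := fun _ => C) (k := k) (body := fun a => .skip)
    (fun d l => Function.update s k l) 1 (fun d l => by simp) [] (s k) ?_
  · refine this.congr ?_ rfl le_rfl
    simp
  · intro d a l _
    exact (Run.skip _).congr (by simp) rfl le_rfl

theorem run_pushes (k : K) (l : List C) (s : K → List C) :
    Run (Prog.pushes k l) s (l.length + 1) (Function.update s k (l.reverse ++ s k)) := by
  induction l generalizing s with
  | nil => exact (Run.skip s).congr rfl (by simp) le_rfl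
  | cons a l ih =>
    refine ((run_push k a s).seq (ih _)).congr rfl ?_ (by simp; omega)
    simp

end Uniform

/-- Names of stacks: input, output, gates, register entries, number of qubits, three operands, a
work stack and a stack for flags. -/
inductive Stk
  | inp
  | out
  | g
  | r
  | b
  | w₁
  | w₂
  | w₃
  | t
  | z
  deriving DecidableEq

instance : Fintype Stk :=
  ⟨{.inp, .out, .g, .r, .b, .w₁, .w₂, .w₃, .t, .z}, by intro k; cases k <;> simp⟩

/-- The contents of all stacks. -/
structure Store (C : Type) where
  inp : List C := []
  out : List C := []
  g : List C := []
  r : List C := []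
  b : List C := []
  w₁ : List C := []
  w₂ : List C := []
  w₃ : List C := []
  t : List C := []
  z : List C := []

namespace Store

variable {C : Type}

/-- The contents of the stacks, as a function of the name of the stack. -/
def fn (S : Store C) : Stk → List C
  | .inp => S.inp
  | .out => S.out
  | .g => S.g
  | .r => S.r
  | .b => S.b
  | .w₁ => S.w₁
  | .w₂ => S.w₂
  | .w₃ => S.w₃
  | .t => S.t
  | .z => S.z

variable (S : Store C) (l : List C)

@[simp] theorem fn_inp : S.fn .inp = S.inp := rfl
@[simp] theorem fn_out : S.fn .out = S.out := rfl
@[simp] theorem fn_g : S.fn .g = S.g := rfl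
@[simp] theorem fn_r : S.fn .r = S.r := rfl
@[simp] theorem fn_b : S.fn .b = S.b := rfl
@[simp] theorem fn_w₁ : S.fn .w₁ = S.w₁ := rfl

@[simp] theorem update_inp : Function.update S.fn .inp l = { S with inp := l }.fn := by
  funext k; cases k <;> rfl
@[simp] theorem update_out : Function.update S.fn .out l = { S with out := l }.fn := by
  funext k; cases k <;> rfl
@[simp] theorem update_g : Function.update S.fn .g l = { S with g := l }.fn := by
  funext k; cases k <;> rfl
@[simp] theorem update_r : Function.update S.fn .r l = { S with r := l }.fn := by
  funext k; cases k <;> rfl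
@[simp] theorem update_b : Function.update S.fn .b l = { S with b := l }.fn := by
  funext k; cases k <;> rfl
@[simp] theorem update_w₁ : Function.update S.fn .w₁ l = { S with w₁ := l }.fn := by
  funext k; cases k <;> rfl

theorem single_inp : single (Γ := fun _ => C) Stk.inp l = ({ inp := l } : Store C).fn := by
  funext k; cases k <;> rfl
theorem single_out : single (Γ := fun _ => C) Stk.out l = ({ out := l } : Store C).fn := by
  funext k; cases k <;> rfl

end Store

/-- A program on the stacks above that computes a string function in polynomial time proves that
the function is computable in polynomial time. -/
theorem computable_of_run_store {C α β : Type} [Fintype C] {ea : α → List C} {eb : β → List C}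
    {f : α → β} (p : Prog fun _ : Stk => C) (P : Polynomial ℕ)
    (h : ∀ a, ∃ t ≤ P.eval (ea a).length,
      Run p ({ inp := ea a } : Store C).fn t ({ out := eb (f a) } : Store C).fn) :
    Nonempty (TM2ComputableInPolyTime ea eb f) := by
  refine computable_of_run (Γ := fun _ => C) p .inp .out (Equiv.refl _) (Equiv.refl _) P
    fun a => ?_
  simpa [Store.single_inp, Store.single_out] using h a

/-! ### Polynomial precision -/

/-- The encoding of a bitstring together with a number in unary. -/
abbrev encodePair : List Bool × ℕ → List (Bool ⊕ Bool) :=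
  (Computability.encodingProd (Computability.encodingList Bool)
    Computability.unaryEncodingNat).encode

theorem encodePair_eq (w : List Bool) (k : ℕ) :
    encodePair (w, k) = w.map Sum.inl ++ List.replicate k (Sum.inr true) := by
  have : ∀ k, Computability.unaryEncodeNat k = List.replicate k true := by
    intro k
    induction k with
    | zero => rfl
    | succ k ih => rw [Computability.unaryEncodeNat, ih, List.replicate_succ]
  change w.map Sum.inl ++ (Computability.unaryEncodeNat k).map Sum.inr = _
  rw [this, List.map_replicate]

theorem computable_fst : Nonempty (TM2ComputableInPolyTime encodePair
    (Computability.encodingList Bool).encode (Prod.fst : List Bool × ℕ → List Bool)) := by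
  refine computable_flatMap (fun a => a.elim (fun b => [b]) fun _ => []) ?_
  rintro ⟨w, k⟩
  rw [encodePair_eq]
  have h1 : ∀ w : List Bool, (w.map (Sum.inl : Bool → Bool ⊕ Bool)).flatMap
      (fun a => a.elim (fun b => [b]) fun _ => []) = w := by
    intro w; induction w with
    | nil => rfl
    | cons a w ih => simpa using ih
  have h2 : (List.replicate k (Sum.inr true : Bool ⊕ Bool)).flatMap
      (fun a => a.elim (fun b => [b]) fun _ => []) = ([] : List Bool) := by
    induction k with
    | zero => rfl
    | succ k ih => simp [List.replicate_succ]
  rw [List.flatMap_append, h1, h2, List.append_nil]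
  rfl

theorem computable_pair_zero : Nonempty (TM2ComputableInPolyTime
    (Computability.encodingList Bool).encode encodePair fun w => (w, 0)) := by
  refine computable_flatMap (fun a => [Sum.inl a]) fun w => ?_
  rw [encodePair_eq]
  change _ = w.flatMap _
  induction w with
  | nil => rfl
  | cons a w ih => simpa using ih

theorem computable_add_const (c : ℕ) : Nonempty (TM2ComputableInPolyTime encodePair encodePair
    fun p => (p.1, p.2 + c)) := by
  refine computable_of_run_store
    (.seq (.move .inp .g) (.seq (.pushes .out (List.replicate c (Sum.inr true)))
      (.move .g .out))) (.X * 4 + .C (c + 5)) ?_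
  rintro ⟨w, k⟩
  have h1 := run_move (k := Stk.inp) (k' := .g) (by simp)
    ({ inp := encodePair (w, k) } : Store (Bool ⊕ Bool)).fn
  simp only [Store.fn_inp, Store.fn_g, Store.update_inp, Store.update_g] at h1
  have h2 := run_pushes Stk.out (List.replicate c (Sum.inr true : Bool ⊕ Bool))
    ({ g := (encodePair (w, k)).reverse ++ [] } : Store (Bool ⊕ Bool)).fn
  simp only [Store.fn_out, Store.update_out] at h2
  have h3 := run_move (k := Stk.g) (k' := .out) (by simp)
    ({ g := (encodePair (w, k)).reverse ++ [],
        out := (List.replicate c (Sum.inr true)).reverse ++ [] } : Store (Bool ⊕ Bool)).fn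
  simp only [Store.fn_out, Store.fn_g, Store.update_out, Store.update_g] at h3
  refine ⟨_, ?_, (h1.seq (h2.seq h3)).congr rfl ?_ le_rfl⟩
  · simp; omega
  · congr 1
    simp only [encodePair_eq, List.reverse_replicate, List.append_nil, List.reverse_reverse,
      List.append_assoc, List.replicate_append_replicate]

/-- Multiplication of the unary number by the length of the bitstring plus one. -/
def mulProg : Prog fun _ : Stk => Bool ⊕ Bool :=
  .seq (.forEach .inp fun a => a.elim
    (fun b => .seq (.push .g (.inl b)) (.push .w₁ (.inr true))) (fun b => .push .r (.inr b)))
  (.seq (.forEach .r fun _ => .seq (.push .out (.inr true)) (.copy .w₁ .out .t))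
  (.seq (.clear .w₁) (.move .g .out)))

theorem computable_mul : Nonempty (TM2ComputableInPolyTime encodePair encodePair
    fun p => (p.1, p.2 * (p.1.length + 1))) := by
  refine computable_of_run_store mulProg (.X * 3 + 2 + (.X * (.X * 5 + 6) + 2 + (.X * 2 + 2 +
    (.X * 2 + 2)))) ?_
  rintro ⟨w, k⟩
  have e : ∀ w : List Bool, w.map (fun _ => (Sum.inr true : Bool ⊕ Bool)) =
      List.replicate w.length (Sum.inr true) := by intro w; simp
  -- the bitstring, then the unary number
  have h1 := Run.forEach (Γ := fun _ : Stk => Bool ⊕ Bool) (k := .inp)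
    (body := fun a => a.elim
      (fun b => .seq (.push .g (.inl b)) (.push .w₁ (.inr true))) (fun b => .push .r (.inr b)))
    (fun d l => ({
        inp := l
        g := (d.filter Sum.isLeft).reverse
        r := (d.filter Sum.isRight).reverse
        w₁ := ((d.filter Sum.isLeft).map fun _ => Sum.inr true) } : Store (Bool ⊕ Bool)).fn) 2 (fun d l => rfl) [] (encodePair (w, k)) (by
      rintro d (a | a) l _
      · refine ((run_push Stk.g _ _).seq (run_push Stk.w₁ _ _)).congr rfl ?_ le_rfl
        simp only [Store.update_inp, Store.update_g, Store.update_w₁, Store.fn_g, Store.fn_w₁]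
        congr 1
        simp [List.filter_cons, ← List.replicate_succ]
        exact List.replicate_succ'
      · refine (run_push Stk.r _ _).congr rfl ?_ (by simp)
        simp only [Store.update_inp, Store.update_r, Store.fn_r]
        congr 1
        simp [List.filter_cons])
  have f1 : (encodePair (w, k)).filter Sum.isLeft = w.map Sum.inl := by
    rw [encodePair_eq, List.filter_append, List.filter_replicate]
    simp [List.filter_map, Function.comp_def]
  have f2 : (encodePair (w, k)).filter Sum.isRight = List.replicate k (Sum.inr true) := by
    rw [encodePair_eq, List.filter_append, List.filter_replicate]
    simp [List.filter_map, Function.comp_def]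
  simp only [List.nil_append, f1, f2, List.filter_nil, List.reverse_nil, List.map_nil,
    List.map_map] at h1
  have h2 := Run.forEach (Γ := fun _ : Stk => Bool ⊕ Bool) (k := .r)
    (body := fun _ => .seq (.push .out (.inr true)) (.copy .w₁ .out .t))
    (fun d l => ({
        r := l
        g := (w.map Sum.inl).reverse,
        w₁ := List.replicate w.length (Sum.inr true),
        out := List.replicate (d.length * (w.length + 1)) (Sum.inr true) } : Store (Bool ⊕ Bool)).fn)
    (w.length * 5 + 5) (fun d l => rfl) []
    (List.replicate k (Sum.inr true)) (by
      intro d a l _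
      have := run_copy (k := Stk.w₁) (k' := .out) (t := .t) (by simp) (by simp) (by simp)
        ({ r := l, g := (w.map Sum.inl).reverse, w₁ := List.replicate w.length (Sum.inr true),
            out := Sum.inr true :: List.replicate (d.length * (w.length + 1)) (Sum.inr true) } :
           Store (Bool ⊕ Bool)).fn rfl
      refine ((run_push Stk.out _ _).seq (this.congr ?_ rfl le_rfl)).congr rfl ?_ ?_
      · simp
      · simp only [Store.fn_w₁, Store.fn_out, Store.update_out, List.reverse_replicate,
          ← List.replicate_succ, List.replicate_append_replicate, List.length_append,
          List.length_singleton]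
        congr 3
        ring
      · simp; omega)
  have h3 := run_clear Stk.w₁ ({
      g := (w.map Sum.inl).reverse,
      w₁ := List.replicate w.length (Sum.inr true),
      out := List.replicate (k * (w.length + 1)) (Sum.inr true) } : Store (Bool ⊕ Bool)).fn
  have h4 := run_move (k := Stk.g) (k' := .out) (by simp) ({
      g := (w.map Sum.inl).reverse,
      out := List.replicate (k * (w.length + 1)) (Sum.inr true) } : Store (Bool ⊕ Bool)).fn
  simp only [Store.fn_w₁, Store.update_w₁] at h3
  simp only [Store.fn_g, Store.fn_out, Store.update_g, Store.update_out] at h4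
  simp only [List.nil_append, List.length_replicate, List.length_nil, Nat.zero_mul,
    List.replicate_zero] at h2 h3
  refine ⟨_, ?_, (h1.seq ((h2.congr ?_ rfl le_rfl).seq (h3.seq h4))).congr rfl ?_ le_rfl⟩
  · have hl : (encodePair (w, k)).length = w.length + k := by simp [encodePair_eq]
    simp only [hl, Polynomial.eval_add, Polynomial.eval_mul, Polynomial.eval_X,
      Polynomial.eval_ofNat, List.length_reverse, List.length_map]
    nlinarith [Nat.zero_le (w.length * w.length), Nat.zero_le (k * k)]
  · simp [Function.comp_def]
  · simp [encodePair_eq]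

/-- The precision `c (n + 1) ^ d` can be computed in unary, along with the input: start with `c` and
multiply by `n + 1` repeatedly. -/
theorem computable_precision (c d : ℕ) : Nonempty (TM2ComputableInPolyTime
    (Computability.encodingList Bool).encode encodePair
    fun w : List Bool => (w, c * (w.length + 1) ^ d)) := by
  induction d with
  | zero =>
    have := computable_comp computable_pair_zero (computable_add_const c)
    convert this using 2
    funext w
    simp
  | succ d ih =>
    have := computable_comp ih computable_mul
    convert this using 2
    funext w
    simp [pow_succ, mul_assoc]

/-- Every polynomial is dominated by some `c (n + 1) ^ d`. -/
theorem exists_poly_le (p : Polynomial ℕ) : ∃ c d : ℕ, ∀ n, p.eval n ≤ c * (n + 1) ^ d := by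
  refine ⟨p.sum fun _ a => a, p.natDegree, fun n => ?_⟩
  rw [Polynomial.eval_eq_sum, Polynomial.sum, Polynomial.sum, Finset.sum_mul]
  refine Finset.sum_le_sum fun i hi => Nat.mul_le_mul_left _ ?_
  exact (Nat.pow_le_pow_left (Nat.le_succ n) i).trans
    (Nat.pow_le_pow_right (Nat.succ_pos n) (Polynomial.le_natDegree_of_mem_supp i hi))

/-! ### Gadgets -/

/-- Gates of both gate sets, on wires of type `W`. The exchange gate has the angle `3π/4` if `neg`
is true and `π/4` otherwise. -/
inductive RawGate (W : Type) : Type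
  | exch (i j : W) (neg : Bool)
  | had (q : W)
  | phase (q : W)
  | cnot (c t : W)
  | toff (c₁ c₂ t : W)

namespace RawGate

variable {W V : Type}

/-- Rename the wires. -/
def map (f : W → V) : RawGate W → RawGate V
  | exch i j neg => exch (f i) (f j) neg
  | had q => had (f q)
  | phase q => phase (f q)
  | cnot c t => cnot (f c) (f t)
  | toff c₁ c₂ t => toff (f c₁) (f c₂) (f t)

/-- The description of a wire. -/
def wireCode (q : ℕ) : List Symbol := List.replicate q Symbol.tick ++ [Symbol.sep]

/-- The description of a gate; the exchange gates have the angles `arg (±1 + i)`. -/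
def code : RawGate ℕ → List Symbol
  | exch i j neg => Symbol.exchange ::
      (wireCode i ++ wireCode j ++ encodeInt (if neg then -1 else 1) ++ encodeInt 1)
  | had q => Symbol.hadamard :: wireCode q
  | phase q => Symbol.phase :: wireCode q
  | cnot c t => Symbol.cnot :: (wireCode c ++ wireCode t)
  | toff c₁ c₂ t => Symbol.toffoli :: (wireCode c₁ ++ wireCode c₂ ++ wireCode t)

end RawGate

/-- A gadget: given an infinite supply of fresh wires, a list of gates, and the values of the fresh
wires that it uses. Each of these ancillas is prepared in its value and finally postselected on the
same value. -/
abbrev Gadget (W : Type) : Type := (ℕ → W) → List (RawGate W) × List Bool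

namespace Gadget

variable {W V : Type}

/-- The empty gadget. -/
def nil : Gadget W := fun _ => ([], [])

/-- A single gate. -/
def gate (g : RawGate W) : Gadget W := fun _ => ([g], [])

/-- Two gadgets, one after the other, with separate ancillas. -/
def seq (G H : Gadget W) : Gadget W := fun a =>
  ((G a).1 ++ (H fun k => a ((G a).2.length + k)).1, (G a).2 ++ (H fun k => a ((G a).2.length + k)).2)

/-- A list of gadgets, one after the other. -/
def seqs (l : List (Gadget W)) : Gadget W := l.foldr seq nil

theorem seqs_append (l l' : List (Gadget W)) : seqs (l ++ l') = seq (seqs l) (seqs l') := by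
  induction l with
  | nil => funext a; simp [seqs, seq, nil]
  | cons G l ih =>
    funext a
    have := congrFun ih fun k => a ((G a).2.length + k)
    simp only [seqs, List.cons_append, List.foldr_cons, seq] at this ⊢
    rw [this]
    simp [Nat.add_assoc]

/-- A gadget that uses ancillas with the values `vs` on the wires passed to `G`. -/
def wrap (vs : List Bool) (G : (ℕ → W) → Gadget W) : Gadget W := fun a =>
  ((G a fun k => a (vs.length + k)).1, vs ++ (G a fun k => a (vs.length + k)).2)

/-! ### Exchange gadgets on dual-rail pairs -/

/-- Exchange with an ancilla: a filter that acts as a diagonal operator on the wire `i`. -/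
def fil (i : W) (v neg : Bool) : Gadget W := fun a => ([.exch i (a 0) neg], [v])

/-- The phase gate on the wire `i`. -/
def ph (i : W) : Gadget W := seqs [fil i false true, fil i true false]

/-- The inverse phase gate on the wire `i`. -/
def phInv (i : W) : Gadget W := seqs [fil i false false, fil i true true]

/-- The Hadamard gate on the dual-rail pair `i`, `j`. -/
def hp (i j : W) : Gadget W := seqs [phInv i, gate (.exch i j false), phInv i]

/-- The controlled `Z` gate on the wires `i`, `j`. -/
def cz (i j : W) : Gadget W :=
  seqs [gate (.exch i j false), ph i, ph i, gate (.exch i j false), ph j, phInv i]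

/-- The controlled NOT gate with control `i` and the dual-rail pair `j`, `j'` as its target. -/
def cx (i j j' : W) : Gadget W := seqs [hp j j', cz i j, hp j j']

/-- The first part of the doubly controlled `Z` gate. It does this gate up to a factor that depends
on the value of `z`. -/
def cczCore (x y z : W) : Gadget W := wrap [false, true] fun p => seqs [hp (p 0) (p 1),
  fil (p 0) false false, cz z (p 0), cx x (p 0) (p 1), fil (p 0) false false, cx y (p 0) (p 1),
  fil (p 0) true false, cx x (p 0) (p 1), fil (p 0) false false, hp (p 0) (p 1)]

/-- The second part of the doubly controlled `Z` gate. It makes up for the factor of the first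
part. -/
def cczFix (z : W) : Gadget W := wrap [false, true] fun p => seqs [hp (p 0) (p 1),
  fil (p 0) false false, fil (p 0) false false, ph (p 0), ph (p 0), cz z (p 0), hp (p 0) (p 1)]

/-- The Toffoli gate with controls `x`, `y` and the dual-rail pair `t`, `t'` as its target. -/
def tof (x y t t' : W) : Gadget W := seqs [hp t t', cczCore x y t, cczFix t, hp t t']

/-! ### An exchange gate made of the gates of the universal set -/

/-- Multiply the amplitude of the value `0` of the wire `u` by `2` (up to a common factor). -/
def double (u : W) : Gadget W := fun a =>
  ([.had (a 0), .toff u (a 0) (a 1), .had (a 0)], [false, false])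

/-- Add the amplitude of the value `0` of the wire `u` to that of `1` (up to a common factor). -/
def addUp (u : W) : Gadget W := fun a =>
  ([.had (a 0), .toff u (a 0) (a 1), .cnot (a 0) u, .had (a 0)], [false, false])

/-- The step that belongs to one binary digit. -/
def digit (u : W) (d : Bool) : Gadget W := if d then seq (addUp u) (double u) else double u

/-- Change the sign of the amplitude of the value `1` of the wire `c`. -/
def signFlip (c : W) : Gadget W := seqs [gate (.phase c), gate (.phase c)]

/-- The sign and the binary digits of an integer. -/
def integer (c u : W) (z : ℤ) : List (Gadget W) :=
  (if z < 0 then [signFlip c] else []) ++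
    (Computability.encodeNat z.natAbs).map fun d => digit u d

/-- The entangled ancillas at the beginning: `c` is in a superposition, `u` is a copy of `c`, and
`v` its negation. -/
def start (c v u : W) : List (Gadget W) :=
  [gate (.had c), gate (.cnot c v), gate (.cnot v u), gate (.phase c)]

/-- The controlled exchange of `i` and `j` at the end. -/
def finish (c i j : W) : List (Gadget W) :=
  [gate (.cnot j i), gate (.toff c i j), gate (.cnot j i), gate (.had c)]

/-- The operator `a + b i E_ij`, up to a factor; `a = b = 0` counts as `a = 1`, `b = 0`. -/
def exchange (i j : W) (a b : ℤ) : Gadget W := wrap [false, true, true] fun p =>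
  seqs (start (p 0) (p 1) (p 2) ++ integer (p 0) (p 2) a ++ integer (p 0) (p 1) b ++
    (if a = 0 ∧ b = 0 then [digit (p 2) true] else []) ++ finish (p 0) i j)

/-- The gadgets `G` and `G'` differ only in the names of the wires. -/
def Renames (f : W → V) (G : Gadget W) (G' : Gadget V) : Prop :=
  ∀ a, G' (fun k => f (a k)) = ((G a).1.map (RawGate.map f), (G a).2)

namespace Renames

variable {f : W → V}

theorem nil : Renames f nil nil := fun _ => rfl

theorem gate (g : RawGate W) : Renames f (gate g) (gate (g.map f)) := fun _ => rfl

theorem fil (i : W) (v neg : Bool) : Renames f (fil i v neg) (fil (f i) v neg) := fun _ => rfl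

theorem seq {G H : Gadget W} {G' H' : Gadget V} (hG : Renames f G G') (hH : Renames f H H') :
    Renames f (seq G H) (seq G' H') := by
  intro a
  have h := hH fun k => a ((G a).2.length + k)
  simp only [Gadget.seq, hG a, List.map_append, h]

theorem seqs {l : List (Gadget W)} {l' : List (Gadget V)} (h : List.Forall₂ (Renames f) l l') :
    Renames f (seqs l) (seqs l') := by
  induction h with
  | nil => exact nil
  | cons h _ ih => exact seq h ih

theorem wrap {vs : List Bool} {G : (ℕ → W) → Gadget W} {G' : (ℕ → V) → Gadget V}
    (h : ∀ p, Renames f (G p) (G' fun k => f (p k))) :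
    Renames f (wrap vs G) (wrap vs G') := by
  intro a
  have := h a fun k => a (vs.length + k)
  simp only [Gadget.wrap, this]

theorem ph (i : W) : Renames f (ph i) (ph (f i)) :=
  seqs (.cons (fil _ _ _) (.cons (fil _ _ _) .nil))

theorem phInv (i : W) : Renames f (phInv i) (phInv (f i)) :=
  seqs (.cons (fil _ _ _) (.cons (fil _ _ _) .nil))

theorem hp (i j : W) : Renames f (hp i j) (hp (f i) (f j)) :=
  seqs (.cons (phInv i) (.cons (gate _) (.cons (phInv i) .nil)))

theorem cz (i j : W) : Renames f (cz i j) (cz (f i) (f j)) :=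
  seqs (.cons (gate _) (.cons (ph i) (.cons (ph i) (.cons (gate _) (.cons (ph j)
    (.cons (phInv i) .nil))))))

theorem cx (i j j' : W) : Renames f (cx i j j') (cx (f i) (f j) (f j')) :=
  seqs (.cons (hp j j') (.cons (cz i j) (.cons (hp j j') .nil)))

theorem tof (x y t t' : W) : Renames f (tof x y t t') (tof (f x) (f y) (f t) (f t')) :=
  seqs (.cons (hp t t') (.cons
    (wrap fun _ => seqs (.cons (hp _ _) (.cons (fil _ _ _) (.cons (cz _ _) (.cons (cx _ _ _)
      (.cons (fil _ _ _) (.cons (cx _ _ _) (.cons (fil _ _ _) (.cons (cx _ _ _) (.cons (fil _ _ _)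
      (.cons (hp _ _) .nil))))))))))) (.cons
    (wrap fun _ => seqs (.cons (hp _ _) (.cons (fil _ _ _) (.cons (fil _ _ _) (.cons (ph _)
      (.cons (ph _) (.cons (cz _ _) (.cons (hp _ _) .nil)))))))) (.cons (hp t t') .nil))))

theorem digit (u : W) (d : Bool) : Renames f (digit u d) (digit (f u) d) := by
  cases d <;> exact fun _ => rfl

theorem signFlip (c : W) : Renames f (signFlip c) (signFlip (f c)) := fun _ => rfl

end Renames

end Gadget

/-! ### Programs that emit gadgets -/

/-- The unary counters of a compiler: the number of qubits so far, and three operands. -/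
inductive Counter
  | base
  | fst
  | snd
  | trd
  deriving DecidableEq

/-- The stack of a counter. -/
def Counter.stk : Counter → Stk
  | base => .b
  | fst => .w₁
  | snd => .w₂
  | trd => .w₃

/-- The state of a compiler: the gates and the register entries emitted so far (in reverse), the
number of flags, and the values of the counters. -/
@[ext]
structure Cfg where
  g : List Symbol
  r : List Symbol
  z : ℕ
  σ : Counter → ℕ

/-- Symbolic wires: a counter and an offset. -/
abbrev SWire : Type := Counter × ℕ

/-- The wire that a symbolic wire stands for. -/
def ev (σ : Counter → ℕ) (x : SWire) : ℕ := σ x.1 + x.2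

/-- A string of ticks. -/
abbrev ticks (n : ℕ) : List Symbol := List.replicate n Symbol.tick

/-- The stacks in the state `C` when the symbols `i` are still to be read. -/
def Cfg.st (C : Cfg) (i : List Symbol) : Stk → List Symbol :=
  ({ inp := i, g := C.g, r := C.r, z := ticks C.z, b := ticks (C.σ .base), w₁ := ticks (C.σ .fst),
     w₂ := ticks (C.σ .snd), w₃ := ticks (C.σ .trd) } : Store Symbol).fn

/-- The description of ancillas with given values. -/
def ancCode (vs : List Bool) : List Symbol := vs.flatMap fun v => [.bit v, .post v]

theorem ancCode_append (vs ws : List Bool) : ancCode (vs ++ ws) = ancCode vs ++ ancCode ws :=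
  List.flatMap_append

/-- Emit a gadget: append its gates and its ancillas. -/
def Cfg.emit (C : Cfg) (G : Gadget ℕ) : Cfg where
  g := ((G fun k => C.σ .base + k).1.flatMap RawGate.code).reverse ++ C.g
  r := (ancCode (G fun k => C.σ .base + k).2).reverse ++ C.r
  z := C.z
  σ := Function.update C.σ .base (C.σ .base + (G fun k => C.σ .base + k).2.length)

namespace Cfg

theorem emit_nil (C : Cfg) : C.emit Gadget.nil = C := by
  ext1 <;> simp [emit, Gadget.nil, ancCode]

theorem emit_seq (C : Cfg) (G H : Gadget ℕ) : C.emit (Gadget.seq G H) = (C.emit G).emit H := by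
  ext1 <;> simp [emit, Gadget.seq, ancCode_append, Nat.add_assoc]

theorem emit_seqs (C : Cfg) (l : List (Gadget ℕ)) : C.emit (Gadget.seqs l) = l.foldl emit C := by
  induction l generalizing C with
  | nil => exact emit_nil C
  | cons G l ih => exact (emit_seq C G _).trans (ih _)

/-- Ancillas shared by a whole list of gadgets are emitted at the beginning, together with an
initial segment of the list; the remaining gadgets can be emitted one by one. -/
theorem emit_wrap_append (C : Cfg) (vs : List Bool) (L L' : (ℕ → ℕ) → List (Gadget ℕ)) :
    C.emit (Gadget.wrap vs fun p => Gadget.seqs (L p ++ L' p)) =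
      (L' fun k => C.σ .base + k).foldl emit
        (C.emit (Gadget.wrap vs fun p => Gadget.seqs (L p))) := by
  rw [← emit_seqs]
  ext1 <;> simp [emit, Gadget.wrap, Gadget.seqs_append, Gadget.seq, ancCode_append, Nat.add_assoc]

theorem emit_σ_of_ne (C : Cfg) (G : Gadget ℕ) {o : Counter} (h : o ≠ .base) :
    (C.emit G).σ o = C.σ o := by simp [emit, h]

/-- Set a counter. -/
def set (C : Cfg) (o : Counter) (n : ℕ) : Cfg := { C with σ := Function.update C.σ o n }

variable (C : Cfg) (i l : List Symbol)

@[simp] theorem st_inp : C.st i .inp = i := rfl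
@[simp] theorem st_g : C.st i .g = C.g := rfl
@[simp] theorem st_r : C.st i .r = C.r := rfl
@[simp] theorem st_z : C.st i .z = ticks C.z := rfl
@[simp] theorem st_stk (o : Counter) : C.st i o.stk = ticks (C.σ o) := by cases o <;> rfl
theorem st_b : C.st i .b = ticks (C.σ .base) := rfl

@[simp] theorem update_inp : Function.update (C.st i) .inp l = C.st l := by
  funext k; cases k <;> rfl
@[simp] theorem update_g : Function.update (C.st i) .g l = { C with g := l }.st i := by
  funext k; cases k <;> rfl
@[simp] theorem update_r : Function.update (C.st i) .r l = { C with r := l }.st i := by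
  funext k; cases k <;> rfl
@[simp] theorem update_z (n : ℕ) :
    Function.update (C.st i) .z (ticks n) = { C with z := n }.st i := by
  funext k; cases k <;> rfl
@[simp] theorem update_stk (o : Counter) (n : ℕ) :
    Function.update (C.st i) o.stk (ticks n) = (C.set o n).st i := by
  funext k; cases o <;> cases k <;> rfl

end Cfg

/-- Programs on the stacks of the compilers. -/
abbrev CProg : Type := Prog fun _ : Stk => Symbol

/-- Emit the description of a wire. -/
def emitWire (x : SWire) : CProg :=
  .seq (.copy x.1.stk .g .t) (.pushes .g (ticks x.2 ++ [.sep]))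

/-- The program `p` appends the string `l` (which depends on the counters) to the gates. Its running
time is bounded in terms of a bound `M` for the counters. -/
def Emits (p : CProg) (c : ℕ) (l : (Counter → ℕ) → List Symbol) : Prop :=
  ∀ (C : Cfg) (i : List Symbol) (M : ℕ), (∀ o, C.σ o ≤ M) →
    Run p (C.st i) (c * (M + 1)) ({ C with g := (l C.σ).reverse ++ C.g }.st i)

theorem Emits.seq {p q : CProg} {c d : ℕ} {l m : (Counter → ℕ) → List Symbol} (hp : Emits p c l)
    (hq : Emits q d m) : Emits (.seq p q) (c + d) fun σ => l σ ++ m σ := by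
  intro C i M hM
  refine ((hp C i M hM).seq (hq _ i M hM)).congr rfl ?_ (by rw [Nat.add_mul])
  simp

theorem emits_pushes (l : List Symbol) : Emits (.pushes .g l) (l.length + 1) fun _ => l := by
  intro C i M _
  refine (run_pushes Stk.g l (C.st i)).congr rfl (by simp) ?_
  exact Nat.le_mul_of_pos_right _ (Nat.succ_pos M)

theorem emits_emitWire (x : SWire) :
    Emits (emitWire x) (x.2 + 11) fun σ => RawGate.wireCode (ev σ x) := by
  intro C i M hM
  have hx := hM x.1
  have h1 := run_copy (k := x.1.stk) (k' := Stk.g) (t := .t) (by cases x.1 <;> simp [Counter.stk])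
    (by cases x.1 <;> simp [Counter.stk]) (by simp) (C.st i) rfl
  simp only [Cfg.st_stk, Cfg.st_g, Cfg.update_g, List.length_replicate, List.reverse_replicate] at h1
  have h2 := run_pushes Stk.g (ticks x.2 ++ [.sep])
    ({ C with g := ticks (C.σ x.1) ++ C.g }.st i)
  simp only [Cfg.st_g, Cfg.update_g] at h2
  refine (h1.seq h2).congr rfl ?_ ?_
  · congr 2
    simp only [RawGate.wireCode, ev, List.reverse_append, List.reverse_replicate,
      List.append_assoc, List.replicate_add]
  · simp only [List.length_append, List.length_replicate, List.length_singleton]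
    nlinarith [Nat.zero_le (x.2 * M)]

/-- Emit the description of a gate. -/
def emitGate : RawGate SWire → CProg
  | .exch i j neg => .seq (.pushes .g [.exchange]) (.seq (.seq (.seq (emitWire i) (emitWire j))
      (.pushes .g (encodeInt (if neg then -1 else 1)))) (.pushes .g (encodeInt 1)))
  | .had q => .seq (.pushes .g [.hadamard]) (emitWire q)
  | .phase q => .seq (.pushes .g [.phase]) (emitWire q)
  | .cnot c t => .seq (.pushes .g [.cnot]) (.seq (emitWire c) (emitWire t))
  | .toff c₁ c₂ t => .seq (.pushes .g [.toffoli])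
      (.seq (.seq (emitWire c₁) (emitWire c₂)) (emitWire t))

theorem emits_emitGate (g : RawGate SWire) :
    ∃ c, Emits (emitGate g) c fun σ => (g.map (ev σ)).code := by
  cases g with
  | exch x y neg => exact ⟨_, (emits_pushes _).seq ((((emits_emitWire x).seq (emits_emitWire y)).seq
      (emits_pushes _)).seq (emits_pushes _))⟩
  | had q => exact ⟨_, (emits_pushes _).seq (emits_emitWire q)⟩
  | phase q => exact ⟨_, (emits_pushes _).seq (emits_emitWire q)⟩
  | cnot x y => exact ⟨_, (emits_pushes _).seq ((emits_emitWire x).seq (emits_emitWire y))⟩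
  | toff x y t => exact ⟨_, (emits_pushes _).seq (((emits_emitWire x).seq (emits_emitWire y)).seq
      (emits_emitWire t))⟩

/-- The gates of a gadget are emitted in time linear in the counters. -/
theorem emits_emitGates (gs : List (RawGate SWire)) : ∃ c, Emits (.seqs (gs.map emitGate)) c
    fun σ => (gs.map (RawGate.map (ev σ))).flatMap RawGate.code := by
  induction gs with
  | nil => exact ⟨1, fun C i M _ => (Run.skip _).congr rfl rfl (by omega)⟩
  | cons g gs ih =>
    obtain ⟨c, hc⟩ := emits_emitGate g
    obtain ⟨d, hd⟩ := ih
    exact ⟨c + d, hc.seq hd⟩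

/-- Emit ancillas. -/
def emitAncs (vs : List Bool) : CProg :=
  .seq (.pushes .r (ancCode vs)) (.pushes .b (ticks vs.length))

theorem run_emitAncs (vs : List Bool) (C : Cfg) (i : List Symbol) :
    Run (emitAncs vs) (C.st i) ((ancCode vs).length + vs.length + 2)
      (({ C with r := (ancCode vs).reverse ++ C.r }.set .base (C.σ .base + vs.length)).st i) := by
  have h1 := run_pushes Stk.r (ancCode vs) (C.st i)
  have h2 := run_pushes Stk.b (ticks vs.length) ({ C with r := (ancCode vs).reverse ++ C.r }.st i)
  have e : ∀ (C : Cfg) n, Function.update (C.st i) Stk.b (ticks n) = (C.set .base n).st i :=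
    fun C n => Cfg.update_stk C i .base n
  simp only [Cfg.st_r, Cfg.update_r] at h1
  simp only [Cfg.st_b, List.reverse_replicate, ← List.replicate_add, e] at h2
  refine (h1.seq h2).congr rfl ?_ ?_
  · rw [Nat.add_comm]
  · simp; omega

/-- Emit a gadget on symbolic wires. -/
def emit (G : Gadget SWire) : CProg :=
  .seq (.seqs ((G fun k => (.base, k)).1.map emitGate)) (emitAncs (G fun k => (.base, k)).2)

/-- The program `emit G`, written for symbolic wires, has the effect of emitting the gadget `G'` on
the wires that they stand for. -/
theorem run_emit (G : Gadget SWire) : ∃ c, ∀ (C : Cfg) (i : List Symbol) (M : ℕ) (G' : Gadget ℕ),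
    Gadget.Renames (ev C.σ) G G' → (∀ o, C.σ o ≤ M) →
      Run (emit G) (C.st i) (c * (M + 1)) ((C.emit G').st i) ∧
      ∀ o, (C.emit G').σ o ≤ C.σ o + c := by
  obtain ⟨c, hc⟩ := emits_emitGates (G fun k => (.base, k)).1
  refine ⟨c + ((ancCode (G fun k => (.base, k)).2).length +
    (G fun k => (.base, k)).2.length + 2), fun C i M G' hG hM => ?_⟩
  have hG' : G' (fun k => C.σ .base + k) = _ := hG fun k => (.base, k)
  constructor
  · refine ((hc C i M hM).seq (run_emitAncs _ _ i)).congr rfl ?_ ?_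
    · congr 1
      simp only [Cfg.emit, hG', Cfg.set]
    · rw [Nat.add_mul]
      exact Nat.add_le_add_left (Nat.le_mul_of_pos_right _ (Nat.succ_pos M)) _
  · intro o
    by_cases ho : o = .base
    · subst ho
      simp only [Cfg.emit, hG', Function.update_self]
      omega
    · rw [Cfg.emit_σ_of_ne _ _ ho]
      omega

/-! ### Programs that read descriptions -/

/-- Add `m` times the number of a wire to a counter. -/
def readWire (o : Counter) (m : ℕ) : CProg :=
  .loop .inp (fun s => decide (s ≠ some .tick)) fun s =>
    if s = some .tick then .pushes o.stk (ticks m) else .skip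

theorem run_readWire (o : Counter) (m q : ℕ) (C : Cfg) (l : List Symbol) :
    Run (readWire o m) (C.st (RawGate.wireCode q ++ l)) ((m + 2) * (q + 1))
      ((C.set o (m * q + C.σ o)).st l) := by
  induction q generalizing C with
  | zero =>
    refine (Run.loop_exit (some .sep) (s₁ := C.st l) rfl (by simp [RawGate.wireCode]) rfl
      (Run.skip _)).congr rfl ?_ (by omega)
    rw [Nat.mul_zero, Nat.zero_add, Cfg.set, Function.update_eq_self]
  | succ q ih =>
    have h1 : Run (.pushes o.stk (ticks m)) (C.st (RawGate.wireCode q ++ l)) (m + 1)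
        ((C.set o (m + C.σ o)).st (RawGate.wireCode q ++ l)) := by
      refine (run_pushes _ _ _).congr rfl ?_ (by simp)
      rw [Cfg.st_stk, List.reverse_replicate, ← List.replicate_add, Cfg.update_stk]
    refine (Run.loop_again (some .tick) (s₁ := C.st (RawGate.wireCode q ++ l)) rfl ?_ rfl h1
      (ih _)).congr rfl ?_ ?_
    · simp [RawGate.wireCode, List.replicate_succ]
    · simp only [Cfg.set, Function.update_self, Function.update_idem]
      congr 3
      ring
    · have : (m + 2) * (q + 1 + 1) = (m + 2) * (q + 1) + (m + 2) := by ring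
      omega

theorem run_clearCounter (o : Counter) (C : Cfg) (l : List Symbol) :
    Run (.clear o.stk) (C.st l) (C.σ o * 2 + 2) ((C.set o 0).st l) := by
  refine (run_clear o.stk (C.st l)).congr rfl ?_ (by simp)
  exact Cfg.update_stk C l o 0

/-- Read the role of a qubit and emit register entries. -/
def readEntry (v : Bool) (l : List Symbol) (n : ℕ) : CProg :=
  .seq (.loop .inp (fun _ => true) fun s => .pushes .r (Symbol.bit v :: s.toList ++ l))
    (.pushes .b (ticks n))

theorem run_readEntry (v : Bool) (s : Symbol) (l : List Symbol) (n : ℕ) (C : Cfg)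
    (i : List Symbol) : Run (readEntry v l n) (C.st (s :: i)) (l.length + n + 5)
      (({ C with r := (Symbol.bit v :: s :: l).reverse ++ C.r }.set .base (C.σ .base + n)).st i) := by
  have h1 : Run (.loop .inp (fun _ => true) fun s => .pushes .r (Symbol.bit v :: s.toList ++ l))
      (C.st (s :: i)) (l.length + 2 + 1 + 1)
      ({ C with r := (Symbol.bit v :: s :: l).reverse ++ C.r }.st i) :=
    Run.loop_exit (some s) (s₁ := C.st i) rfl (by simp) rfl
      ((run_pushes _ _ _).congr rfl (by simp) (by simp))
  have h2 := run_pushes Stk.b (ticks n) ({ C with r := (Symbol.bit v :: s :: l).reverse ++ C.r }.st i)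
  have e : ∀ (C : Cfg) n, Function.update (C.st i) Stk.b (ticks n) = (C.set .base n).st i :=
    fun C n => Cfg.update_stk C i .base n
  simp only [Cfg.st_b, List.reverse_replicate, ← List.replicate_add, e] at h2
  refine (h1.seq h2).congr rfl ?_ ?_
  · rw [Nat.add_comm]
  · simp; omega

/-! ### The main loop of a compiler -/

/-- The auxiliary counters and the flags are cleared. -/
structure Cfg.Clean (C : Cfg) : Prop where
  z : C.z = 0
  fst : C.σ .fst = 0
  snd : C.σ .snd = 0
  trd : C.σ .trd = 0

/-- The initial state of a compiler. -/
def Cfg.init : Cfg := ⟨[], [], 0, fun _ => 0⟩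

/-- `body` deals with the item `x` in the state `C` as prescribed by the new state `C'`. Its running
time is bounded in terms of the length of the item and a bound `M` for that and for the number of
qubits. -/
structure Handles (body : Option Symbol → CProg) (c : ℕ) (code : List Symbol) (C C' : Cfg) : Prop
    where
  clean : C'.Clean
  base_le : C'.σ .base ≤ C.σ .base + c * code.length
  run : ∃ a l, code = a :: l ∧ ∀ rest M, C.σ .base ≤ M → code.length ≤ M →
    Run (body (some a)) (C.st (l ++ rest)) (c * (M + 1) * code.length) (C'.st rest)

/-- The loop over all items. The number of qubits stays linear in the length of the input read so
far, so a single bound `M` for the counters serves all rounds. -/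
theorem run_items {ι : Type} {body : Option Symbol → CProg} {code : ι → List Symbol}
    {step : Cfg → ι → Cfg} {c : ℕ} (h0 : body none = .skip) (items : List ι)
    (h : ∀ x ∈ items, ∀ C : Cfg, C.Clean → Handles body c (code x) C (step C x))
    (C : Cfg) (hC : C.Clean) (M : ℕ)
    (hM : C.σ .base + (c + 1) * (items.flatMap code).length ≤ M) :
    Run (.loop .inp Option.isNone body) (C.st (items.flatMap code))
      ((c * (M + 1) + 1) * (items.flatMap code).length + 2) ((items.foldl step C).st []) ∧
    (items.foldl step C).Clean := by
  induction items generalizing C with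
  | nil =>
    refine ⟨(Run.loop_exit none (s₁ := C.st []) rfl (by simp) rfl (t := 1) ?_).congr rfl rfl
      (by simp), hC⟩
    rw [h0]
    exact .skip _
  | cons x items ih =>
    obtain ⟨h1, h2, a, l, e, h3⟩ := h x (by simp) C hC
    rw [List.flatMap_cons, List.length_append, Nat.mul_add (c + 1)] at hM
    rw [List.flatMap_cons, List.length_append, Nat.mul_add (c * (M + 1) + 1)]
    have h4 : (code x).length ≤ (c + 1) * (code x).length := Nat.le_mul_of_pos_left _ (by omega)
    have h6 : (c + 1) * (code x).length = c * (code x).length + (code x).length := by ring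
    obtain ⟨h5, h5'⟩ := ih (fun y hy => h y (by simp [hy])) (step C x) h1 (by omega)
    refine ⟨(Run.loop_again (some a) (s₁ := C.st (l ++ items.flatMap code)) ?_ ?_ rfl
      (h3 (items.flatMap code) M (by omega) (by omega)) h5).congr rfl rfl ?_, h5'⟩
    · simp [e]
    · simp [e]
    · have : 1 ≤ (code x).length := by simp [e]
      have : (c * (M + 1) + 1) * (code x).length = c * (M + 1) * (code x).length +
        (code x).length := by ring
      omega

/-- A compiler that deals with its input item by item runs in polynomial time. -/
theorem computable_of_handles {ι α β : Type} {ea : α → List Symbol} {eb : β → List Symbol}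
    {f : α → β} {body : Option Symbol → CProg} {code : ι → List Symbol} {step : Cfg → ι → Cfg}
    {c : ℕ} (items : α → List ι) (h0 : body none = .skip)
    (h : ∀ a, ∀ x ∈ items a, ∀ C : Cfg, C.Clean → Handles body c (code x) C (step C x))
    (hin : ∀ a, ea a = (items a).flatMap code)
    (hout : ∀ a, eb (f a) = ((items a).foldl step .init).r.reverse ++
      ((items a).foldl step .init).g.reverse) :
    Nonempty (TM2ComputableInPolyTime ea eb f) := by
  refine computable_of_run_store (.seq (.loop .inp Option.isNone body)
    (.seq (.move .g .out) (.seq (.move .r .out) (.clear .b))))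
    (((.C c * (.C (c + 1) * .X + 1) + 1) * .X + 2) * .C 7 + .C 6) fun a => ?_
  obtain ⟨h1, h2⟩ := run_items h0 (items a) (h a) .init ⟨rfl, rfl, rfl, rfl⟩
    ((c + 1) * (ea a).length) (by rw [hin a]; simp [Cfg.init])
  set C := (items a).foldl step .init with hC
  rw [← hin a] at h1
  have h3 := run_move (k := Stk.g) (k' := .out) (by simp)
    ({ g := C.g, r := C.r, b := ticks (C.σ .base) } : Store Symbol).fn
  have h4 := run_move (k := Stk.r) (k' := .out) (by simp)
    ({ out := C.g.reverse, r := C.r, b := ticks (C.σ .base) } : Store Symbol).fn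
  have h5 := run_clear Stk.b
    ({ out := C.r.reverse ++ C.g.reverse, b := ticks (C.σ .base) } : Store Symbol).fn
  have l1 := h1.length_le Stk.g
  have l2 := h1.length_le Stk.r
  have l3 := h1.length_le Stk.b
  simp only [Cfg.st_g, Cfg.st_r, Cfg.st_b, Cfg.init, List.length_nil, Nat.zero_add,
    List.length_replicate] at l1 l2 l3
  simp only [Store.fn_g, Store.fn_out, Store.update_g, Store.update_out, Store.fn_r,
    Store.update_r, Store.fn_b, Store.update_b, List.append_nil, List.length_replicate] at h3 h4 h5
  refine ⟨_, ?_, (h1.seq (Run.congr (h3.seq (h4.seq h5)) ?_ rfl le_rfl)).congr rfl ?_ le_rfl⟩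
  · simp only [Polynomial.eval_add, Polynomial.eval_mul, Polynomial.eval_X, Polynomial.eval_C,
      Polynomial.eval_ofNat, Polynomial.eval_one]
    omega
  · simp [Cfg.st, h2.z, h2.fst, h2.snd, h2.trd]
  · rw [hout a]

namespace Cfg

/-- The state `C` with the given values of the operands and the given number of flags. -/
def aux (C : Cfg) (x y w z : ℕ) : Cfg where
  g := C.g
  r := C.r
  z := z
  σ
    | .base => C.σ .base
    | .fst => x
    | .snd => y
    | .trd => w

variable (C : Cfg) (x y w z n : ℕ)

theorem Clean.eq_aux {C : Cfg} (h : C.Clean) : C = C.aux 0 0 0 0 := by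
  ext1
  · rfl
  · rfl
  · exact h.z
  · funext o
    cases o
    · rfl
    · exact h.fst
    · exact h.snd
    · exact h.trd

theorem clean_aux : (C.aux 0 0 0 0).Clean := ⟨rfl, rfl, rfl, rfl⟩

theorem aux_emit (G : Gadget ℕ) : (C.aux x y w z).emit G = (C.emit G).aux x y w z := by
  ext1
  · rfl
  · rfl
  · rfl
  · funext o
    cases o
    · simp [emit, aux]
    · simp [emit, aux]
    · simp [emit, aux]
    · simp [emit, aux]

theorem aux_set_fst : (C.aux x y w z).set .fst n = C.aux n y w z := by
  ext1 <;> try rfl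
  funext o; cases o <;> simp [set, aux]

theorem aux_set_snd : (C.aux x y w z).set .snd n = C.aux x n w z := by
  ext1 <;> try rfl
  funext o; cases o <;> simp [set, aux]

theorem aux_set_trd : (C.aux x y w z).set .trd n = C.aux x y n z := by
  ext1 <;> try rfl
  funext o; cases o <;> simp [set, aux]

@[simp] theorem aux_base : (C.aux x y w z).σ .base = C.σ .base := rfl
@[simp] theorem aux_fst : (C.aux x y w z).σ .fst = x := rfl
@[simp] theorem aux_snd : (C.aux x y w z).σ .snd = y := rfl
@[simp] theorem aux_trd : (C.aux x y w z).σ .trd = w := rfl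
@[simp] theorem aux_z : (C.aux x y w z).z = z := rfl

theorem aux_le {M : ℕ} (h : C.σ .base ≤ M) (hx : x ≤ M) (hy : y ≤ M) (hw : w ≤ M)
    (o : Counter) : (C.aux x y w z).σ o ≤ M := by
  cases o <;> assumption

end Cfg

theorem Handles.mono {body : Option Symbol → CProg} {c d : ℕ} {code : List Symbol} {C C' : Cfg}
    (h : Handles body c code C C') (hcd : c ≤ d) : Handles body d code C C' := by
  obtain ⟨h1, h2, a, l, e, h3⟩ := h
  exact ⟨h1, h2.trans (by gcongr), a, l, e, fun rest M hb hl =>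
    (h3 rest M hb hl).mono (by gcongr)⟩

/-- A form in which costs of items are collected: `L` is the length of the item, which is at least
`1`. -/
theorem cost_le {x a b k L M : ℕ} (hL : 1 ≤ L) (hx : x ≤ a * L + b * (M + 1)) (hk : a + b ≤ k) :
    x ≤ k * (M + 1) * L := by
  have h1 : a * L ≤ a * (M + 1) * L := Nat.mul_le_mul_right L (Nat.le_mul_of_pos_right a (by omega))
  have h2 : b * (M + 1) ≤ b * (M + 1) * L := Nat.le_mul_of_pos_right _ hL
  have h3 : (a + b) * (M + 1) * L ≤ k * (M + 1) * L := by gcongr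
  have h4 : (a + b) * (M + 1) * L = a * (M + 1) * L + b * (M + 1) * L := by ring
  omega

theorem length_wireCode (q : ℕ) : (RawGate.wireCode q).length = q + 1 := by
  simp [RawGate.wireCode]

/-! ### The compiler for general circuits -/

/-- The exchange gadget for a gate of the universal set. The qubit `q` is encoded in the dual-rail
pair `2 q`, `2 q + 1`. -/
def dualRail : RawGate ℕ → Gadget ℕ
  | .exch _ _ _ => Gadget.nil
  | .had q => Gadget.hp (2 * q) (2 * q + 1)
  | .phase q => Gadget.ph (2 * q)
  | .cnot c t => Gadget.cx (2 * c) (2 * t) (2 * t + 1)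
  | .toff c₁ c₂ t => Gadget.tof (2 * c₁) (2 * c₂) (2 * t) (2 * t + 1)

/-- The gate belongs to the universal set. -/
def RawGate.IsUniversal : RawGate ℕ → Prop
  | .exch _ _ _ => False
  | _ => True

/-- The loop body of the compiler from general circuits to exchange circuits. -/
def dualRailBody : Option Symbol → CProg
  | some (.bit v) => readEntry v [.bit (!v), .free] 2
  | some .hadamard => .seq (readWire .fst 2)
      (.seq (emit (Gadget.hp (.fst, 0) (.fst, 1))) (.clear Counter.fst.stk))
  | some .phase => .seq (readWire .fst 2)
      (.seq (emit (Gadget.ph (.fst, 0))) (.clear Counter.fst.stk))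
  | some .cnot => .seq (readWire .fst 2) (.seq (readWire .snd 2)
      (.seq (emit (Gadget.cx (.fst, 0) (.snd, 0) (.snd, 1)))
      (.seq (.clear Counter.fst.stk) (.clear Counter.snd.stk))))
  | some .toffoli => .seq (readWire .fst 2) (.seq (readWire .snd 2) (.seq (readWire .trd 2)
      (.seq (emit (Gadget.tof (.fst, 0) (.snd, 0) (.trd, 0) (.trd, 1)))
      (.seq (.clear Counter.fst.stk) (.seq (.clear Counter.snd.stk)
      (.clear Counter.trd.stk))))))
  | _ => .skip

/-- The items of the description of a general circuit: register entries and gates. -/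
abbrev GateItem : Type := (Bool × Symbol) ⊕ RawGate ℕ

/-- The description of an item. -/
def GateItem.code : GateItem → List Symbol
  | .inl x => [.bit x.1, x.2]
  | .inr g => g.code

/-- The effect of an item on the state of the compiler. -/
def dualRailStep (C : Cfg) : GateItem → Cfg
  | .inl x => { C with r := [Symbol.bit x.1, x.2, .bit (!x.1), .free].reverse ++ C.r }.set .base
      (C.σ .base + 2)
  | .inr g => C.emit (dualRail g)

/-- Register entries: the compiler emits the entry itself and additional entries `l`, and counts `n`
qubits. No gates are emitted, but the time constant has to cover the copying of `l`. -/
theorem handles_entry {body : Option Symbol → CProg} {C : Cfg} (hC : C.Clean) (v : Bool)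
    (s : Symbol) (l : List Symbol) (n : ℕ) (hb : body (some (.bit v)) = readEntry v l n) :
    Handles body (l.length + n + 5) [.bit v, s] C
      ({ C with r := (Symbol.bit v :: s :: l).reverse ++ C.r }.set .base (C.σ .base + n)) := by
  refine ⟨⟨hC.z, ?_, ?_, ?_⟩, ?_, .bit v, [s], rfl, fun rest M _ _ => ?_⟩
  · simp [Cfg.set, hC.fst]
  · simp [Cfg.set, hC.snd]
  · simp [Cfg.set, hC.trd]
  · simp [Cfg.set]; omega
  · rw [hb]
    refine (run_readEntry v s l n C rest).mono ?_
    exact cost_le (a := l.length + n + 5) (b := 0) (by simp) (by simp) (by omega)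

/-- Gates on one qubit: a symbol, followed by one wire. The counter is incremented by `2` for each
tick, since the qubit `x` is encoded from the wire `2 x` on. -/
theorem handles_unary {body : Option Symbol → CProg} {sym : Symbol} {G : Gadget SWire}
    {G' : ℕ → Gadget ℕ} (hb : body (some sym) = .seq (readWire .fst 2)
      (.seq (emit G) (.clear Counter.fst.stk)))
    (hr : ∀ (C : Cfg) x, Gadget.Renames (ev (C.aux (2 * x) 0 0 0).σ) G (G' x)) :
    ∃ c, ∀ C : Cfg, C.Clean → ∀ x,
      Handles body c (sym :: RawGate.wireCode x) C (C.emit (G' x)) := by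
  obtain ⟨c, hc⟩ := run_emit G
  refine ⟨2 * c + 8, fun C hC x => ?_⟩
  obtain ⟨C, rfl⟩ : ∃ D : Cfg, C = D.aux 0 0 0 0 := ⟨C, hC.eq_aux⟩
  have hb' := (hc _ [] _ _ (hr C x) (C.aux_le (2 * x) 0 0 0 (M := C.σ .base + 2 * x)
    (by omega) (by omega) (by omega) (by omega))).2 .base
  rw [Cfg.aux_emit] at hb' ⊢
  refine ⟨Cfg.clean_aux _, ?_, _, _, rfl, fun rest M hM hl => ?_⟩
  · simp only [Cfg.aux_base] at hb' ⊢
    simp only [List.length_cons, length_wireCode]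
    nlinarith
  · have h1 := run_readWire .fst 2 x (C.aux 0 0 0 0) rest
    rw [Cfg.aux_set_fst] at h1
    simp only [Cfg.aux_base, List.length_cons, length_wireCode] at hM hl ⊢
    have h2 := (hc _ rest _ _ (hr C x) (C.aux_le (2 * x) 0 0 0 (M := 2 * M)
      (by omega) (by omega) (by omega) (by omega))).1
    rw [Cfg.aux_emit] at h2
    have h3 := run_clearCounter .fst ((C.emit (G' x)).aux (2 * x) 0 0 0) rest
    rw [Cfg.aux_set_fst] at h3
    rw [hb]
    refine (h1.seq (h2.seq h3)).mono (cost_le (a := 8) (b := 2 * c) (by omega) ?_ (by omega))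
    simp only [Cfg.aux_fst]
    nlinarith

/-- Gates on two qubits: a symbol, followed by two wires. -/
theorem handles_binary {body : Option Symbol → CProg} {sym : Symbol} {G : Gadget SWire}
    {G' : ℕ → ℕ → Gadget ℕ} (hb : body (some sym) = .seq (readWire .fst 2) (.seq (readWire .snd 2)
      (.seq (emit G) (.seq (.clear Counter.fst.stk) (.clear Counter.snd.stk)))))
    (hr : ∀ (C : Cfg) x y, Gadget.Renames (ev (C.aux (2 * x) (2 * y) 0 0).σ) G (G' x y)) :
    ∃ c, ∀ C : Cfg, C.Clean → ∀ x y,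
      Handles body c (sym :: (RawGate.wireCode x ++ RawGate.wireCode y)) C (C.emit (G' x y)) := by
  obtain ⟨c, hc⟩ := run_emit G
  refine ⟨2 * c + 16, fun C hC x y => ?_⟩
  obtain ⟨C, rfl⟩ : ∃ D : Cfg, C = D.aux 0 0 0 0 := ⟨C, hC.eq_aux⟩
  have hb' := (hc _ [] _ _ (hr C x y) (C.aux_le (2 * x) (2 * y) 0 0
    (M := C.σ .base + 2 * x + 2 * y) (by omega) (by omega) (by omega) (by omega))).2 .base
  rw [Cfg.aux_emit] at hb' ⊢
  refine ⟨Cfg.clean_aux _, ?_, _, _, rfl, fun rest M hM hl => ?_⟩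
  · simp only [Cfg.aux_base] at hb' ⊢
    simp only [List.length_cons, List.length_append, length_wireCode]
    nlinarith
  · have h1 := run_readWire .fst 2 x (C.aux 0 0 0 0) (RawGate.wireCode y ++ rest)
    have h1' := run_readWire .snd 2 y (C.aux (2 * x) 0 0 0) rest
    rw [Cfg.aux_set_fst] at h1
    rw [Cfg.aux_set_snd] at h1'
    simp only [Cfg.aux_base, List.length_cons, List.length_append, length_wireCode] at hM hl ⊢
    have h2 := (hc _ rest _ _ (hr C x y) (C.aux_le (2 * x) (2 * y) 0 0 (M := 2 * M)
      (by omega) (by omega) (by omega) (by omega))).1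
    rw [Cfg.aux_emit] at h2
    have h3 := run_clearCounter .fst ((C.emit (G' x y)).aux (2 * x) (2 * y) 0 0) rest
    have h4 := run_clearCounter .snd ((C.emit (G' x y)).aux 0 (2 * y) 0 0) rest
    rw [Cfg.aux_set_fst] at h3
    rw [Cfg.aux_set_snd] at h4
    rw [hb, List.append_assoc]
    refine (h1.seq (h1'.seq (h2.seq (h3.seq h4)))).mono
      (cost_le (a := 16) (b := 2 * c) (by omega) ?_ (by omega))
    simp only [Cfg.aux_fst, Cfg.aux_snd]
    nlinarith

/-- Gates on three qubits: a symbol, followed by three wires. -/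
theorem handles_ternary {body : Option Symbol → CProg} {sym : Symbol} {G : Gadget SWire}
    {G' : ℕ → ℕ → ℕ → Gadget ℕ} (hb : body (some sym) = .seq (readWire .fst 2)
      (.seq (readWire .snd 2) (.seq (readWire .trd 2) (.seq (emit G)
      (.seq (.clear Counter.fst.stk) (.seq (.clear Counter.snd.stk) (.clear Counter.trd.stk)))))))
    (hr : ∀ (C : Cfg) x y w,
      Gadget.Renames (ev (C.aux (2 * x) (2 * y) (2 * w) 0).σ) G (G' x y w)) :
    ∃ c, ∀ C : Cfg, C.Clean → ∀ x y w, Handles body c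
      (sym :: (RawGate.wireCode x ++ RawGate.wireCode y ++ RawGate.wireCode w)) C
      (C.emit (G' x y w)) := by
  obtain ⟨c, hc⟩ := run_emit G
  refine ⟨2 * c + 24, fun C hC x y w => ?_⟩
  obtain ⟨C, rfl⟩ : ∃ D : Cfg, C = D.aux 0 0 0 0 := ⟨C, hC.eq_aux⟩
  have hb' := (hc _ [] _ _ (hr C x y w) (C.aux_le (2 * x) (2 * y) (2 * w) 0
    (M := C.σ .base + 2 * x + 2 * y + 2 * w)
    (by omega) (by omega) (by omega) (by omega))).2 .base
  rw [Cfg.aux_emit] at hb' ⊢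
  refine ⟨Cfg.clean_aux _, ?_, _, _, rfl, fun rest M hM hl => ?_⟩
  · simp only [Cfg.aux_base] at hb' ⊢
    simp only [List.length_cons, List.length_append, length_wireCode]
    nlinarith
  · have h1 := run_readWire .fst 2 x (C.aux 0 0 0 0)
      (RawGate.wireCode y ++ (RawGate.wireCode w ++ rest))
    have h1' := run_readWire .snd 2 y (C.aux (2 * x) 0 0 0) (RawGate.wireCode w ++ rest)
    have h1'' := run_readWire .trd 2 w (C.aux (2 * x) (2 * y) 0 0) rest
    rw [Cfg.aux_set_fst] at h1
    rw [Cfg.aux_set_snd] at h1'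
    rw [Cfg.aux_set_trd] at h1''
    simp only [Cfg.aux_base, List.length_cons, List.length_append, length_wireCode] at hM hl ⊢
    have h2 := (hc _ rest _ _ (hr C x y w) (C.aux_le (2 * x) (2 * y) (2 * w) 0 (M := 2 * M)
      (by omega) (by omega) (by omega) (by omega))).1
    rw [Cfg.aux_emit] at h2
    have h3 := run_clearCounter .fst ((C.emit (G' x y w)).aux (2 * x) (2 * y) (2 * w) 0) rest
    have h4 := run_clearCounter .snd ((C.emit (G' x y w)).aux 0 (2 * y) (2 * w) 0) rest
    have h5 := run_clearCounter .trd ((C.emit (G' x y w)).aux 0 0 (2 * w) 0) rest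
    rw [Cfg.aux_set_fst] at h3
    rw [Cfg.aux_set_snd] at h4
    rw [Cfg.aux_set_trd] at h5
    rw [hb, List.append_assoc, List.append_assoc]
    refine (h1.seq (h1'.seq (h1''.seq (h2.seq (h3.seq (h4.seq h5)))))).mono
      (cost_le (a := 24) (b := 2 * c) (by omega) ?_ (by omega))
    simp only [Cfg.aux_fst, Cfg.aux_snd, Cfg.aux_trd]
    nlinarith

/-- The compiler from general to exchange circuits handles every item as `dualRailStep` prescribes.
-/
theorem handles_dualRail : ∃ c, ∀ (x : GateItem), (∀ g, x = .inr g → g.IsUniversal) →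
    ∀ C : Cfg, C.Clean → Handles dualRailBody c x.code C (dualRailStep C x) := by
  obtain ⟨c₁, h₁⟩ := handles_unary (body := dualRailBody) (sym := .hadamard)
    (G' := fun q => dualRail (.had q)) rfl fun C x => Gadget.Renames.hp _ _
  obtain ⟨c₂, h₂⟩ := handles_unary (body := dualRailBody) (sym := .phase)
    (G' := fun q => dualRail (.phase q)) rfl fun C x => Gadget.Renames.ph _
  obtain ⟨c₃, h₃⟩ := handles_binary (body := dualRailBody) (sym := .cnot)
    (G' := fun c t => dualRail (.cnot c t)) rfl fun C x y => Gadget.Renames.cx _ _ _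
  obtain ⟨c₄, h₄⟩ := handles_ternary (body := dualRailBody) (sym := .toffoli)
    (G' := fun c₁ c₂ t => dualRail (.toff c₁ c₂ t)) rfl
    fun C x y w => Gadget.Renames.tof _ _ _ _
  refine ⟨9 + c₁ + c₂ + c₃ + c₄, ?_⟩
  rintro (⟨v, s⟩ | g) hg C hC
  · exact (handles_entry hC v s [.bit (!v), .free] 2 rfl).mono (by simp; omega)
  · cases g with
    | exch i j neg => exact (hg _ rfl).elim
    | had q => exact (h₁ C hC q).mono (by omega)
    | phase q => exact (h₂ C hC q).mono (by omega)
    | cnot x y => exact (h₃ C hC x y).mono (by omega)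
    | toff x y t => exact (h₄ C hC x y t).mono (by omega)

/-! ### The compiler for exchange circuits -/

/-- The digit that a symbol stands for, if there is one. -/
def digitOf : Option Symbol → Option Bool
  | some (.bit d) => some d
  | _ => none

/-- Read the digits of an integer and emit the gadgets for them; every digit leaves a flag. -/
def readDigits (u : SWire) : CProg :=
  .loop .inp (fun s => (digitOf s).isNone) fun s => (digitOf s).elim .skip fun d =>
    .seq (emit (Gadget.digit u d)) (.push .z .tick)

/-- While digits are read, the gadgets refer to the wire `u` through a counter other than the number
of qubits, which grows with every digit. The number `z` of flags grows by the number of digits. -/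
theorem run_readDigits (u : SWire) (hu : u.1 ≠ .base) : ∃ c, ∀ (ds : List Bool) (C : Cfg)
    (x y w z M : ℕ) (rest : List Symbol),
    (∀ o, (C.aux x y w z).σ o + c * ds.length ≤ M) →
    Run (readDigits u) ((C.aux x y w z).st (ds.map Symbol.bit ++ Symbol.sep :: rest))
      (c * (M + 1) * (ds.length + 1))
      ((((ds.map (Gadget.digit (ev (C.aux x y w z).σ u))).foldl Cfg.emit C).aux x y w
        (z + ds.length)).st rest) ∧
    ((ds.map (Gadget.digit (ev (C.aux x y w z).σ u))).foldl Cfg.emit C).σ .base ≤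
      C.σ .base + c * ds.length := by
  obtain ⟨c₀, h₀⟩ := run_emit (Gadget.digit u false)
  obtain ⟨c₁, h₁⟩ := run_emit (Gadget.digit u true)
  have hd : ∀ (d : Bool) (C : Cfg) (i : List Symbol) (M : ℕ), (∀ o, C.σ o ≤ M) →
      Run (emit (Gadget.digit u d)) (C.st i) ((c₀ + c₁) * (M + 1))
        ((C.emit (Gadget.digit (ev C.σ u) d)).st i) ∧
      ∀ o, (C.emit (Gadget.digit (ev C.σ u) d)).σ o ≤ C.σ o + (c₀ + c₁) := by
    intro d C i M hM
    cases d with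
    | false =>
      obtain ⟨h, h'⟩ := h₀ C i M _ (Gadget.Renames.digit u false) hM
      exact ⟨h.mono (by gcongr; omega), fun o => (h' o).trans (by omega)⟩
    | true =>
      obtain ⟨h, h'⟩ := h₁ C i M _ (Gadget.Renames.digit u true) hM
      exact ⟨h.mono (by gcongr; omega), fun o => (h' o).trans (by omega)⟩
  refine ⟨c₀ + c₁ + 2, fun ds => ?_⟩
  induction ds with
  | nil =>
    intro C x y w z M rest hM
    refine ⟨(Run.loop_exit (some .sep) (s₁ := (C.aux x y w z).st rest) rfl (by simp) rfl
      (Run.skip _)).congr rfl rfl ?_, by simp⟩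
    nlinarith [Nat.zero_le ((c₀ + c₁) * (M + 1)), Nat.zero_le M]
  | cons d ds ih =>
    intro C x y w z M rest hM
    simp only [List.length_cons, Nat.mul_add, Nat.mul_one] at hM
    obtain ⟨h1, h2⟩ := hd d (C.aux x y w z) (ds.map Symbol.bit ++ Symbol.sep :: rest) M
      fun o => by have := hM o; omega
    rw [Cfg.aux_emit] at h1
    have h2' := h2 .base
    simp only [Cfg.aux_emit, Cfg.aux_base] at h2'
    set C' := C.emit (Gadget.digit (ev (C.aux x y w z).σ u) d) with hC'
    have hev : ev (C'.aux x y w (z + 1)).σ u = ev (C.aux x y w z).σ u := by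
      obtain ⟨o, k⟩ := u
      cases o
      · exact (hu rfl).elim
      · rfl
      · rfl
      · rfl
    have hle : ∀ o, (C'.aux x y w (z + 1)).σ o + (c₀ + c₁ + 2) * ds.length ≤ M := by
      intro o
      have := hM o
      cases o
      · simp only [Cfg.aux_base] at this ⊢
        omega
      all_goals
        simp only [Cfg.aux_fst, Cfg.aux_snd, Cfg.aux_trd] at this ⊢
        omega
    obtain ⟨h3, h4⟩ := ih C' x y w (z + 1) M rest hle
    rw [hev] at h3 h4
    have h5 : Run (.push .z .tick) ((C'.aux x y w z).st (ds.map Symbol.bit ++ Symbol.sep :: rest)) 1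
        ((C'.aux x y w (z + 1)).st (ds.map Symbol.bit ++ Symbol.sep :: rest)) := by
      refine (run_push Stk.z _ _).congr rfl ?_ le_rfl
      rw [Cfg.st_z, ← List.replicate_succ, Cfg.update_z]
      rfl
    refine ⟨(Run.loop_again (some (.bit d)) (by simp) (by simp) rfl (h1.seq h5) h3).congr rfl
      ?_ ?_, ?_⟩
    · rw [List.map_cons, List.foldl_cons, ← hC', List.length_cons, Nat.add_right_comm,
        Nat.add_assoc z]
    · simp only [List.length_cons]
      nlinarith [Nat.zero_le M, Nat.zero_le ((c₀ + c₁) * (M + 1))]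
    · rw [List.map_cons, List.foldl_cons, ← hC', List.length_cons]
      have : (c₀ + c₁ + 2) * (ds.length + 1) = (c₀ + c₁ + 2) * ds.length + (c₀ + c₁ + 2) := by ring
      omega

/-- Read an integer and emit the gadgets for it. -/
def readInt (c u : SWire) : CProg :=
  .seq (.loop .inp (fun _ => true) fun s =>
    if s = some (.bit true) then emit (Gadget.signFlip c) else .skip) (readDigits u)

theorem run_readInt (c u : SWire) (hu : u.1 ≠ .base) : ∃ k, ∀ (n : ℤ) (C : Cfg)
    (x y w z M : ℕ) (rest : List Symbol),
    (∀ o, (C.aux x y w z).σ o + k * (encodeInt n).length ≤ M) →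
    Run (readInt c u) ((C.aux x y w z).st (encodeInt n ++ rest))
      (k * (M + 1) * (encodeInt n).length)
      ((((Gadget.integer (ev (C.aux x y w z).σ c) (ev (C.aux x y w z).σ u) n).foldl
        Cfg.emit C).aux x y w (z + (Computability.encodeNat n.natAbs).length)).st rest) ∧
    ((Gadget.integer (ev (C.aux x y w z).σ c) (ev (C.aux x y w z).σ u) n).foldl
      Cfg.emit C).σ .base ≤ C.σ .base + k * (encodeInt n).length := by
  obtain ⟨k₁, h₁⟩ := run_emit (Gadget.signFlip c)
  obtain ⟨k₂, h₂⟩ := run_readDigits u hu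
  refine ⟨k₁ + k₂ + 3, fun n C x y w z M rest hM => ?_⟩
  set ds := Computability.encodeNat n.natAbs with hds
  have hlen : (encodeInt n).length = ds.length + 2 := by simp [encodeInt, ← hds]
  have henc : encodeInt n ++ rest =
      Symbol.bit (decide (n < 0)) :: (ds.map Symbol.bit ++ Symbol.sep :: rest) := by
    simp [encodeInt, ← hds]
  rw [hlen] at hM ⊢
  rw [henc]
  have hM' : ∀ o, (C.aux x y w z).σ o + k₁ + k₂ * ds.length ≤ M := by
    intro o
    have := hM o
    have e : (k₁ + k₂ + 3) * (ds.length + 2) = k₁ * (ds.length + 2) + k₂ * ds.length + 2 * k₂ +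
      3 * (ds.length + 2) := by ring
    have e' : k₁ ≤ k₁ * (ds.length + 2) := Nat.le_mul_of_pos_right _ (by omega)
    omega
  -- the symbol for the sign is read in any case, but only a negative sign emits gates
  obtain ⟨C', hC', hrun, hb⟩ : ∃ C', C' = (if n < 0 then
      [Gadget.signFlip (ev (C.aux x y w z).σ c)] else []).foldl Cfg.emit C ∧
      Run (.loop .inp (fun _ => true) fun s =>
        if s = some (.bit true) then emit (Gadget.signFlip c) else .skip)
        ((C.aux x y w z).st (Symbol.bit (decide (n < 0)) ::
          (ds.map Symbol.bit ++ Symbol.sep :: rest))) ((k₁ + 2) * (M + 1))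
        ((C'.aux x y w z).st (ds.map Symbol.bit ++ Symbol.sep :: rest)) ∧
      C'.σ .base ≤ C.σ .base + k₁ := by
    by_cases hn : n < 0
    · obtain ⟨h1, h2⟩ := h₁ (C.aux x y w z) (ds.map Symbol.bit ++ Symbol.sep :: rest) M _
        (Gadget.Renames.signFlip c) fun o => by have := hM' o; omega
      rw [Cfg.aux_emit] at h1
      refine ⟨_, by rw [if_pos hn], (Run.loop_exit (some (.bit true)) (by simp [hn])
        (by simp; rfl) rfl (by rw [if_pos rfl]; exact h1)).mono ?_, ?_⟩
      · nlinarith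
      · have := h2 .base
        rw [Cfg.aux_emit] at this
        exact this
    · refine ⟨C, by rw [if_neg hn]; rfl, (Run.loop_exit (some (.bit false)) (by simp [hn])
        (by simp; rfl) rfl (by rw [if_neg (by simp)]; exact Run.skip _)).mono ?_, by omega⟩
      nlinarith [Nat.zero_le (k₁ * (M + 1))]
  have hev : ev (C'.aux x y w z).σ u = ev (C.aux x y w z).σ u := by
    obtain ⟨o, k⟩ := u
    cases o
    · exact (hu rfl).elim
    · rfl
    · rfl
    · rfl
  obtain ⟨h3, h4⟩ := h₂ ds C' x y w z M rest (by
    intro o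
    have := hM' o
    cases o
    · simp only [Cfg.aux_base] at this ⊢
      omega
    all_goals
      simp only [Cfg.aux_fst, Cfg.aux_snd, Cfg.aux_trd] at this ⊢
      omega)
  rw [hev] at h3 h4
  have hfold : (Gadget.integer (ev (C.aux x y w z).σ c) (ev (C.aux x y w z).σ u) n).foldl
      Cfg.emit C = (ds.map (Gadget.digit (ev (C.aux x y w z).σ u))).foldl Cfg.emit C' := by
    rw [Gadget.integer, List.foldl_append, ← hC']
  rw [hfold]
  refine ⟨(hrun.seq h3).mono ?_, ?_⟩
  · nlinarith [Nat.zero_le (k₁ * (M + 1) * ds.length), Nat.zero_le (k₂ * (M + 1)),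
      Nat.zero_le (k₁ * (M + 1)), Nat.zero_le ((M + 1) * ds.length)]
  · nlinarith [Nat.zero_le (k₁ * ds.length)]

/-- Zero is the only number without binary digits; so there are no flags after both integers have
been read exactly if both are zero. -/
theorem encodeNat_eq_nil_iff (n : ℕ) : Computability.encodeNat n = [] ↔ n = 0 := by
  constructor
  · intro h
    have := Computability.decode_encodeNat n
    rw [h] at this
    exact this.symm
  · rintro rfl
    rfl

/-- Emit one more digit if there are no flags, and clear the flags. -/
def readFlags (u : SWire) : CProg :=
  .seq (.loop .z (fun _ => true) fun s =>
    if s = none then emit (Gadget.digit u true) else .skip) (.clear .z)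

theorem run_readFlags (u : SWire) : ∃ c, ∀ (C : Cfg)
    (x y w z M : ℕ) (rest : List Symbol), (∀ o, (C.aux x y w z).σ o ≤ M) → z ≤ M →
    Run (readFlags u) ((C.aux x y w z).st rest) (c * (M + 1))
      ((((if z = 0 then [Gadget.digit (ev (C.aux x y w z).σ u) true] else []).foldl
        Cfg.emit C).aux x y w 0).st rest) ∧
    ((if z = 0 then [Gadget.digit (ev (C.aux x y w z).σ u) true] else []).foldl
        Cfg.emit C).σ .base ≤ C.σ .base + c := by
  obtain ⟨c, h⟩ := run_emit (Gadget.digit u true)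
  refine ⟨c + 4, fun C x y w z M rest hM hz => ?_⟩
  have hclear : ∀ (C : Cfg) z, Run (.clear .z) ((C.aux x y w z).st rest) (z * 2 + 2)
      ((C.aux x y w 0).st rest) := by
    intro C z
    refine (run_clear Stk.z _).congr rfl ?_ (by simp)
    exact Cfg.update_z (C.aux x y w z) rest 0
  cases z with
  | zero =>
    obtain ⟨h1, h2⟩ := h (C.aux x y w 0) rest M _ (Gadget.Renames.digit u true) hM
    rw [Cfg.aux_emit] at h1
    refine ⟨((Run.loop_exit none (by simp) ?_ rfl (by rw [if_pos rfl]; exact h1)).seq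
      (hclear _ 0)).mono ?_, ?_⟩
    · exact Cfg.update_z (C.aux x y w 0) rest 0
    · nlinarith
    · have := h2 .base
      simp only [Cfg.aux_emit, Cfg.aux_base] at this
      simp only [if_true, List.foldl_cons, List.foldl_nil]
      omega
  | succ z =>
    refine ⟨((Run.loop_exit (some .tick) ?_ ?_ rfl
      (by rw [if_neg (by simp)]; exact Run.skip ((C.aux x y w z).st rest))).seq
      (hclear _ z)).mono ?_, ?_⟩
    · rw [Cfg.st_z]; rfl
    · rw [Cfg.st_z]
      exact Cfg.update_z (C.aux x y w (z + 1)) rest z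
    · nlinarith [Nat.zero_le (c * (M + 1))]
    · simp

/-- The items of the description of an exchange circuit: register entries and gates. -/
abbrev ExchangeItem : Type := (Bool × Symbol) ⊕ (ℕ × ℕ × ℤ × ℤ)

/-- The description of an item. -/
def ExchangeItem.code : ExchangeItem → List Symbol
  | .inl x => [.bit x.1, x.2]
  | .inr (i, j, a, b) => Symbol.exchange ::
      (RawGate.wireCode i ++ RawGate.wireCode j ++ encodeInt a ++ encodeInt b)

/-- The effect of an item on the state of the compiler. -/
def exchangeStep (C : Cfg) : ExchangeItem → Cfg
  | .inl x => { C with r := [Symbol.bit x.1, x.2].reverse ++ C.r }.set .base (C.σ .base + 1)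
  | .inr (i, j, a, b) => C.emit (Gadget.exchange i j a b)

/-- The ancillas of the exchange gadget and the gates that entangle them. -/
def Gadget.prelude {W : Type} : Gadget W :=
  Gadget.wrap [false, true, true] fun p => Gadget.seqs (Gadget.start (p 0) (p 1) (p 2))

/-- The loop body of the compiler from exchange circuits to general circuits. -/
def exchangeBody : Option Symbol → CProg
  | some (.bit v) => readEntry v [] 1
  | some .exchange => .seq (readWire .fst 1) (.seq (readWire .snd 1) (.seq (.copy .b .w₃ .t)
      (.seq (emit Gadget.prelude) (.seq (readInt (.trd, 0) (.trd, 2))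
      (.seq (readInt (.trd, 0) (.trd, 1)) (.seq (readFlags (.trd, 2))
      (.seq (emit (Gadget.seqs (Gadget.finish (.trd, 0) (.fst, 0) (.snd, 0))))
      (.seq (.clear Counter.fst.stk) (.seq (.clear Counter.snd.stk)
      (.clear Counter.trd.stk))))))))))
  | _ => .skip

/-- The exchange gadget, in the portions in which the compiler emits it. -/
theorem emit_exchange (C : Cfg) (i j : ℕ) (a b : ℤ) : C.emit (Gadget.exchange i j a b) =
    (Gadget.finish (C.σ .base) i j).foldl Cfg.emit
    ((if a = 0 ∧ b = 0 then [Gadget.digit (C.σ .base + 2) true] else []).foldl Cfg.emit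
    ((Gadget.integer (C.σ .base) (C.σ .base + 1) b).foldl Cfg.emit
    ((Gadget.integer (C.σ .base) (C.σ .base + 2) a).foldl Cfg.emit
    (C.emit Gadget.prelude)))) := by
  have := C.emit_wrap_append [false, true, true] (fun p => Gadget.start (p 0) (p 1) (p 2))
    fun p => Gadget.integer (p 0) (p 2) a ++ Gadget.integer (p 0) (p 1) b ++
      (if a = 0 ∧ b = 0 then [Gadget.digit (p 2) true] else []) ++ Gadget.finish (p 0) i j
  simp only [List.foldl_append, ← List.append_assoc] at this
  exact this

/-- The compiler from exchange to general circuits handles gates correctly. It keeps the number of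
the first ancilla of the gadget in the counter `trd`, and reads both integers only once, digit by
digit. -/
theorem handles_exchange : ∃ c, ∀ i j a b, ∀ C : Cfg, C.Clean →
    Handles exchangeBody c (ExchangeItem.code (.inr (i, j, a, b))) C
      (C.emit (Gadget.exchange i j a b)) := by
  obtain ⟨c₁, h₁⟩ := run_emit Gadget.prelude
  obtain ⟨c₂, h₂⟩ := run_readInt (.trd, 0) (.trd, 2) (by simp)
  obtain ⟨c₃, h₃⟩ := run_readInt (.trd, 0) (.trd, 1) (by simp)
  obtain ⟨c₄, h₄⟩ := run_readFlags (.trd, 2)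
  obtain ⟨c₅, h₅⟩ := run_emit (Gadget.seqs (Gadget.finish (.trd, 0) (.fst, 0) (.snd, 0)))
  obtain ⟨K, hK⟩ : ∃ K, K = c₁ + c₂ + c₃ + c₄ + c₅ := ⟨_, rfl⟩
  refine ⟨2 * K * (K + 3) + 15, fun i j a b C hC => ?_⟩
  obtain ⟨C, rfl⟩ : ∃ D : Cfg, C = D.aux 0 0 0 0 := ⟨C, hC.eq_aux⟩
  rw [Cfg.aux_emit, emit_exchange]
  set β := C.σ .base with hβ
  set C₁ := C.emit Gadget.prelude with hC₁
  set C₂ := (Gadget.integer β (β + 2) a).foldl Cfg.emit C₁ with hC₂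
  set C₃ := (Gadget.integer β (β + 1) b).foldl Cfg.emit C₂ with hC₃
  set C₄ := (if a = 0 ∧ b = 0 then [Gadget.digit (β + 2) true] else []).foldl Cfg.emit C₃ with hC₄
  set C₅ := (Gadget.finish β i j).foldl Cfg.emit C₄ with hC₅
  set la := (Computability.encodeNat a.natAbs).length with hla
  set lb := (Computability.encodeNat b.natAbs).length with hlb
  have hea : (encodeInt a).length = la + 2 := by simp [encodeInt, hla]
  have heb : (encodeInt b).length = lb + 2 := by simp [encodeInt, hlb]
  have hz : 0 + la + lb = 0 ↔ a = 0 ∧ b = 0 := by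
    have h1 : la = 0 ↔ a = 0 := by
      rw [hla, List.length_eq_zero_iff, encodeNat_eq_nil_iff, Int.natAbs_eq_zero]
    have h2 : lb = 0 ↔ b = 0 := by
      rw [hlb, List.length_eq_zero_iff, encodeNat_eq_nil_iff, Int.natAbs_eq_zero]
    rw [← h1, ← h2]; omega
  -- all counters are bounded by `B`, where `N` bounds the length of the item
  have key : ∀ N M rest, β ≤ M → i + j + la + lb + 7 = N → N ≤ M → ∀ B, B = (K + 3) * (M + N) →
      Run (exchangeBody (some .exchange)) ((C.aux 0 0 0 0).st (RawGate.wireCode i ++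
        RawGate.wireCode j ++ encodeInt a ++ encodeInt b ++ rest))
        (3 * (i + 1) + (3 * (j + 1) + ((β * 5 + 4) + (c₁ * (B + 1) + (c₂ * (B + 1) * (la + 2) +
          (c₃ * (B + 1) * (lb + 2) + (c₄ * (B + 1) + (c₅ * (B + 1) +
          (i * 2 + 2 + (j * 2 + 2 + (β * 2 + 2))))))))))) ((C₅.aux 0 0 0 0).st rest) ∧
      C₅.σ .base ≤ β + K * N := by
    intro N M rest hM hN hNM B hB
    have e1 : (K + 3) * (M + N) = K * M + K * N + 3 * M + 3 * N := by ring
    have e2 : K * N = K * i + K * j + K * la + K * lb + 7 * K := by rw [← hN]; ring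
    have e3 : c₂ * la ≤ K * la := Nat.mul_le_mul_right _ (by omega)
    have e4 : c₃ * lb ≤ K * lb := Nat.mul_le_mul_right _ (by omega)
    have r1 := run_readWire .fst 1 i (C.aux 0 0 0 0)
      (RawGate.wireCode j ++ (encodeInt a ++ (encodeInt b ++ rest)))
    have r2 := run_readWire .snd 1 j (C.aux i 0 0 0) (encodeInt a ++ (encodeInt b ++ rest))
    rw [Cfg.aux_set_fst, Cfg.aux_fst, Nat.one_mul, Nat.add_zero] at r1
    rw [Cfg.aux_set_snd, Cfg.aux_snd, Nat.one_mul, Nat.add_zero] at r2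
    have r3 := run_copy (k := Stk.b) (k' := .w₃) (t := .t) (by simp) (by simp) (by simp)
      ((C.aux i j 0 0).st (encodeInt a ++ (encodeInt b ++ rest))) rfl
    have r3' : Function.update ((C.aux i j 0 0).st (encodeInt a ++ (encodeInt b ++ rest))) Stk.w₃
        (((C.aux i j 0 0).st (encodeInt a ++ (encodeInt b ++ rest)) Stk.b).reverse ++
        (C.aux i j 0 0).st (encodeInt a ++ (encodeInt b ++ rest)) Stk.w₃) =
        (C.aux i j β 0).st (encodeInt a ++ (encodeInt b ++ rest)) := by
      rw [Cfg.st_b, List.reverse_replicate]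
      have : (C.aux i j 0 0).st (encodeInt a ++ (encodeInt b ++ rest)) Stk.w₃ = [] := rfl
      rw [this, List.append_nil]
      have := Cfg.update_stk (C.aux i j 0 0) (encodeInt a ++ (encodeInt b ++ rest)) .trd β
      rw [Cfg.aux_set_trd] at this
      exact this
    rw [r3', Cfg.st_b, List.length_replicate, Cfg.aux_base] at r3
    obtain ⟨r4, g4⟩ := h₁ (C.aux i j β 0) (encodeInt a ++ (encodeInt b ++ rest)) B Gadget.prelude
      (fun _ => rfl) (C.aux_le _ _ _ _ (by omega) (by omega) (by omega) (by omega))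
    rw [Cfg.aux_emit, ← hC₁] at r4
    have g4' := g4 .base
    rw [Cfg.aux_emit, ← hC₁, Cfg.aux_base, Cfg.aux_base, ← hβ] at g4'
    have m2 : c₂ * (la + 2) = c₂ * la + 2 * c₂ := by ring
    have m3 : c₃ * (lb + 2) = c₃ * lb + 2 * c₃ := by ring
    obtain ⟨r5, g5⟩ := h₂ a C₁ i j β 0 B (encodeInt b ++ rest) (by
      rw [hea, m2]
      intro o
      have := C₁.aux_le i j β 0 (M := B - (c₂ * la + 2 * c₂)) (by omega) (by omega) (by omega)
        (by omega) o
      omega)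
    rw [show ev (C₁.aux i j β 0).σ (.trd, 0) = β from rfl,
      show ev (C₁.aux i j β 0).σ (.trd, 2) = β + 2 from rfl, ← hC₂, ← hla] at r5
    rw [show ev (C₁.aux i j β 0).σ (.trd, 0) = β from rfl,
      show ev (C₁.aux i j β 0).σ (.trd, 2) = β + 2 from rfl, ← hC₂] at g5
    rw [hea] at r5 g5
    obtain ⟨r6, g6⟩ := h₃ b C₂ i j β (0 + la) B rest (by
      rw [heb, m3]
      intro o
      have := C₂.aux_le i j β (0 + la) (M := B - (c₃ * lb + 2 * c₃)) (by omega) (by omega)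
        (by omega) (by omega) o
      omega)
    rw [show ev (C₂.aux i j β (0 + la)).σ (.trd, 0) = β from rfl,
      show ev (C₂.aux i j β (0 + la)).σ (.trd, 1) = β + 1 from rfl, ← hC₃, ← hlb] at r6
    rw [show ev (C₂.aux i j β (0 + la)).σ (.trd, 0) = β from rfl,
      show ev (C₂.aux i j β (0 + la)).σ (.trd, 1) = β + 1 from rfl, ← hC₃] at g6
    rw [heb] at r6 g6
    obtain ⟨r7, g7⟩ := h₄ C₃ i j β (0 + la + lb) B rest
      (C₃.aux_le _ _ _ _ (by omega) (by omega) (by omega) (by omega)) (by omega)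
    rw [show ev (C₃.aux i j β (0 + la + lb)).σ (.trd, 2) = β + 2 from rfl] at r7 g7
    simp only [hz, ← hC₄] at r7 g7
    obtain ⟨r8, g8⟩ := h₅ (C₄.aux i j β 0) rest B (Gadget.seqs (Gadget.finish β i j))
      (fun _ => rfl) (C₄.aux_le _ _ _ _ (by omega) (by omega) (by omega) (by omega))
    rw [Cfg.aux_emit, Cfg.emit_seqs, ← hC₅] at r8
    have g8' := g8 .base
    rw [Cfg.aux_emit, Cfg.emit_seqs, ← hC₅, Cfg.aux_base, Cfg.aux_base] at g8'
    have r9 := run_clearCounter .fst (C₅.aux i j β 0) rest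
    have r10 := run_clearCounter .snd (C₅.aux 0 j β 0) rest
    have r11 := run_clearCounter .trd (C₅.aux 0 0 β 0) rest
    rw [Cfg.aux_set_fst, Cfg.aux_fst] at r9
    rw [Cfg.aux_set_snd, Cfg.aux_snd] at r10
    rw [Cfg.aux_set_trd, Cfg.aux_trd] at r11
    refine ⟨?_, by omega⟩
    simp only [List.append_assoc]
    exact r1.seq (r2.seq (r3.seq (r4.seq (r5.seq (r6.seq (r7.seq (r8.seq (r9.seq (r10.seq
      r11)))))))))
  have hlen : (ExchangeItem.code (.inr (i, j, a, b))).length = i + j + la + lb + 7 := by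
    simp only [ExchangeItem.code, List.length_cons, List.length_append, length_wireCode, hea, heb]
    omega
  obtain ⟨N, hN⟩ : ∃ N, i + j + la + lb + 7 = N := ⟨_, rfl⟩
  refine ⟨Cfg.clean_aux _, ?_, _, _, rfl, fun rest M hM hl => ?_⟩
  · have := (key N (β + N) [] (by omega) hN (by omega) _ rfl).2
    rw [hlen, hN]
    simp only [Cfg.aux_base, ← hβ]
    nlinarith [Nat.zero_le (K * K * N)]
  · rw [hlen, hN] at hl ⊢
    obtain ⟨B, hB⟩ : ∃ B, B = (K + 3) * (M + N) := ⟨_, rfl⟩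
    refine ((key N M rest hM hN hl B hB).1).mono ?_
    have hM₀ : C.σ .base ≤ M := hM
    have hB' : B + 1 ≤ 2 * (K + 3) * (M + 1) := by
      rw [hB]
      have : (K + 3) * (M + N) ≤ (K + 3) * (2 * M) := Nat.mul_le_mul_left _ (by omega)
      nlinarith
    have hlin : 5 * N + 10 * (M + 1) ≤ 15 * (M + 1) * N := cost_le (by omega) le_rfl (by omega)
    have hmain : K * (B + 1) * N ≤ 2 * K * (K + 3) * (M + 1) * N := by
      have : K * (B + 1) ≤ K * (2 * (K + 3) * (M + 1)) := Nat.mul_le_mul_left _ hB'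
      have := Nat.mul_le_mul_right N this
      nlinarith
    have t : ∀ c n, n ≤ N → c * (B + 1) * n ≤ c * (B + 1) * N := fun c n hn =>
      Nat.mul_le_mul_left _ hn
    have t1 := t c₁ 1 (by omega)
    have t2 := t c₂ (la + 2) (by omega)
    have t3 := t c₃ (lb + 2) (by omega)
    have t4 := t c₄ 1 (by omega)
    have t5 := t c₅ 1 (by omega)
    have hsum : K * (B + 1) * N = c₁ * (B + 1) * N + c₂ * (B + 1) * N + c₃ * (B + 1) * N +
      c₄ * (B + 1) * N + c₅ * (B + 1) * N := by rw [hK]; ring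
    rw [Nat.mul_one] at t1 t4 t5
    have hfin : (2 * K * (K + 3) + 15) * (M + 1) * N =
      2 * K * (K + 3) * (M + 1) * N + 15 * (M + 1) * N := by ring
    rw [hfin]
    generalize c₁ * (B + 1) = u₁ at *
    generalize c₂ * (B + 1) * (la + 2) = u₂ at *
    generalize c₃ * (B + 1) * (lb + 2) = u₃ at *
    generalize c₄ * (B + 1) = u₄ at *
    generalize c₅ * (B + 1) = u₅ at *
    omega

/-- The compiler from exchange to general circuits handles every item as `exchangeStep` prescribes.
-/
theorem handles_exchangeItem : ∃ c, ∀ (x : ExchangeItem), ∀ C : Cfg, C.Clean →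
    Handles exchangeBody c x.code C (exchangeStep C x) := by
  obtain ⟨c, h⟩ := handles_exchange
  refine ⟨c + 6, ?_⟩
  rintro (⟨v, s⟩ | ⟨i, j, a, b⟩) C hC
  · exact (handles_entry hC v s [] 1 rfl).mono (by simp)
  · exact (h i j a b C hC).mono (by omega)

/-! ### Amplitudes on infinitely many wires -/

/-- Amplitudes of assignments of values to infinitely many wires. A state of `n` qubits is an
amplitude that depends on the first `n` wires only. -/
abbrev Amp : Type := (ℕ → Bool) → ℂ

/-- The number `1 / √2`. -/
noncomputable def invSqrtTwo : ℂ := ((Real.sqrt 2 : ℝ) : ℂ)⁻¹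

theorem invSqrtTwo_sq : invSqrtTwo ^ 2 = 1 / 2 := by
  rw [invSqrtTwo, inv_pow, ← Complex.ofReal_pow, Real.sq_sqrt (by norm_num)]
  norm_num

theorem invSqrtTwo_ne_zero : invSqrtTwo ≠ 0 := by
  intro h
  have := invSqrtTwo_sq
  rw [h] at this
  norm_num at this

namespace RawGate

/-- The wires of a gate. -/
def wires {W : Type} : RawGate W → List W
  | exch i j _ => [i, j]
  | had q => [q]
  | phase q => [q]
  | cnot c t => [c, t]
  | toff c₁ c₂ t => [c₁, c₂, t]

/-- The action of a gate on amplitudes. -/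
noncomputable def act : RawGate ℕ → Amp → Amp
  | exch i j neg, Ψ => fun x => (if neg then -invSqrtTwo else invSqrtTwo) * Ψ x +
      Complex.I * invSqrtTwo * Ψ (x ∘ Equiv.swap i j)
  | had q, Ψ => fun x => invSqrtTwo * (Ψ (Function.update x q false) +
      (if x q then -1 else 1) * Ψ (Function.update x q true))
  | phase q, Ψ => fun x => (if x q then Complex.I else 1) * Ψ x
  | cnot c t, Ψ => fun x => if x c then Ψ (Function.update x t (!x t)) else Ψ x
  | toff c₁ c₂ t, Ψ => fun x =>
      if x c₁ && x c₂ then Ψ (Function.update x t (!x t)) else Ψ x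

end RawGate

/-- The action of a list of gates. -/
noncomputable def runGates (gs : List (RawGate ℕ)) (Ψ : Amp) : Amp :=
  gs.foldl (fun Ψ g => g.act Ψ) Ψ

theorem runGates_append (gs hs : List (RawGate ℕ)) (Ψ : Amp) :
    runGates (gs ++ hs) Ψ = runGates hs (runGates gs Ψ) := List.foldl_append

/-- Prepare the wire `q` in the value `v`. -/
def prepWire (q : ℕ) (v : Bool) (Ψ : Amp) : Amp := fun x => if x q = v then Ψ x else 0

/-- Postselect the wire `q` on the value `v`. -/
def projWire (q : ℕ) (v : Bool) (Ψ : Amp) : Amp := fun x => Ψ (Function.update x q v)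

/-- Prepare the wires from `b` on in the values `vs`. -/
def prep : ℕ → List Bool → Amp → Amp
  | _, [], Ψ => Ψ
  | b, v :: vs, Ψ => prep (b + 1) vs (prepWire b v Ψ)

/-- Postselect the wires from `b` on on the values `vs`. -/
def proj : ℕ → List Bool → Amp → Amp
  | _, [], Ψ => Ψ
  | b, v :: vs, Ψ => projWire b v (proj (b + 1) vs Ψ)

theorem prep_append (b : ℕ) (vs ws : List Bool) (Ψ : Amp) :
    prep b (vs ++ ws) Ψ = prep (b + vs.length) ws (prep b vs Ψ) := by
  induction vs generalizing b Ψ with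
  | nil => rfl
  | cons v vs ih =>
    simp only [List.cons_append, prep, ih, List.length_cons]
    congr 1
    omega

theorem proj_append (b : ℕ) (vs ws : List Bool) (Ψ : Amp) :
    proj b (vs ++ ws) Ψ = proj b vs (proj (b + vs.length) ws Ψ) := by
  induction vs generalizing b Ψ with
  | nil => rfl
  | cons v vs ih =>
    simp only [List.cons_append, proj, ih, List.length_cons]
    congr 3
    omega

/-- The operator `T` does not touch the wire `q`. -/
structure Commutes (T : Amp → Amp) (q : ℕ) : Prop where
  prepWire : ∀ v Ψ, T (prepWire q v Ψ) = prepWire q v (T Ψ)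
  projWire : ∀ v Ψ, T (projWire q v Ψ) = projWire q v (T Ψ)

theorem Commutes.prep {T : Amp → Amp} {b : ℕ} {vs : List Bool}
    (h : ∀ k < vs.length, Commutes T (b + k)) (Ψ : Amp) :
    T (prep b vs Ψ) = prep b vs (T Ψ) := by
  induction vs generalizing b Ψ with
  | nil => rfl
  | cons v vs ih =>
    simp only [XQP.prep]
    have h0 : Commutes T b := h 0 (by simp)
    rw [ih (fun k hk => ?_), h0.prepWire v Ψ]
    · have := h (k + 1) (by simpa using hk)
      rwa [show b + (k + 1) = b + 1 + k by omega] at this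

theorem Commutes.proj {T : Amp → Amp} {b : ℕ} {vs : List Bool}
    (h : ∀ k < vs.length, Commutes T (b + k)) (Ψ : Amp) :
    T (proj b vs Ψ) = proj b vs (T Ψ) := by
  induction vs generalizing b Ψ with
  | nil => rfl
  | cons v vs ih =>
    simp only [XQP.proj]
    rw [← ih (fun k hk => ?_)]
    · exact (h 0 (by simp)).projWire v _
    · have := h (k + 1) (by simpa using hk)
      rwa [show b + (k + 1) = b + 1 + k by omega] at this

theorem update_comp_swap {i j q : ℕ} (hi : q ≠ i) (hj : q ≠ j) (x : ℕ → Bool) (v : Bool) :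
    Function.update x q v ∘ Equiv.swap i j = Function.update (x ∘ Equiv.swap i j) q v := by
  funext k
  by_cases h : k = q
  · subst h
    simp [Equiv.swap_apply_of_ne_of_ne hi hj]
  · have h' : Equiv.swap i j k ≠ q := fun e => h (by
      rw [← Equiv.swap_apply_of_ne_of_ne hi hj] at e
      exact (Equiv.swap i j).injective e)
    simp [h, h']

/-- A gate does not touch wires that it does not act on. -/
theorem commutes_act (g : RawGate ℕ) {q : ℕ} (hq : q ∉ g.wires) : Commutes g.act q := by
  cases g with
  | exch i j neg =>
    simp only [RawGate.wires, List.mem_cons, List.not_mem_nil, or_false, not_or] at hq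
    constructor
    · intro v Ψ
      funext x
      simp only [RawGate.act, prepWire, Function.comp_apply,
        Equiv.swap_apply_of_ne_of_ne hq.1 hq.2]
      split_ifs <;> simp
    · intro v Ψ
      funext x
      simp only [RawGate.act, projWire, update_comp_swap hq.1 hq.2]
  | had i =>
    simp only [RawGate.wires, List.mem_cons, List.not_mem_nil, or_false] at hq
    constructor
    · intro v Ψ
      funext x
      simp only [RawGate.act, prepWire, Function.update_of_ne hq]
      split_ifs <;> simp
    · intro v Ψ
      funext x
      simp only [RawGate.act, projWire, Function.update_of_ne (Ne.symm hq),
        Function.update_comm (Ne.symm hq)]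
  | phase i =>
    simp only [RawGate.wires, List.mem_cons, List.not_mem_nil, or_false] at hq
    constructor
    · intro v Ψ
      funext x
      simp only [RawGate.act, prepWire]
      split_ifs <;> simp
    · intro v Ψ
      funext x
      simp only [RawGate.act, projWire, Function.update_of_ne (Ne.symm hq)]
  | cnot i t =>
    simp only [RawGate.wires, List.mem_cons, List.not_mem_nil, or_false, not_or] at hq
    constructor
    · intro v Ψ
      funext x
      simp only [RawGate.act, prepWire, Function.update_of_ne hq.2]
      split_ifs <;> simp
    · intro v Ψ
      funext x
      simp only [RawGate.act, projWire, Function.update_of_ne (Ne.symm hq.1),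
        Function.update_of_ne (Ne.symm hq.2), Function.update_comm (Ne.symm hq.2)]
  | toff i j t =>
    simp only [RawGate.wires, List.mem_cons, List.not_mem_nil, or_false, not_or] at hq
    constructor
    · intro v Ψ
      funext x
      simp only [RawGate.act, prepWire, Function.update_of_ne hq.2.2]
      split_ifs <;> simp
    · intro v Ψ
      funext x
      simp only [RawGate.act, projWire, Function.update_of_ne (Ne.symm hq.1),
        Function.update_of_ne (Ne.symm hq.2.1), Function.update_of_ne (Ne.symm hq.2.2),
        Function.update_comm (Ne.symm hq.2.2)]

theorem Commutes.comp {S T : Amp → Amp} {q : ℕ} (hS : Commutes S q) (hT : Commutes T q) :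
    Commutes (fun Ψ => S (T Ψ)) q :=
  ⟨fun v Ψ => by rw [hT.prepWire, hS.prepWire], fun v Ψ => by rw [hT.projWire, hS.projWire]⟩

theorem commutes_runGates (gs : List (RawGate ℕ)) {q : ℕ} (hq : ∀ g ∈ gs, q ∉ g.wires) :
    Commutes (runGates gs) q := by
  induction gs with
  | nil => exact ⟨fun _ _ => rfl, fun _ _ => rfl⟩
  | cons g gs ih =>
    exact (ih fun h hh => hq h (by simp [hh])).comp (commutes_act g (hq g (by simp)))

theorem commutes_prepWire {p q : ℕ} (h : q ≠ p) (v : Bool) : Commutes (prepWire p v) q := by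
  constructor
  · intro w Ψ
    funext x
    simp only [prepWire]
    split_ifs <;> rfl
  · intro w Ψ
    funext x
    simp only [prepWire, projWire, Function.update_of_ne h.symm]

theorem commutes_projWire {p q : ℕ} (h : q ≠ p) (v : Bool) : Commutes (projWire p v) q := by
  constructor
  · intro w Ψ
    funext x
    simp only [prepWire, projWire, Function.update_of_ne h]
  · intro w Ψ
    funext x
    simp only [projWire, Function.update_comm h]

theorem commutes_prep {b q : ℕ} {vs : List Bool} (h : q < b ∨ b + vs.length ≤ q) :
    Commutes (prep b vs) q := by
  induction vs generalizing b with
  | nil => exact ⟨fun _ _ => rfl, fun _ _ => rfl⟩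
  | cons v vs ih =>
    simp only [List.length_cons] at h
    exact (ih (b := b + 1) (by omega)).comp (commutes_prepWire (by omega) v)

theorem commutes_proj {b q : ℕ} {vs : List Bool} (h : q < b ∨ b + vs.length ≤ q) :
    Commutes (proj b vs) q := by
  induction vs generalizing b with
  | nil => exact ⟨fun _ _ => rfl, fun _ _ => rfl⟩
  | cons v vs ih =>
    simp only [List.length_cons] at h
    exact (commutes_projWire (by omega) v).comp (ih (b := b + 1) (by omega))

/-! ### Amplitudes that depend on finitely many wires -/

/-- The amplitude depends on the wires below `b` only. -/
abbrev DependsBelow (b : ℕ) (Ψ : Amp) : Prop := DependsOn Ψ (Set.Iio b)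

theorem DependsBelow.mono {b c : ℕ} {Ψ : Amp} (h : DependsBelow b Ψ) (hbc : b ≤ c) :
    DependsBelow c Ψ := fun _ _ e => h fun q hq => e q (lt_of_lt_of_le hq hbc)

theorem DependsBelow.update {b q : ℕ} {Ψ : Amp} (h : DependsBelow b Ψ) (hq : b ≤ q)
    (x : ℕ → Bool) (v : Bool) : Ψ (Function.update x q v) = Ψ x :=
  h fun k hk => Function.update_of_ne (by rintro rfl; exact absurd hk (not_lt.mpr hq)) _ _

theorem DependsBelow.act {b : ℕ} {Ψ : Amp} (h : DependsBelow b Ψ) {g : RawGate ℕ}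
    (hg : ∀ q ∈ g.wires, q < b) : DependsBelow b (g.act Ψ) := by
  have hup : ∀ {x y : ℕ → Bool}, (∀ k ∈ Set.Iio b, x k = y k) → ∀ t v,
      Ψ (Function.update x t v) = Ψ (Function.update y t v) := by
    intro x y e t v
    refine h fun k hk => ?_
    by_cases hkt : k = t
    · subst hkt; simp
    · simp [hkt, e k hk]
  intro x y e
  cases g with
  | exch i j neg =>
    simp only [RawGate.wires, List.mem_cons, List.not_mem_nil, or_false, forall_eq_or_imp,
      forall_eq] at hg
    simp only [RawGate.act]
    have h2 : Ψ (x ∘ Equiv.swap i j) = Ψ (y ∘ Equiv.swap i j) := by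
      refine h fun k hk => e _ ?_
      rcases Equiv.swap_apply_eq_iff.mp (rfl : Equiv.swap i j k = Equiv.swap i j k) with _
      by_cases h1 : k = i
      · subst h1; simpa using hg.2
      · by_cases h2 : k = j
        · subst h2; simpa using hg.1
        · rwa [Equiv.swap_apply_of_ne_of_ne h1 h2]
    rw [h e, h2]
  | had q =>
    simp only [RawGate.wires, List.mem_cons, List.not_mem_nil, or_false, forall_eq] at hg
    simp only [RawGate.act]
    rw [hup e, hup e, e q hg]
  | phase q =>
    simp only [RawGate.wires, List.mem_cons, List.not_mem_nil, or_false, forall_eq] at hg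
    simp only [RawGate.act]
    rw [h e, e q hg]
  | cnot c t =>
    simp only [RawGate.wires, List.mem_cons, List.not_mem_nil, or_false, forall_eq_or_imp,
      forall_eq] at hg
    simp only [RawGate.act]
    rw [h e, hup e, e c hg.1, e t hg.2]
  | toff c₁ c₂ t =>
    simp only [RawGate.wires, List.mem_cons, List.not_mem_nil, or_false, forall_eq_or_imp,
      forall_eq] at hg
    simp only [RawGate.act]
    rw [h e, hup e, e c₁ hg.1, e c₂ hg.2.1, e t hg.2.2]

theorem DependsBelow.prep {b : ℕ} {Ψ : Amp} (h : DependsBelow b Ψ) (vs : List Bool) :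
    DependsBelow (b + vs.length) (prep b vs Ψ) := by
  induction vs generalizing b Ψ with
  | nil => exact h
  | cons v vs ih =>
    have h1 : DependsBelow (b + 1) (prepWire b v Ψ) := by
      intro x y e
      simp only [prepWire]
      rw [e b (Nat.lt_succ_self b), (h.mono (Nat.le_succ b)) e]
    have := ih h1
    rwa [List.length_cons, show b + (vs.length + 1) = b + 1 + vs.length by omega]

theorem DependsBelow.proj {b : ℕ} {Ψ : Amp} {vs : List Bool}
    (h : DependsBelow (b + vs.length) Ψ) : DependsBelow b (proj b vs Ψ) := by
  induction vs generalizing b Ψ with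
  | nil => exact h
  | cons v vs ih =>
    rw [List.length_cons, show b + (vs.length + 1) = b + 1 + vs.length by omega] at h
    have h1 := ih h
    intro x y e
    refine h1 fun k hk => ?_
    by_cases hkb : k = b
    · subst hkb; simp
    · have : k < b + 1 := hk
      simp only [Function.update_of_ne hkb]
      exact e k (show k < b by omega)

/-! ### What a gadget does -/

/-- The gadget `G` on the wires `U` maps the amplitude `Ψ` to `Ψ'`: this is the result of preparing
its ancillas, applying its gates, and postselecting the ancillas. -/
def Impl (U : Set ℕ) (G : Gadget ℕ) (Ψ Ψ' : Amp) : Prop :=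
  ∀ b, (∀ q ∈ U, q < b) → DependsBelow b Ψ →
    (∀ g ∈ (G fun k => b + k).1, g.wires.Nodup ∧
      ∀ q ∈ g.wires, q ∈ U ∨ (b ≤ q ∧ q < b + (G fun k => b + k).2.length)) ∧
    proj b (G fun k => b + k).2 (runGates (G fun k => b + k).1 (prep b (G fun k => b + k).2 Ψ)) =
      Ψ' ∧
    DependsBelow b Ψ'

namespace Impl

variable {U : Set ℕ} {G H : Gadget ℕ} {Ψ Ψ' Ψ'' : Amp}

theorem congr (h : Impl U G Ψ Ψ') (e : Ψ' = Ψ'') : Impl U G Ψ Ψ'' := e ▸ h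

theorem nil : Impl U Gadget.nil Ψ Ψ := fun _ _ hΨ => ⟨by simp [Gadget.nil], rfl, hΨ⟩

theorem gate {g : RawGate ℕ} (hg : g.wires.Nodup) (hU : ∀ q ∈ g.wires, q ∈ U) :
    Impl U (Gadget.gate g) Ψ (g.act Ψ) := by
  intro b hb hΨ
  refine ⟨fun g' hg' => ?_, rfl, hΨ.act fun q hq => hb q (hU q hq)⟩
  obtain rfl : g' = g := by simpa [Gadget.gate] using hg'
  exact ⟨hg, fun q hq => .inl (hU q hq)⟩

/-- Composition of gadgets. The ancillas of the second gadget can be prepared before the gates of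
the first one are applied, and those of the first one postselected after the gates of the second
one, since the gates of either gadget do not touch the ancillas of the other one. -/
theorem seq (hG : Impl U G Ψ Ψ') (hH : Impl U H Ψ' Ψ'') :
    Impl U (Gadget.seq G H) Ψ Ψ'' := by
  intro b hb hΨ
  obtain ⟨g1, g2, g3⟩ := hG b hb hΨ
  have hdep := (hH b hb g3).2.2
  simp only [Gadget.seq]
  generalize G (fun k => b + k) = r at *
  obtain ⟨gs, vs⟩ := r
  dsimp only at *
  obtain ⟨h1, h2, -⟩ := hH (b + vs.length) (fun q hq => (hb q hq).trans_le (by omega))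
    (g3.mono (by omega))
  have e : (fun k => b + (vs.length + k)) = fun k => b + vs.length + k := by
    funext k; omega
  rw [e]
  generalize H (fun k => b + vs.length + k) = r at *
  obtain ⟨hs, ws⟩ := r
  dsimp only at *
  refine ⟨fun g hg => ?_, ?_, hdep⟩
  · rw [List.length_append]
    rcases List.mem_append.mp hg with hg | hg
    · refine ⟨(g1 g hg).1, fun q hq => ((g1 g hg).2 q hq).imp_right fun h => ?_⟩
      omega
    · refine ⟨(h1 g hg).1, fun q hq => ((h1 g hg).2 q hq).imp_right fun h => ?_⟩
      omega
  · rw [prep_append, proj_append, runGates_append]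
    have c1 : XQP.runGates gs (prep (b + vs.length) ws (prep b vs Ψ)) =
        prep (b + vs.length) ws (XQP.runGates gs (prep b vs Ψ)) := by
      refine Commutes.prep (fun k hk => commutes_runGates gs fun g hg hq => ?_) _
      rcases (g1 g hg).2 _ hq with h | h
      · have := hb _ h; omega
      · omega
    have c2 : proj b vs (proj (b + vs.length) ws (XQP.runGates hs
        (prep (b + vs.length) ws (XQP.runGates gs (prep b vs Ψ))))) =
        proj (b + vs.length) ws (XQP.runGates hs (prep (b + vs.length) ws
          (proj b vs (XQP.runGates gs (prep b vs Ψ))))) := by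
      refine (Commutes.proj (T := fun X => proj (b + vs.length) ws (XQP.runGates hs
        (prep (b + vs.length) ws X))) (fun k hk => ?_) _).symm
      refine (commutes_proj (by omega)).comp (Commutes.comp
        (commutes_runGates hs fun g hg hq => ?_) (commutes_prep (by omega)))
      rcases (h1 g hg).2 _ hq with h | h
      · have := hb _ h; omega
      · omega
    rw [c1, c2, g2, h2]

theorem seqs_cons {l : List (Gadget ℕ)} (hG : Impl U G Ψ Ψ') (hl : Impl U (Gadget.seqs l) Ψ' Ψ'') :
    Impl U (Gadget.seqs (G :: l)) Ψ Ψ'' := hG.seq hl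

theorem seqs_append {l l' : List (Gadget ℕ)} (hl : Impl U (Gadget.seqs l) Ψ Ψ')
    (hl' : Impl U (Gadget.seqs l') Ψ' Ψ'') : Impl U (Gadget.seqs (l ++ l')) Ψ Ψ'' := by
  rw [Gadget.seqs_append]
  exact hl.seq hl'

/-- A gadget with outer ancillas: inside, they count as ordinary wires. -/
theorem wrap {vs : List Bool} {G : (ℕ → ℕ) → Gadget ℕ}
    (hG : ∀ b, (∀ q ∈ U, q < b) → DependsBelow b Ψ → ∃ Φ,
      Impl (U ∪ Set.Ico b (b + vs.length)) (G fun k => b + k) (prep b vs Ψ) Φ ∧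
      proj b vs Φ = Ψ') : Impl U (Gadget.wrap vs G) Ψ Ψ' := by
  intro b hb hΨ
  obtain ⟨Φ, h, hp⟩ := hG b hb hΨ
  obtain ⟨h1, h2, h3⟩ := h (b + vs.length) (fun q hq => by
    rcases hq with hq | hq
    · exact (hb q hq).trans_le (by omega)
    · exact hq.2) (hΨ.prep vs)
  have e : (fun k => b + (vs.length + k)) = fun k => b + vs.length + k := by
    funext k; omega
  simp only [Gadget.wrap, e]
  generalize G (fun k => b + k) (fun k => b + vs.length + k) = r at *
  obtain ⟨gs, ws⟩ := r
  dsimp only at *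
  refine ⟨fun g hg => ⟨(h1 g hg).1, fun q hq => ?_⟩, ?_, hp ▸ h3.proj⟩
  · rw [List.length_append]
    rcases (h1 g hg).2 q hq with (h | h) | h
    · exact .inl h
    · exact .inr ⟨h.1, by have := h.2; omega⟩
    · exact .inr ⟨by omega, by omega⟩
  · rw [prep_append, proj_append, h2, hp]

end Impl

/-! ### Powers of the constants -/

theorem I_pows : Complex.I ^ 2 = -1 ∧ Complex.I ^ 3 = -Complex.I ∧ Complex.I ^ 4 = 1 ∧
    Complex.I ^ 5 = Complex.I ∧ Complex.I ^ 6 = -1 ∧ Complex.I ^ 7 = -Complex.I ∧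
    Complex.I ^ 8 = 1 ∧ Complex.I ^ 9 = Complex.I ∧ Complex.I ^ 10 = -1 := by
  have h2 := Complex.I_sq
  refine ⟨h2, ?_, ?_, ?_, ?_, ?_, ?_, ?_, ?_⟩ <;> rw [Complex.I_pow_eq_pow_mod] <;>
    norm_num [pow_succ]

theorem invSqrtTwo_pows : invSqrtTwo ^ 2 = 1 / 2 ∧ invSqrtTwo ^ 4 = 1 / 4 ∧
    invSqrtTwo ^ 6 = 1 / 8 := by
  have h2 := invSqrtTwo_sq
  refine ⟨h2, ?_, ?_⟩
  · calc invSqrtTwo ^ 4 = (invSqrtTwo ^ 2) ^ 2 := by ring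
      _ = 1 / 4 := by rw [h2]; norm_num
  · calc invSqrtTwo ^ 6 = (invSqrtTwo ^ 2) ^ 3 := by ring
      _ = 1 / 8 := by rw [h2]; norm_num

namespace Impl

variable {U : Set ℕ} {Ψ Ψ' Ψ'' : Amp}

/-! ### What the exchange gadgets do -/

/-- If the wire and the ancilla have the same value `v`, the exchange gate is the scalar
`(±1 + i) / √2`. Otherwise the term with the swap does not survive the postselection, and the term
with the identity contributes `±1 / √2`. -/
theorem fil {i : ℕ} (hi : i ∈ U) (v neg : Bool) : Impl U (Gadget.fil i v neg) Ψ fun x =>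
    invSqrtTwo * ((if neg then -1 else 1) + if x i = v then Complex.I else 0) * Ψ x := by
  intro b hb hΨ
  have hib := hb i hi
  refine ⟨fun g hg => ?_, ?_, ?_⟩
  · obtain rfl : g = .exch i b neg := by simpa [Gadget.fil] using hg
    refine ⟨by simp [RawGate.wires, hib.ne], fun q hq => ?_⟩
    rcases (by simpa [RawGate.wires] using hq : q = i ∨ q = b) with rfl | rfl
    · exact .inl hi
    · exact .inr ⟨le_rfl, by simp [Gadget.fil]⟩
  · funext x
    simp only [Gadget.fil, proj, prep, runGates, List.foldl_cons, List.foldl_nil, RawGate.act,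
      projWire, prepWire, Nat.add_zero, Function.update_self, if_true, Function.comp_apply,
      Equiv.swap_apply_right, Function.update_of_ne hib.ne, hΨ.update le_rfl]
    by_cases h : x i = v
    · have : Function.update x b v ∘ Equiv.swap i b = Function.update x b v := by
        funext k
        by_cases h1 : k = i
        · subst h1; simp [h, hib.ne]
        · by_cases h2 : k = b
          · subst h2; simp [h, hib.ne]
          · simp [Equiv.swap_apply_of_ne_of_ne h1 h2]
      rw [this, hΨ.update le_rfl]
      simp only [h, if_true]
      split_ifs <;> ring
    · simp only [h, if_false]
      split_ifs <;> ring
  · intro x y e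
    simp only [e i hib, hΨ e]

/-- Up to the factor `1 / 2`, the two filters together contribute `-1 + i` to the value `0` and
`(-1) (1 + i) = (-1 + i) i` to the value `1`. -/
theorem ph {i : ℕ} (hi : i ∈ U) : Impl U (Gadget.ph i) Ψ fun x =>
    (-1 + Complex.I) / 2 * (if x i then Complex.I else 1) * Ψ x := by
  refine (seqs_cons (fil hi _ _) (seqs_cons (fil hi _ _) nil)).congr ?_
  funext x
  have h2 := invSqrtTwo_sq
  have hI := Complex.I_sq
  cases x i
  · simp
    linear_combination (Complex.I - 1) * Ψ x * h2
  · simp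
    linear_combination (-Complex.I - 1) * Ψ x * h2 - Ψ x / 2 * hI

theorem phInv {i : ℕ} (hi : i ∈ U) : Impl U (Gadget.phInv i) Ψ fun x =>
    -(1 + Complex.I) / 2 * (if x i then -Complex.I else 1) * Ψ x := by
  refine (seqs_cons (fil hi _ _) (seqs_cons (fil hi _ _) nil)).congr ?_
  funext x
  have h2 := invSqrtTwo_sq
  have hI := Complex.I_sq
  cases x i
  · simp
    linear_combination (-Complex.I - 1) * Ψ x * h2
  · simp
    linear_combination (Complex.I - 1) * Ψ x * h2 - Ψ x / 2 * hI

theorem exch {i j : ℕ} (hi : i ∈ U) (hj : j ∈ U) (hij : i ≠ j) (neg : Bool) :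
    Impl U (Gadget.gate (.exch i j neg)) Ψ (RawGate.act (.exch i j neg) Ψ) :=
  gate (by simp [RawGate.wires, hij]) (by simp [RawGate.wires, hi, hj])

/-- Up to a constant, two `√SWAP`s with a phase flip of the wire `i` between them multiply the
amplitudes of the values `00`, `01`, `10`, `11` by `i`, `1`, `-1`, `-i`: where the values agree,
`√SWAP` is a scalar with the square `i`, and where they differ, `Z (1 - i X) (1 + i X) / 2 = Z`. The
phase gates at the end turn this into `i` times the controlled `Z` gate. -/
theorem cz {i j : ℕ} (hi : i ∈ U) (hj : j ∈ U) (hij : i ≠ j) : Impl U (Gadget.cz i j) Ψ fun x =>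
    1 / 4 * (if x i && x j then -1 else 1) * Ψ x := by
  refine (seqs_cons (exch hi hj hij _) (seqs_cons (ph hi) (seqs_cons (ph hi)
    (seqs_cons (exch hi hj hij _) (seqs_cons (ph hj) (seqs_cons (phInv hi) nil)))))).congr ?_
  funext x
  have h2 := invSqrtTwo_sq
  have hI := Complex.I_sq
  have hs : (x ∘ Equiv.swap i j) ∘ Equiv.swap i j = x := by funext k; simp
  have hx : x i = x j → x ∘ Equiv.swap i j = x := by
    intro h
    funext k
    by_cases h1 : k = i
    · subst h1; simp [h]
    · by_cases h2 : k = j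
      · subst h2; simp [h]
      · simp [Equiv.swap_apply_of_ne_of_ne h1 h2]
  simp only [RawGate.act, hs, Function.comp_apply, Equiv.swap_apply_left]
  cases hi' : x i <;> cases hj' : x j
  · rw [hx (hi'.trans hj'.symm)]
    simp
    ring_nf
    simp only [invSqrtTwo_sq, I_pows]
    ring
  · simp
    ring_nf
    simp only [invSqrtTwo_sq, I_pows]
    ring
  · simp
    ring_nf
    simp only [invSqrtTwo_sq, I_pows]
    ring
  · rw [hx (hi'.trans hj'.symm)]
    simp
    ring_nf
    simp only [invSqrtTwo_sq, I_pows]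
    ring

/-- The amplitude `Φ` on the subspace where the wires `i`, `j` have opposite values. -/
def dualPair (i j : ℕ) (Φ : Amp) : Amp := fun x => if x j = !x i then Φ x else 0

/-- On a dual-rail pair, `√SWAP` is `(1 + i X) / √2`, and an inverse phase gate on either side of it
makes it the Hadamard gate. -/
theorem hp {i j : ℕ} (hi : i ∈ U) (hj : j ∈ U) (hij : i ≠ j) {Φ : Amp}
    (hΦ : ∀ x v, Φ (Function.update x j v) = Φ x) :
    Impl U (Gadget.hp i j) (dualPair i j Φ) (dualPair i j fun x => Complex.I / 2 * invSqrtTwo *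
      (Φ (Function.update x i false) +
        (if x i then -1 else 1) * Φ (Function.update x i true))) := by
  refine (seqs_cons (phInv hi) (seqs_cons (exch hi hj hij _) (seqs_cons (phInv hi) nil))).congr ?_
  funext x
  have hI := Complex.I_sq
  simp only [RawGate.act, dualPair, Function.comp_apply, Equiv.swap_apply_left,
    Equiv.swap_apply_right]
  by_cases h : x j = !x i
  · have hx : Φ (x ∘ Equiv.swap i j) = Φ (Function.update x i (!x i)) := by
      rw [← hΦ (Function.update x i (!x i)) (x i)]
      congr 1
      funext k
      by_cases h1 : k = i
      · subst h1; simp [h, hij]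
      · by_cases h2 : k = j
        · subst h2; simp
        · simp [Equiv.swap_apply_of_ne_of_ne h1 h2, h1, h2]
    have hx' : Φ x = Φ (Function.update x i (x i)) := by rw [Function.update_eq_self]
    have h' : x i = !x j := by rw [h, Bool.not_not]
    rw [hx, if_pos h, if_pos h, if_pos h', hx', h]
    cases x i
    · simp
      ring_nf
      simp only [I_pows]
      ring
    · simp
      ring_nf
      simp only [I_pows]
      ring
  · have h' : ¬ x i = !x j := fun e => h (by rw [e, Bool.not_not])
    rw [if_neg h, if_neg h, if_neg h']
    simp

/-- A controlled `Z` gate between two Hadamard gates on the target. -/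
theorem cx {i j j' : ℕ} (hi : i ∈ U) (hj : j ∈ U) (hj' : j' ∈ U) (hij : i ≠ j) (hij' : i ≠ j')
    (hjj' : j ≠ j') {Φ : Amp} (hΦ : ∀ x v, Φ (Function.update x j' v) = Φ x) :
    Impl U (Gadget.cx i j j') (dualPair j j' Φ) (dualPair j j' fun x =>
      -1 / 16 * if x i then Φ (Function.update x j (!x j)) else Φ x) := by
  have hcz : Impl U (Gadget.cz i j) (dualPair j j' fun x => Complex.I / 2 * invSqrtTwo *
        (Φ (Function.update x j false) +
          (if x j then -1 else 1) * Φ (Function.update x j true))) (dualPair j j' fun x =>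
      1 / 4 * (if x i && x j then -1 else 1) * (Complex.I / 2 * invSqrtTwo *
        (Φ (Function.update x j false) +
          (if x j then -1 else 1) * Φ (Function.update x j true)))) :=
    (cz hi hj hij).congr (by funext x; simp only [dualPair]; split_ifs <;> simp)
  refine (seqs_cons (hp hj hj' hjj' hΦ) (seqs_cons hcz (seqs_cons
    (hp hj hj' hjj' fun x v => ?_) nil))).congr ?_
  · simp only [Function.update_of_ne hij', Function.update_of_ne hjj',
      Function.update_comm hjj'.symm, hΦ]
  · funext x
    simp only [dualPair, Function.update_self, Function.update_of_ne hij, Function.update_idem]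
    have hx : Φ x = Φ (Function.update x j (x j)) := by rw [Function.update_eq_self]
    rw [hx]
    congr 1
    cases x i <;> cases x j <;> simp <;> ring_nf <;> simp only [invSqrtTwo_sq, I_pows] <;> ring

/-- The amplitude `Ψ`, tensored with the state `u` of the dual-rail pair `p`, `p'`, which depends on
the values of the wires `x`, `y`, `z`. -/
def withPair (x y z p p' : ℕ) (Ψ : Amp) (u : Bool → Bool → Bool → Bool → ℂ) : Amp :=
  dualPair p p' fun s => u (s x) (s y) (s z) (s p) * Ψ s

section Pair

variable {x y z p p' : ℕ} {u : Bool → Bool → Bool → Bool → ℂ}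

/-- A gadget that is diagonal changes the state of the pair by a factor. -/
theorem pair_diag {G : Gadget ℕ} {f : Bool → Bool → Bool → Bool → ℂ}
    (h : ∀ Φ, Impl U G Φ fun s => f (s x) (s y) (s z) (s p) * Φ s) :
    Impl U G (withPair x y z p p' Ψ u)
      (withPair x y z p p' Ψ fun a b c d => f a b c d * u a b c d) := by
  refine (h _).congr ?_
  funext s
  simp only [withPair, dualPair]
  split_ifs <;> ring

theorem pair_fil (hp : p ∈ U) (v neg : Bool) :
    Impl U (Gadget.fil p v neg) (withPair x y z p p' Ψ u) (withPair x y z p p' Ψ fun a b c d =>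
      invSqrtTwo * ((if neg then -1 else 1) + if d = v then Complex.I else 0) * u a b c d) :=
  pair_diag (f := fun _ _ _ d =>
    invSqrtTwo * ((if neg then -1 else 1) + if d = v then Complex.I else 0)) fun _ => fil hp v neg

theorem pair_ph (hp : p ∈ U) :
    Impl U (Gadget.ph p) (withPair x y z p p' Ψ u) (withPair x y z p p' Ψ fun a b c d =>
      (-1 + Complex.I) / 2 * (if d then Complex.I else 1) * u a b c d) :=
  pair_diag (f := fun _ _ _ d => (-1 + Complex.I) / 2 * (if d then Complex.I else 1)) fun _ => ph hp

theorem pair_cz (hz : z ∈ U) (hp : p ∈ U) (hzp : z ≠ p) :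
    Impl U (Gadget.cz z p) (withPair x y z p p' Ψ u) (withPair x y z p p' Ψ fun a b c d =>
      1 / 4 * (if c && d then -1 else 1) * u a b c d) :=
  pair_diag (f := fun _ _ c d => 1 / 4 * (if c && d then -1 else 1)) fun _ => cz hz hp hzp

/-- The wires `p`, `p'` are fresh. -/
structure Fresh (U : Set ℕ) (x y z p p' : ℕ) (Ψ : Amp) : Prop where
  hx : x ≠ p ∧ x ≠ p'
  hy : y ≠ p ∧ y ≠ p'
  hz : z ≠ p ∧ z ≠ p'
  hpp' : p ≠ p'
  hp : p ∈ U
  hp' : p' ∈ U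
  indep : ∀ s v, Ψ (Function.update s p v) = Ψ s
  indep' : ∀ s v, Ψ (Function.update s p' v) = Ψ s

theorem pair_hp (h : Fresh U x y z p p' Ψ) : Impl U (Gadget.hp p p') (withPair x y z p p' Ψ u)
    (withPair x y z p p' Ψ fun a b c d => Complex.I / 2 * invSqrtTwo *
      (u a b c false + (if d then -1 else 1) * u a b c true)) := by
  refine (Impl.hp h.hp h.hp' h.hpp' fun s v => ?_).congr ?_
  · simp [h.hx.2, h.hy.2, h.hz.2, h.hpp', h.indep']
  · funext s
    simp only [withPair, dualPair, Function.update_of_ne h.hx.1, Function.update_of_ne h.hy.1,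
      Function.update_of_ne h.hz.1, Function.update_self, h.indep]
    split_ifs <;> ring

theorem pair_cx_fst (h : Fresh U x y z p p' Ψ) (hx : x ∈ U) :
    Impl U (Gadget.cx x p p') (withPair x y z p p' Ψ u)
    (withPair x y z p p' Ψ fun a b c d => -1 / 16 * if a then u a b c (!d) else u a b c d) := by
  refine (cx hx h.hp h.hp' h.hx.1 h.hx.2 h.hpp' fun s v => ?_).congr ?_
  · simp [h.hx.2, h.hy.2, h.hz.2, h.hpp', h.indep']
  · funext s
    simp only [withPair, dualPair, Function.update_of_ne h.hx.1, Function.update_of_ne h.hy.1,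
      Function.update_of_ne h.hz.1, Function.update_self, h.indep]
    split_ifs <;> ring

theorem pair_cx_snd (h : Fresh U x y z p p' Ψ) (hy : y ∈ U) :
    Impl U (Gadget.cx y p p') (withPair x y z p p' Ψ u)
    (withPair x y z p p' Ψ fun a b c d => -1 / 16 * if b then u a b c (!d) else u a b c d) := by
  refine (cx hy h.hp h.hp' h.hy.1 h.hy.2 h.hpp' fun s v => ?_).congr ?_
  · simp [h.hx.2, h.hy.2, h.hz.2, h.hpp', h.indep']
  · funext s
    simp only [withPair, dualPair, Function.update_of_ne h.hx.1, Function.update_of_ne h.hy.1,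
      Function.update_of_ne h.hz.1, Function.update_self, h.indep]
    split_ifs <;> ring

end Pair

theorem prep_pair {b : ℕ} (x y z : ℕ) : prep b [false, true] Ψ =
    withPair x y z b (b + 1) Ψ fun _ _ _ d => if d then 0 else 1 := by
  funext s
  simp only [prep, prepWire, withPair, dualPair]
  cases s b <;> cases s (b + 1) <;> simp

theorem proj_pair {b x y z : ℕ} (hx : x < b) (hy : y < b) (hz : z < b) (hΨ : DependsBelow b Ψ)
    (u : Bool → Bool → Bool → Bool → ℂ) :
    proj b [false, true] (withPair x y z b (b + 1) Ψ u) =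
      fun s => u (s x) (s y) (s z) false * Ψ s := by
  funext s
  simp [proj, projWire, withPair, dualPair, hx.ne, hy.ne, hz.ne, (hx.trans b.lt_succ_self).ne,
    (hy.trans b.lt_succ_self).ne, (hz.trans b.lt_succ_self).ne, hΨ.update]

theorem fresh {b x y z : ℕ} (hb : ∀ q ∈ U, q < b) (hΨ : DependsBelow b Ψ) (hx : x ∈ U)
    (hy : y ∈ U) (hz : z ∈ U) :
    Fresh (U ∪ Set.Ico b (b + [false, true].length)) x y z b (b + 1) Ψ := by
  have hx' := hb x hx
  have hy' := hb y hy
  have hz' := hb z hz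
  exact ⟨⟨by omega, by omega⟩, ⟨by omega, by omega⟩, ⟨by omega, by omega⟩, by omega,
    .inr ⟨le_rfl, by simp⟩, .inr ⟨by simp, by simp⟩, fun s v => hΨ.update le_rfl s v,
    fun s v => hΨ.update (Nat.le_succ b) s v⟩

/-- The pair `p`, `p'` starts in the superposition of its two values and ends in the same state, so
the result is the sum over the two values `d` of the products of the factors along the way. The
signs contribute `(-1) ^ (z d)`. The filters contribute `(1 + i) ^ e`, where `e` is `3` for one
value of `d` and `1` for the other: `e = 3` for `d = 0`, unless `x = y = 1`, in which case `e = 3`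
for `d = 1`. So the result is `(1 + i) (2 i + (-1) ^ z)`, and `(1 + i) (1 + (-1) ^ z 2 i)` if
`x = y = 1`. These agree for `z = 0` and differ by the sign for `z = 1`. -/
theorem cczCore {x y z : ℕ} (hx : x ∈ U) (hy : y ∈ U) (hz : z ∈ U) :
    Impl U (Gadget.cczCore x y z) Ψ fun s => (1 + Complex.I) / 524288 *
      (if s z then 2 * Complex.I - 1 else 2 * Complex.I + 1) *
      (if s x && s y && s z then -1 else 1) * Ψ s := by
  refine wrap fun b hb hΨ => ?_
  have h := fresh hb hΨ hx hy hz
  have hp := h.hp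
  rw [prep_pair x y z]
  refine ⟨_, seqs_cons (pair_hp h) (seqs_cons (pair_fil hp _ _) (seqs_cons
    (pair_cz (.inl hz) hp h.hz.1) (seqs_cons (pair_cx_fst h (.inl hx)) (seqs_cons
    (pair_fil hp _ _) (seqs_cons (pair_cx_snd h (.inl hy)) (seqs_cons (pair_fil hp _ _)
    (seqs_cons (pair_cx_fst h (.inl hx)) (seqs_cons (pair_fil hp _ _) (seqs_cons (pair_hp h)
    nil))))))))), ?_⟩
  refine (proj_pair (hb x hx) (hb y hy) (hb z hz) hΨ _).trans ?_
  funext s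
  congr 1
  cases s x <;> cases s y <;> cases s z <;> simp <;> ring_nf <;>
    simp only [invSqrtTwo_pows, I_pows] <;> ring

/-- As in the first part, the result is a sum over the two values of the pair, here
`2 i - (-1) ^ z`. Multiplied by the factor `2 i + (-1) ^ z` of the first part, this is `-5` for both
values of `z`. -/
theorem cczFix {z : ℕ} (hz : z ∈ U) :
    Impl U (Gadget.cczFix z) Ψ fun s => Complex.I / 128 *
      (if s z then 2 * Complex.I + 1 else 2 * Complex.I - 1) * Ψ s := by
  refine wrap fun b hb hΨ => ?_
  have h := fresh hb hΨ hz hz hz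
  have hp := h.hp
  rw [prep_pair z z z]
  refine ⟨_, seqs_cons (pair_hp h) (seqs_cons (pair_fil hp _ _) (seqs_cons (pair_fil hp _ _)
    (seqs_cons (pair_ph hp) (seqs_cons (pair_ph hp) (seqs_cons (pair_cz (.inl hz) hp h.hz.1)
    (seqs_cons (pair_hp h) nil)))))), ?_⟩
  refine (proj_pair (hb z hz) (hb z hz) (hb z hz) hΨ _).trans ?_
  funext s
  congr 1
  cases s z <;> simp <;> ring_nf <;> simp only [invSqrtTwo_pows, I_pows] <;> ring

/-- The constant by which the Toffoli gadget multiplies the Toffoli gate. -/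
noncomputable def tofConst : ℂ := 5 * (Complex.I - 1) / 2 ^ 28

/-- The doubly controlled `Z` gate between two Hadamard gates on the target. -/
theorem tof {x y t t' : ℕ} (hx : x ∈ U) (hy : y ∈ U) (ht : t ∈ U) (ht' : t' ∈ U) (hxt : x ≠ t)
    (hxt' : x ≠ t') (hyt : y ≠ t) (hyt' : y ≠ t') (htt' : t ≠ t') {Φ : Amp}
    (hΦ : ∀ x v, Φ (Function.update x t' v) = Φ x) :
    Impl U (Gadget.tof x y t t') (dualPair t t' Φ) (dualPair t t' fun s =>
      tofConst * if s x && s y then Φ (Function.update s t (!s t)) else Φ s) := by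
  have hfix := (cczFix ht (Ψ := fun s => (1 + Complex.I) / 524288 *
      (if s t then 2 * Complex.I - 1 else 2 * Complex.I + 1) *
      (if s x && s y && s t then -1 else 1) * dualPair t t' (fun x => Complex.I / 2 * invSqrtTwo *
        (Φ (Function.update x t false) + (if x t then -1 else 1) * Φ (Function.update x t true)))
        s)).congr (Ψ'' := dualPair t t' fun s =>
      -5 * (Complex.I - 1) / 2 ^ 26 * (if s x && s y && s t then -1 else 1) *
        (Complex.I / 2 * invSqrtTwo * (Φ (Function.update s t false) +
          (if s t then -1 else 1) * Φ (Function.update s t true)))) (by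
      funext s
      simp only [dualPair]
      by_cases h : s t' = !s t
      · simp only [h, if_true]
        cases s x <;> cases s y <;> cases s t <;> simp <;> ring_nf <;>
          simp only [I_pows] <;> ring
      · simp [h])
  refine (seqs_cons (hp ht ht' htt' hΦ) (seqs_cons (cczCore hx hy ht) (seqs_cons hfix (seqs_cons
    (hp ht ht' htt' fun x v => ?_) nil)))).congr ?_
  · simp only [Function.update_of_ne hxt', Function.update_of_ne hyt', Function.update_of_ne htt',
      Function.update_comm htt'.symm, hΦ]
  · funext s
    simp only [dualPair, Function.update_self, Function.update_of_ne hxt, Function.update_of_ne hyt,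
      Function.update_idem]
    have hs : Φ s = Φ (Function.update s t (s t)) := by rw [Function.update_eq_self]
    rw [hs]
    congr 1
    cases s x <;> cases s y <;> cases s t <;> simp [tofConst] <;> ring_nf <;>
      simp only [invSqrtTwo_sq, I_pows] <;> ring

end Impl

/-! ### States of finitely many qubits as amplitudes -/

/-- The amplitude given by a state of the first `n` wires. -/
def lift {n : ℕ} (ψ : State n) : Amp := fun x => ψ fun q => x q

/-- The state of the first `n` wires given by an amplitude; the other wires are set to `0`. -/
def toState (n : ℕ) (Ψ : Amp) : State n := fun y => Ψ fun q => if h : q < n then y ⟨q, h⟩ else false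

theorem dependsBelow_lift {n : ℕ} (ψ : State n) : DependsBelow n (lift ψ) :=
  fun _ _ e => congrArg ψ (funext fun q => e q q.2)

theorem toState_lift {n : ℕ} (ψ : State n) : toState n (lift ψ) = ψ := by
  funext y
  simp [toState, lift]

/-- The preparation of ancillas, in closed form. -/
theorem prep_apply (b : ℕ) (vs : List Bool) (Ψ : Amp) (x : ℕ → Bool) : prep b vs Ψ x =
    if ∀ k : Fin vs.length, x (b + k) = vs.get k then Ψ x else 0 := by
  induction vs generalizing b Ψ with
  | nil => simp [prep]
  | cons v vs ih =>
    rw [prep, ih]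
    simp only [prepWire, ← ite_and]
    refine if_congr ?_ rfl rfl
    rw [and_comm]
    refine Iff.trans ?_ (Fin.forall_fin_succ (n := vs.length)).symm
    have e : ∀ k : ℕ, b + 1 + k = b + (k + 1) := by omega
    simp [e]

/-- The postselection of ancillas, in closed form. -/
theorem proj_apply (b : ℕ) (vs : List Bool) (Ψ : Amp) (x : ℕ → Bool) : proj b vs Ψ x =
    Ψ fun q => if h : b ≤ q ∧ q < b + vs.length then vs[q - b] else x q := by
  induction vs generalizing b x with
  | nil =>
    refine congrArg Ψ (funext fun q => ?_)
    rw [dif_neg (by simp)]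
  | cons v vs ih =>
    rw [proj, projWire, ih]
    refine congrArg Ψ (funext fun q => ?_)
    by_cases hq : q = b
    · subst hq
      simp
    · by_cases h : b + 1 ≤ q ∧ q < b + 1 + vs.length
      · have h' : b ≤ q ∧ q < b + (v :: vs).length := by simp; omega
        obtain ⟨k, rfl⟩ := Nat.exists_eq_add_of_le h.1
        simp only [h, h']
        simp [show b + 1 + k - b = k + 1 by omega]
      · have h' : ¬ (b ≤ q ∧ q < b + (v :: vs).length) := by simp; omega
        rw [dif_neg h, dif_neg h', Function.update_of_ne hq]

/-! ### Registers with ancillas -/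

/-- The register `R` together with ancillas that are prepared in and postselected on the
values `vs`. -/
def Register.extend (R : Register) (vs : List Bool) : Register where
  n := R.n + vs.length
  input := Fin.append R.input vs.get
  output := Fin.castAdd _ R.output
  post := Fin.append R.post fun k => some (vs.get k)
  post_output := by rw [Fin.append_left, R.post_output]

/-- The role of a qubit in the measurement. -/
def Register.role (R : Register) (q : Fin R.n) : Symbol :=
  if q = R.output then Symbol.out
  else match R.post q with
    | none => Symbol.free
    | some b => Symbol.post b

theorem Register.encode_eq (R : Register) :
    R.encode = (List.ofFn fun q => [Symbol.bit (R.input q), R.role q]).flatten := by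
  rw [Register.encode, List.flatMap_def, List.ofFn_eq_map]
  rfl

theorem Register.role_castAdd (R : Register) (vs : List Bool) (q : Fin R.n) :
    (R.extend vs).role (Fin.castAdd vs.length q) = R.role q := by
  simp only [Register.role, Register.extend, Fin.append_left]
  exact if_congr (Fin.castAdd_inj) rfl rfl

theorem Register.role_natAdd (R : Register) (vs : List Bool) (k : Fin vs.length) :
    (R.extend vs).role (Fin.natAdd R.n k) = Symbol.post (vs.get k) := by
  have h : Fin.natAdd R.n k ≠ Fin.castAdd vs.length R.output := fun e => by
    have := congrArg Fin.val e
    simp at this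
    omega
  simp only [Register.role, Register.extend, Fin.append_right]
  exact if_neg h

/-- Ancillas come last in the description of a register. So a compiler can emit them as it goes
along. -/
theorem Register.encode_extend (R : Register) (vs : List Bool) :
    (R.extend vs).encode = R.encode ++ ancCode vs := by
  rw [Register.encode_eq, Register.encode_eq]
  refine (congrArg List.flatten (List.ofFn_add (m := vs.length) (n := R.n)
    (f := fun q : Fin (R.n + vs.length) => [Symbol.bit ((R.extend vs).input q),
      (R.extend vs).role q]))).trans ?_
  rw [List.flatten_append]
  congr 1
  · congr 2
    funext q
    exact congrArg₂ (fun a b => [Symbol.bit a, b]) (Fin.append_left _ _ q) (R.role_castAdd vs q)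
  · rw [ancCode, List.flatMap_def]
    conv_rhs => rw [← List.ofFn_get vs, List.map_ofFn]
    congr 2
    funext k
    exact congrArg₂ (fun a b => [Symbol.bit a, b]) (Fin.append_right _ _ k) (R.role_natAdd vs k)

theorem lift_ket_extend (R : Register) (vs : List Bool) :
    lift (ket (R.extend vs).input) = prep R.n vs (lift (ket R.input)) := by
  funext x
  rw [prep_apply]
  simp only [lift, ket, Register.extend, ← ite_and]
  refine if_congr ?_ rfl rfl
  constructor
  · intro h
    refine ⟨fun k => ?_, funext fun q => ?_⟩
    · simpa using congrFun h (Fin.natAdd R.n k)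
    · simpa using congrFun h (Fin.castAdd vs.length q)
  · rintro ⟨h1, h2⟩
    funext q
    refine Fin.addCases (fun q => ?_) (fun k => ?_) q
    · simpa using congrFun h2 q
    · simpa using h1 k

theorem toState_proj_lift {n : ℕ} (vs : List Bool) (ψ : State (n + vs.length)) (y : Fin n → Bool) :
    toState n (proj n vs (lift ψ)) y = ψ (Fin.append y vs.get) := by
  simp only [toState, proj_apply, lift]
  refine congrArg ψ (funext fun q => ?_)
  refine Fin.addCases (fun q => ?_) (fun k => ?_) q
  · have : ¬ (n ≤ (q : ℕ)) := by omega
    simp [this]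
  · simp

theorem Register.selected_extend (R : Register) (vs : List Bool) (y : Fin R.n → Bool)
    (z : Fin vs.length → Bool) :
    (R.extend vs).Selected (Fin.append y z) ↔ R.Selected y ∧ z = vs.get := by
  constructor
  · intro h
    refine ⟨fun q b hq => ?_, funext fun k => ?_⟩
    · simpa using h (Fin.castAdd _ q) b (by simpa [Register.extend] using hq)
    · simpa using h (Fin.natAdd _ k) (vs.get k) (by simp [Register.extend])
  · rintro ⟨h, rfl⟩ q
    refine Fin.addCases (fun q b hq => ?_) (fun k b hq => ?_) q
    · simpa using h q b (by simpa [Register.extend] using hq)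
    · simpa [Register.extend] using hq

/-- A sum over the selected outcomes of the extended register is the sum over those of `R` in the
postselected state. -/
theorem sum_extend (R : Register) (vs : List Bool) (ψ : State (R.extend vs).n)
    (P : (Fin R.n → Bool) → Prop) (P' : (Fin (R.extend vs).n → Bool) → Prop)
    [DecidablePred P] [DecidablePred P'] (hP : ∀ y z, P' (Fin.append y z) ↔ P y ∧ z = vs.get) :
    ∑ x with P' x, ‖ψ x‖ ^ 2 = ∑ y with P y, ‖toState R.n (proj R.n vs (lift ψ)) y‖ ^ 2 := by
  refine (Finset.sum_bij (fun y _ => Fin.append y vs.get) (fun y hy => ?_) (fun y _ y' _ e => ?_)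
    (fun x hx => ?_) (fun y _ => ?_)).symm
  · exact (Finset.mem_filter (p := P')).mpr ⟨Finset.mem_univ _, (hP _ _).mpr ⟨(Finset.mem_filter.mp hy).2, rfl⟩⟩
  · funext q
    simpa using congrFun e (Fin.castAdd _ q)
  · have hx' : P' x := ((Finset.mem_filter (p := P')).mp hx).2
    rw [← Fin.append_castAdd_natAdd (m := R.n) (n := vs.length) (f := x), hP] at hx'
    refine ⟨_, by simpa using hx'.1, ?_⟩
    rw [← hx'.2]
    exact Fin.append_castAdd_natAdd
  · exact congrArg (fun z => ‖z‖ ^ 2) (toState_proj_lift vs ψ y)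

theorem Register.postProb_extend (R : Register) (vs : List Bool) (ψ : State (R.extend vs).n) :
    (R.extend vs).postProb ψ = R.postProb (toState R.n (proj R.n vs (lift ψ))) := by
  classical
  exact sum_extend R vs ψ R.Selected (R.extend vs).Selected (R.selected_extend vs)

theorem Register.jointProb_extend (R : Register) (vs : List Bool) (ψ : State (R.extend vs).n)
    (v : Bool) :
    (R.extend vs).jointProb ψ v = R.jointProb (toState R.n (proj R.n vs (lift ψ))) v := by
  classical
  have h := sum_extend R vs ψ (fun y => R.Selected y ∧ y R.output = v)
    (fun x => (R.extend vs).Selected x ∧ x (R.extend vs).output = v) fun y z => ?_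
  · unfold Register.jointProb
    convert h
  rw [R.selected_extend]
  have : Fin.append y z (R.extend vs).output = y R.output := by simp [Register.extend]
  rw [this]
  tauto

theorem Register.postProb_smul (R : Register) (c : ℂ) (ψ : State R.n) :
    R.postProb (c • ψ) = ‖c‖ ^ 2 * R.postProb ψ := by
  simp only [Register.postProb, Pi.smul_apply, smul_eq_mul, norm_mul, mul_pow, Finset.mul_sum]

theorem Register.jointProb_smul (R : Register) (c : ℂ) (ψ : State R.n) (v : Bool) :
    R.jointProb (c • ψ) v = ‖c‖ ^ 2 * R.jointProb ψ v := by
  simp only [Register.jointProb, Pi.smul_apply, smul_eq_mul, norm_mul, mul_pow, Finset.mul_sum]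

/-! ### Gates on finitely many qubits -/

/-- A gate of the universal set as a gate on wires. -/
def QGate.raw {n : ℕ} : QGate n → RawGate ℕ
  | .hadamard q => .had q
  | .phase q => .phase q
  | .cnot c t _ => .cnot c t
  | .toffoli c₁ c₂ t _ _ _ => .toff c₁ c₂ t

theorem QGate.encode_eq {n : ℕ} (g : QGate n) : g.encode = g.raw.code := by cases g <;> rfl

theorem QGate.isUniversal_raw {n : ℕ} (g : QGate n) : g.raw.IsUniversal := by
  cases g <;> trivial

theorem restrict_update {n : ℕ} (x : ℕ → Bool) (t : Fin n) (v : Bool) :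
    (fun q : Fin n => Function.update x t v q) = Function.update (fun q : Fin n => x q) t v := by
  funext q
  simp only [Function.update_apply, Fin.ext_iff]

theorem restrict_swap {n : ℕ} (x : ℕ → Bool) (i j : Fin n) :
    (fun q : Fin n => (x ∘ Equiv.swap (i : ℕ) j) q) = (fun q : Fin n => x q) ∘ Equiv.swap i j := by
  funext q
  simp only [Function.comp_apply, Equiv.swap_apply_def, Fin.ext_iff]
  split_ifs <;> rfl

theorem QGate.lift_apply {n : ℕ} (g : QGate n) (ψ : State n) :
    lift (g.apply ψ) = g.raw.act (lift ψ) := by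
  funext x
  cases g <;> simp only [lift, QGate.apply, QGate.raw, RawGate.act, restrict_update, flip, invSqrtTwo]

theorem lift_final_q {n : ℕ} (gs : List (QGate n)) (ψ : State n) :
    lift (gs.foldl (fun ψ g => g.apply ψ) ψ) = runGates (gs.map QGate.raw) (lift ψ) := by
  induction gs generalizing ψ with
  | nil => rfl
  | cons g gs ih =>
    rw [List.foldl_cons, ih, g.lift_apply]
    rfl

theorem exists_qGate {n : ℕ} (g : RawGate ℕ) (hg : g.IsUniversal) (hn : g.wires.Nodup)
    (hw : ∀ q ∈ g.wires, q < n) : ∃ g' : QGate n, g'.raw = g := by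
  cases g with
  | exch i j neg => exact hg.elim
  | had q => exact ⟨.hadamard ⟨q, hw q (by simp [RawGate.wires])⟩, rfl⟩
  | phase q => exact ⟨.phase ⟨q, hw q (by simp [RawGate.wires])⟩, rfl⟩
  | cnot c t =>
    simp only [RawGate.wires, List.nodup_cons, List.mem_cons, List.not_mem_nil, or_false] at hn
    exact ⟨.cnot ⟨c, hw c (by simp [RawGate.wires])⟩ ⟨t, hw t (by simp [RawGate.wires])⟩
      (by simpa using hn.1), rfl⟩
  | toff c₁ c₂ t =>
    simp only [RawGate.wires, List.nodup_cons, List.mem_cons, List.not_mem_nil, or_false,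
      not_or] at hn
    exact ⟨.toffoli ⟨c₁, hw c₁ (by simp [RawGate.wires])⟩ ⟨c₂, hw c₂ (by simp [RawGate.wires])⟩
      ⟨t, hw t (by simp [RawGate.wires])⟩ (by simpa using hn.1.1) (by simpa using hn.1.2)
      (by simpa using hn.2.1), rfl⟩

theorem exists_qGates {n : ℕ} (gs : List (RawGate ℕ)) (hgs : ∀ g ∈ gs, g.IsUniversal ∧
    g.wires.Nodup ∧ ∀ q ∈ g.wires, q < n) : ∃ l : List (QGate n), l.map QGate.raw = gs := by
  induction gs with
  | nil => exact ⟨[], rfl⟩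
  | cons g gs ih =>
    obtain ⟨l, rfl⟩ := ih fun g hg => hgs g (by simp [hg])
    obtain ⟨h1, h2, h3⟩ := hgs g (by simp)
    obtain ⟨g', rfl⟩ := exists_qGate g h1 h2 h3
    exact ⟨g' :: l, rfl⟩

/-- The pair of integers that denotes the angle `3π/4` if `neg` is true and `π/4` otherwise. -/
def signedAngle (neg : Bool) : ℤ × ℤ := (if neg then -1 else 1, 1)

theorem denotedAngle_signedAngle (neg : Bool) :
    denotedAngle (signedAngle neg) = if neg then 3 * (Real.pi / 4) else Real.pi / 4 := by
  have hr : (0 : ℝ) < Real.sqrt 2 := by positivity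
  have h2 : ((Real.sqrt 2 : ℝ) : ℂ) * (Real.sqrt 2 : ℝ) = 2 := by
    rw [← Complex.ofReal_mul, Real.mul_self_sqrt (by norm_num)]; norm_num
  have h3 : 3 * (Real.pi / 4) = Real.pi - Real.pi / 4 := by ring
  cases neg
  · have := Complex.arg_mul_cos_add_sin_mul_I hr (θ := Real.pi / 4)
      ⟨by linarith [Real.pi_pos], by linarith [Real.pi_pos]⟩
    rw [← Complex.ofReal_cos, ← Complex.ofReal_sin, Real.cos_pi_div_four,
      Real.sin_pi_div_four] at this
    simp only [denotedAngle, signedAngle, Bool.false_eq_true, if_false]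
    rw [← this]
    congr 1
    push_cast
    linear_combination (-(1 + Complex.I) / 2) * h2
  · have := Complex.arg_mul_cos_add_sin_mul_I hr (θ := Real.pi - Real.pi / 4)
      ⟨by linarith [Real.pi_pos], by linarith [Real.pi_pos]⟩
    rw [← Complex.ofReal_cos, ← Complex.ofReal_sin, Real.cos_pi_sub, Real.sin_pi_sub,
      Real.cos_pi_div_four, Real.sin_pi_div_four] at this
    simp only [denotedAngle, signedAngle, if_true, h3]
    rw [← this]
    congr 1
    push_cast
    linear_combination (-(-1 + Complex.I) / 2) * h2

/-- The exchange gate denoted by a gate of a description. -/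
noncomputable def ExchangeGate.denote {n : ℕ} (g : ExchangeGate (ℤ × ℤ) n) : ExchangeGate ℝ n :=
  ⟨g.i, g.j, g.ne, denotedAngle g.angle⟩

theorem ofReal_sqrt_two_div_two : ((Real.sqrt 2 / 2 : ℝ) : ℂ) = invSqrtTwo := by
  have : Real.sqrt 2 / 2 = (Real.sqrt 2)⁻¹ := by
    rw [div_eq_iff two_ne_zero, eq_comm, inv_mul_eq_div, div_eq_iff (by positivity)]
    exact (Real.mul_self_sqrt (by norm_num)).symm
  rw [this, invSqrtTwo, Complex.ofReal_inv]

/-- The exchange gates that occur in gadgets can be written with integers such that the denoted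
angle is exactly the intended multiple of `π / 4`. -/
theorem exists_exchangeGate {n : ℕ} (g : RawGate ℕ) (hg : ¬ g.IsUniversal) (hn : g.wires.Nodup)
    (hw : ∀ q ∈ g.wires, q < n) : ∃ g' : ExchangeGate (ℤ × ℤ) n, encodeExchangeGate g' = g.code ∧
      (∃ m : ℕ, denotedAngle g'.angle = m * (Real.pi / 4)) ∧
      ∀ ψ, lift (g'.denote.apply ψ) = g.act (lift ψ) := by
  cases g with
  | exch i j neg =>
    simp only [RawGate.wires, List.nodup_cons, List.mem_cons, List.not_mem_nil, or_false] at hn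
    refine ⟨⟨⟨i, hw i (by simp [RawGate.wires])⟩, ⟨j, hw j (by simp [RawGate.wires])⟩,
      by simpa using hn.1, signedAngle neg⟩, rfl, ?_, fun ψ => ?_⟩
    · cases neg
      · exact ⟨1, by rw [denotedAngle_signedAngle]; simp⟩
      · exact ⟨3, by rw [denotedAngle_signedAngle]; simp⟩
    · funext x
      simp only [lift, ExchangeGate.apply, ExchangeGate.denote, denotedAngle_signedAngle,
        RawGate.act, swap]
      have := restrict_swap x ⟨i, hw i (by simp [RawGate.wires])⟩
        ⟨j, hw j (by simp [RawGate.wires])⟩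
      rw [← this]
      have h3 : 3 * (Real.pi / 4) = Real.pi - Real.pi / 4 := by ring
      cases neg
      · simp only [Bool.false_eq_true, if_false]
        rw [Real.cos_pi_div_four, Real.sin_pi_div_four, ofReal_sqrt_two_div_two]
      · simp only [if_true, h3]
        rw [Real.cos_pi_sub, Real.sin_pi_sub, Real.cos_pi_div_four, Real.sin_pi_div_four,
          Complex.ofReal_neg, ofReal_sqrt_two_div_two]
  | _ => exact (hg trivial).elim

theorem exists_exchangeGates {n : ℕ} (gs : List (RawGate ℕ)) (hgs : ∀ g ∈ gs, ¬ g.IsUniversal ∧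
    g.wires.Nodup ∧ ∀ q ∈ g.wires, q < n) : ∃ l : List (ExchangeGate (ℤ × ℤ) n),
      l.flatMap encodeExchangeGate = gs.flatMap RawGate.code ∧
      (∀ g ∈ l, ∃ m : ℕ, denotedAngle g.angle = m * (Real.pi / 4)) ∧
      ∀ ψ, lift ((l.map ExchangeGate.denote).foldl (fun ψ g => g.apply ψ) ψ) =
        runGates gs (lift ψ) := by
  induction gs with
  | nil => exact ⟨[], rfl, by simp, fun _ => rfl⟩
  | cons g gs ih =>
    obtain ⟨l, hl1, hl2, hl3⟩ := ih fun g hg => hgs g (by simp [hg])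
    obtain ⟨h1, h2, h3⟩ := hgs g (by simp)
    obtain ⟨g', e1, e2, e3⟩ := exists_exchangeGate g h1 h2 h3
    refine ⟨g' :: l, ?_, ?_, fun ψ => ?_⟩
    · rw [List.flatMap_cons, List.flatMap_cons, e1, hl1]
    · simpa using ⟨e2, hl2⟩
    · rw [List.map_cons, List.foldl_cons, hl3, e3]
      rfl

/-! ### The dual-rail encoding -/

/-- The dual-rail encoding of an amplitude of `n` wires: wire `q` becomes the pair `2 q`,
`2 q + 1` of wires with opposite values. -/
def enc (n : ℕ) (φ : Amp) : Amp := fun x =>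
  if ∀ q < n, x (2 * q + 1) = !x (2 * q) then φ fun q => x (2 * q) else 0

/-- The amplitude `φ` on the even wires, where all pairs but the pair `t` have opposite values. -/
def encExcept (n t : ℕ) (φ : Amp) : Amp := fun x =>
  if ∀ q < n, q ≠ t → x (2 * q + 1) = !x (2 * q) then φ fun q => x (2 * q) else 0

theorem enc_smul (n : ℕ) (c : ℂ) (φ : Amp) : enc n (c • φ) = c • enc n φ := by
  funext x
  simp only [enc, Pi.smul_apply]
  split_ifs <;> simp

theorem enc_eq_dualPair {n t : ℕ} (ht : t < n) (φ : Amp) :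
    enc n φ = Impl.dualPair (2 * t) (2 * t + 1) (encExcept n t φ) := by
  funext x
  simp only [enc, Impl.dualPair, encExcept, ← ite_and]
  refine if_congr ⟨fun h => ⟨h t ht, fun q hq _ => h q hq⟩, fun h q hq => ?_⟩ rfl rfl
  by_cases hqt : q = t
  · exact hqt ▸ h.1
  · exact h.2 q hq hqt

/-- The dual-rail gadgets require an amplitude that does not depend on the second wire of the target
pair. The constraint on the pair `t` is left out of `encExcept` for this reason. -/
theorem encExcept_update_odd (n t : ℕ) (φ : Amp) (x : ℕ → Bool) (v : Bool) :
    encExcept n t φ (Function.update x (2 * t + 1) v) = encExcept n t φ x := by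
  refine ite_congr (propext (forall₃_congr fun q _ hqt => ?_)) (fun _ => congrArg φ ?_) fun _ => rfl
  · rw [Function.update_of_ne (by omega), Function.update_of_ne (by omega)]
  · funext q
    rw [Function.update_of_ne (by omega)]

theorem encExcept_update_even (n t : ℕ) (φ : Amp) (x : ℕ → Bool) (v : Bool) :
    encExcept n t φ (Function.update x (2 * t) v) =
      encExcept n t (fun y => φ (Function.update y t v)) x := by
  refine ite_congr (propext (forall₃_congr fun q _ hqt => ?_)) (fun _ => congrArg φ ?_) fun _ => rfl
  · rw [Function.update_of_ne (by omega), Function.update_of_ne (by omega)]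
  · funext q
    by_cases h : q = t
    · subst h; simp
    · rw [Function.update_of_ne h, Function.update_of_ne (by omega)]

/-- On the dual-rail encoding, the gadget of a gate acts as the gate, up to a constant that is not
too small. -/
theorem exists_impl_dualRail {n : ℕ} {g : RawGate ℕ} (hg : g.IsUniversal) (hn : g.wires.Nodup)
    (hw : ∀ q ∈ g.wires, q < n) (φ : Amp) : ∃ c : ℂ, (2 : ℝ)⁻¹ ^ 28 ≤ ‖c‖ ∧
      Impl (Set.Iio (2 * n)) (dualRail g) (enc n φ) (enc n (c • g.act φ)) := by
  have hlt : ∀ {q}, q < n → 2 * q ∈ Set.Iio (2 * n) := fun {q} h => by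
    simp only [Set.mem_Iio]; omega
  have hlt' : ∀ {q}, q < n → 2 * q + 1 ∈ Set.Iio (2 * n) := fun {q} h => by
    simp only [Set.mem_Iio]; omega
  have hI : (1 : ℝ) ≤ ‖-1 + Complex.I‖ := by
    have := Complex.abs_im_le_norm (-1 + Complex.I)
    simpa using this
  cases g with
  | exch i j neg => exact hg.elim
  | had t =>
    have ht : t < n := hw t (by simp [RawGate.wires])
    refine ⟨Complex.I / 2, by norm_num, ?_⟩
    rw [enc_eq_dualPair ht, enc_eq_dualPair ht]
    refine (Impl.hp (hlt ht) (hlt' ht) (by omega) fun x v =>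
      encExcept_update_odd n t φ x v).congr (congrArg _ ?_)
    funext x
    rw [encExcept_update_even, encExcept_update_even]
    simp only [encExcept, RawGate.act, Pi.smul_apply, smul_eq_mul]
    split_ifs <;> ring
  | phase t =>
    have ht : t < n := hw t (by simp [RawGate.wires])
    refine ⟨(-1 + Complex.I) / 2, ?_, (Impl.ph (hlt ht)).congr ?_⟩
    · rw [norm_div, Complex.norm_ofNat]
      linarith [show (2 : ℝ)⁻¹ ^ 28 ≤ 1 / 2 by norm_num]
    · funext x
      simp only [enc, RawGate.act, Pi.smul_apply, smul_eq_mul]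
      split_ifs <;> ring
  | cnot c t =>
    have hc : c < n := hw c (by simp [RawGate.wires])
    have ht : t < n := hw t (by simp [RawGate.wires])
    have hct : c ≠ t := by simpa [RawGate.wires] using hn
    refine ⟨-1 / 16, by norm_num, ?_⟩
    rw [enc_eq_dualPair ht, enc_eq_dualPair ht]
    refine (Impl.cx (hlt hc) (hlt ht) (hlt' ht) (by omega) (by omega) (by omega) fun x v =>
      encExcept_update_odd n t φ x v).congr (congrArg _ ?_)
    funext x
    rw [encExcept_update_even]
    simp only [encExcept, RawGate.act, Pi.smul_apply, smul_eq_mul]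
    split_ifs <;> ring
  | toff a b t =>
    have ha : a < n := hw a (by simp [RawGate.wires])
    have hb : b < n := hw b (by simp [RawGate.wires])
    have ht : t < n := hw t (by simp [RawGate.wires])
    have hat : a ≠ t := by rintro rfl; simp [RawGate.wires] at hn
    have hbt : b ≠ t := by rintro rfl; simp [RawGate.wires] at hn
    refine ⟨Impl.tofConst, ?_, ?_⟩
    · rw [Impl.tofConst, norm_div, norm_mul, norm_pow, Complex.norm_ofNat, Complex.norm_ofNat,
        show Complex.I - 1 = -1 + Complex.I by ring, inv_pow, inv_eq_one_div]
      gcongr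
      linarith
    rw [enc_eq_dualPair ht, enc_eq_dualPair ht]
    refine (Impl.tof (hlt ha) (hlt hb) (hlt ht) (hlt' ht) (by omega) (by omega) (by omega)
      (by omega) (by omega) fun x v => encExcept_update_odd n t φ x v).congr (congrArg _ ?_)
    funext x
    rw [encExcept_update_even]
    simp only [encExcept, RawGate.act, Pi.smul_apply, smul_eq_mul]
    split_ifs <;> ring

theorem RawGate.act_smul (g : RawGate ℕ) (c : ℂ) (Ψ : Amp) : g.act (c • Ψ) = c • g.act Ψ := by
  funext x
  cases g <;> simp only [RawGate.act, Pi.smul_apply, smul_eq_mul] <;> (try split_ifs) <;> ring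

theorem runGates_smul (gs : List (RawGate ℕ)) (c : ℂ) (Ψ : Amp) :
    runGates gs (c • Ψ) = c • runGates gs Ψ := by
  induction gs generalizing Ψ with
  | nil => rfl
  | cons g gs ih =>
    refine (congrArg (runGates gs) (g.act_smul c Ψ)).trans (ih _)

theorem exists_impl_dualRails {n : ℕ} {gs : List (RawGate ℕ)} (hgs : ∀ g ∈ gs, g.IsUniversal ∧
    g.wires.Nodup ∧ ∀ q ∈ g.wires, q < n) (φ : Amp) : ∃ c : ℂ,
      ((2 : ℝ)⁻¹ ^ 28) ^ gs.length ≤ ‖c‖ ∧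
      Impl (Set.Iio (2 * n)) (Gadget.seqs (gs.map dualRail)) (enc n φ)
        (enc n (c • runGates gs φ)) := by
  induction gs generalizing φ with
  | nil => exact ⟨1, by simp, Impl.nil.congr (by rw [one_smul]; rfl)⟩
  | cons g gs ih =>
    obtain ⟨h1, h2, h3⟩ := hgs g (by simp)
    obtain ⟨c, hc, hi⟩ := exists_impl_dualRail h1 h2 h3 φ
    obtain ⟨c', hc', hi'⟩ := ih (fun h hh => hgs h (by simp [hh])) (c • g.act φ)
    refine ⟨c' * c, ?_, (Impl.seqs_cons hi hi').congr ?_⟩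
    · rw [List.length_cons, pow_succ, norm_mul]
      gcongr
    · rw [runGates_smul, smul_smul]
      rfl

/-! ### Dual-rail registers -/

/-- The register of an exchange circuit that has two qubits with opposite values for each qubit
of `R`. -/
def Register.dual (R : Register) : Register where
  n := 2 * R.n
  input q := if (q : ℕ) % 2 = 0 then R.input ⟨q / 2, by omega⟩ else !R.input ⟨q / 2, by omega⟩
  output := ⟨2 * R.output, by omega⟩
  post q := if (q : ℕ) % 2 = 0 then R.post ⟨q / 2, by omega⟩ else none
  post_output := by simp [R.post_output]

theorem Register.encode_dual (R : Register) : R.dual.encode = (List.ofFn fun q =>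
    [Symbol.bit (R.input q), R.role q, Symbol.bit (!R.input q), Symbol.free]).flatten := by
  rw [Register.encode_eq]
  refine (congrArg List.flatten (List.ofFn_mul' (m := 2) (n := R.n)
    (fun q : Fin (2 * R.n) => [Symbol.bit (R.dual.input q), R.dual.role q]))).trans ?_
  rw [List.flatten_flatten, List.map_ofFn]
  congr 2
  funext q
  have h : ¬ 2 * (q : ℕ) + 1 = 2 * (R.output : ℕ) := by omega
  have h2 : (2 * (q : ℕ) + 1) / 2 = q := by omega
  simp [Register.dual, Register.role, Fin.ext_iff, h, h2, Nat.add_mod]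

/-- The dual-rail encoding of an assignment. -/
def dualBits {n : ℕ} (y : Fin n → Bool) (q : Fin (2 * n)) : Bool :=
  if (q : ℕ) % 2 = 0 then y ⟨q / 2, by omega⟩ else !y ⟨q / 2, by omega⟩

theorem enc_lift_ket (R : Register) : enc R.n (lift (ket R.input)) = lift (ket R.dual.input) := by
  funext x
  simp only [enc, lift, ket, ← ite_and]
  refine if_congr ?_ rfl rfl
  constructor
  · rintro ⟨h1, h2⟩
    funext q
    have h2' := congrFun h2 ⟨q / 2, by have := q.2; simp only [Register.dual] at this; omega⟩
    have h1' := h1 (q / 2) (by have := q.2; simp only [Register.dual] at this; omega)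
    simp only [Register.dual]
    rcases Nat.mod_two_eq_zero_or_one q with h | h
    · rw [if_pos h, ← h2']
      simp only
      congr 1
      omega
    · rw [if_neg (by omega), ← h2']
      simp only
      rw [← h1']
      congr 1
      omega
  · intro h
    have he : ∀ q (hq : q < R.n), x (2 * q) = R.input ⟨q, hq⟩ := fun q hq => by
      have := congrFun h ⟨2 * q, by simp only [Register.dual]; omega⟩
      simpa [Register.dual] using this
    refine ⟨fun q hq => ?_, funext fun q => he q q.2⟩
    have := congrFun h ⟨2 * q + 1, by simp only [Register.dual]; omega⟩
    have h2 : (2 * q + 1) / 2 = q := by omega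
    rw [he q hq]
    simpa [Register.dual, h2, Nat.add_mod] using this

theorem toState_enc {n : ℕ} (ψ : State n) (y : Fin n → Bool) :
    toState (2 * n) (enc n (lift ψ)) (dualBits y) = ψ y := by
  have h2 : ∀ q : ℕ, (2 * q + 1) / 2 = q := by omega
  simp only [toState, enc, lift]
  rw [if_pos]
  · congr 1
    funext q
    simp [dualBits]
  · intro q hq
    have h : 2 * q + 1 < 2 * n := by omega
    simp [dualBits, hq, h, h2, Nat.add_mod]

theorem dualBits_of_toState_enc_ne_zero {n : ℕ} (ψ : State n) (x : Fin (2 * n) → Bool)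
    (h : toState (2 * n) (enc n (lift ψ)) x ≠ 0) :
    dualBits (fun q => x ⟨2 * q, by omega⟩) = x := by
  simp only [toState, enc] at h
  have h1 := (ite_ne_right_iff.mp h).1
  funext q
  simp only [dualBits]
  have h2 := h1 (q / 2) (by omega)
  rw [dif_pos (by omega), dif_pos (by omega)] at h2
  rcases Nat.mod_two_eq_zero_or_one q with h | h
  · rw [if_pos h]
    congr 1
    ext
    simp only
    omega
  · rw [if_neg (by omega), ← h2]
    congr 1
    ext
    simp only
    omega

/-- Off the image of the dual-rail encoding the amplitudes vanish, so sums over outcomes agree. -/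
theorem sum_dual (R : Register) (ψ : State R.n) (P : (Fin R.n → Bool) → Prop)
    (P' : (Fin R.dual.n → Bool) → Prop) [DecidablePred P] [DecidablePred P']
    (hP : ∀ y, P' (dualBits y) ↔ P y) :
    ∑ x with P' x, ‖toState R.dual.n (enc R.n (lift ψ)) x‖ ^ 2 = ∑ y with P y, ‖ψ y‖ ^ 2 := by
  refine (Finset.sum_of_injOn dualBits (fun y _ y' _ e => ?_) (fun y hy => ?_)
    (fun x hx h => ?_) (fun y _ => ?_)).symm
  · funext q
    simpa [dualBits] using congrFun e ⟨2 * q, by omega⟩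
  · refine (Finset.mem_filter (p := P')).mpr ⟨Finset.mem_univ _, (hP y).mpr ?_⟩
    exact (Finset.mem_filter.mp hy).2
  · by_contra hne
    have h0 : toState R.dual.n (enc R.n (lift ψ)) x ≠ 0 := fun e => hne (by rw [e]; simp)
    have h1 := dualBits_of_toState_enc_ne_zero ψ x h0
    have h2 : P' x := ((Finset.mem_filter (p := P')).mp hx).2
    refine h ⟨_, ?_, h1⟩
    refine Finset.mem_coe.mpr (Finset.mem_filter.mpr ⟨Finset.mem_univ _, (hP _).mp ?_⟩)
    rw [h1]
    exact h2
  · exact congrArg (fun z => ‖z‖ ^ 2) (toState_enc ψ y).symm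

theorem Register.selected_dual (R : Register) (y : Fin R.n → Bool) :
    R.dual.Selected (dualBits y) ↔ R.Selected y := by
  constructor
  · intro h q b hq
    simpa [dualBits] using h ⟨2 * q, by simp only [Register.dual]; omega⟩ b
      (by simpa [Register.dual] using hq)
  · intro h q b hq
    simp only [Register.dual] at hq
    simp only [dualBits]
    split_ifs at hq ⊢ with h2
    · exact h _ _ hq

theorem Register.postProb_dual (R : Register) (ψ : State R.n) :
    R.dual.postProb (toState R.dual.n (enc R.n (lift ψ))) = R.postProb ψ := by
  classical
  exact sum_dual R ψ R.Selected R.dual.Selected R.selected_dual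

theorem Register.jointProb_dual (R : Register) (ψ : State R.n) (v : Bool) :
    R.dual.jointProb (toState R.dual.n (enc R.n (lift ψ))) v = R.jointProb ψ v := by
  classical
  have h := sum_dual R ψ (fun y => R.Selected y ∧ y R.output = v)
    (fun x => R.dual.Selected x ∧ x R.dual.output = v) fun y => ?_
  · unfold Register.jointProb
    convert h
  rw [R.selected_dual]
  have : dualBits y R.dual.output = y R.output := by simp [Register.dual, dualBits]
  rw [this]

/-! ### Which gates occur in a gadget -/

namespace Gadget

variable {W : Type} {p : RawGate W → Prop}

/-- All gates of the gadget have the property `p`. -/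
def All (p : RawGate W → Prop) (G : Gadget W) : Prop := ∀ a, ∀ g ∈ (G a).1, p g

theorem All.seq {G H : Gadget W} (hG : All p G) (hH : All p H) : All p (seq G H) :=
  fun a g hg => (List.mem_append.mp hg).elim (hG a g) (hH _ g)

theorem All.seqs {l : List (Gadget W)} (h : ∀ G ∈ l, All p G) : All p (seqs l) := by
  induction l with
  | nil => exact fun a g hg => by simp [Gadget.seqs, nil] at hg
  | cons G l ih => exact (h G (by simp)).seq (ih fun H hH => h H (by simp [hH]))

theorem All.wrap {vs : List Bool} {G : (ℕ → W) → Gadget W} (h : ∀ a, All p (G a)) :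
    All p (wrap vs G) := fun a => h a _

end Gadget

/-- All gates of the gadget are exchange gates. -/
abbrev Gadget.AllExchange (G : Gadget ℕ) : Prop := G.All fun g => ¬ g.IsUniversal

namespace Gadget.AllExchange

variable (i j k l : ℕ)

theorem fil (v neg : Bool) : (Gadget.fil i v neg).AllExchange := fun a g hg => by
  rw [List.mem_singleton.mp hg]; exact id

theorem exch (neg : Bool) : (Gadget.gate (.exch i j neg)).AllExchange := fun a g hg => by
  rw [List.mem_singleton.mp hg]; exact id

theorem ph : (Gadget.ph i).AllExchange := All.seqs (by simp [fil])

theorem phInv : (Gadget.phInv i).AllExchange := All.seqs (by simp [fil])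

theorem hp : (Gadget.hp i j).AllExchange := All.seqs (by simp [phInv, exch])

theorem cz : (Gadget.cz i j).AllExchange := All.seqs (by simp [ph, phInv, exch])

theorem cx : (Gadget.cx i j k).AllExchange := All.seqs (by simp [hp, cz])

theorem tof : (Gadget.tof i j k l).AllExchange := All.seqs (by
  simp only [List.forall_mem_cons, List.not_mem_nil, false_imp_iff, implies_true, and_true, hp,
    true_and]
  exact ⟨All.wrap fun a => All.seqs (by simp [hp, fil, cz, cx]),
    All.wrap fun a => All.seqs (by simp [hp, fil, cz, ph])⟩)

theorem dualRail (g : RawGate ℕ) : (XQP.dualRail g).AllExchange := by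
  cases g
  · exact fun a g hg => by simp [XQP.dualRail, Gadget.nil] at hg
  · exact hp _ _
  · exact ph _
  · exact cx _ _ _
  · exact tof _ _ _ _

end Gadget.AllExchange

/-! ### Lower bounds on success probabilities -/

theorem gaussian_norm_sq (z : GaussianInt) : ‖(z : ℂ)‖ ^ 2 = (z.norm : ℝ) := by
  rw [← Complex.normSq_eq_norm_sq, GaussianInt.intCast_real_norm]

/-- The amplitudes are Gaussian integers, up to a power of `1 / √2` with at most one factor for each
gate. -/
theorem exists_gaussian {n : ℕ} (gs : List (QGate n)) (y : Fin n → Bool) :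
    ∃ h ≤ gs.length, ∃ f : (Fin n → Bool) → GaussianInt,
      gs.foldl (fun ψ g => g.apply ψ) (ket y) = fun x => invSqrtTwo ^ h * (f x : ℂ) := by
  induction gs using List.reverseRecOn with
  | nil =>
    refine ⟨0, le_rfl, fun x => if x = y then 1 else 0, ?_⟩
    funext x
    simp only [List.foldl_nil, ket, pow_zero, one_mul]
    split_ifs <;> simp
  | append_singleton gs g ih =>
    obtain ⟨h, hh, f, e⟩ := ih
    rw [List.foldl_append, e]
    cases g with
    | hadamard q =>
      refine ⟨h + 1, by simpa using hh, fun x => f (Function.update x q false) +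
        (if x q then -1 else 1) * f (Function.update x q true), ?_⟩
      funext x
      simp only [List.foldl_cons, List.foldl_nil, QGate.apply]
      rw [← invSqrtTwo]
      split_ifs
      · rw [GaussianInt.toComplex_add, GaussianInt.toComplex_mul]
        simp
        ring
      · rw [GaussianInt.toComplex_add, GaussianInt.toComplex_mul]
        simp
        ring
    | phase q =>
      refine ⟨h, hh.trans (by simp), fun x => (if x q then ⟨0, 1⟩ else 1) * f x, ?_⟩
      funext x
      simp only [List.foldl_cons, List.foldl_nil, QGate.apply]
      split_ifs
      · have : (((⟨0, 1⟩ : GaussianInt) : GaussianInt) : ℂ) = Complex.I := by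
          simp [GaussianInt.toComplex_def]
        rw [GaussianInt.toComplex_mul, this]
        ring
      · simp
    | cnot c t hct =>
      refine ⟨h, hh.trans (by simp), fun x => if x c then f (flip t x) else f x, ?_⟩
      funext x
      simp only [List.foldl_cons, List.foldl_nil, QGate.apply]
      split_ifs <;> rfl
    | toffoli c₁ c₂ t h₁₂ h₁ h₂ =>
      refine ⟨h, hh.trans (by simp), fun x => if x c₁ && x c₂ then f (flip t x) else f x, ?_⟩
      funext x
      simp only [List.foldl_cons, List.foldl_nil, QGate.apply]
      split_ifs <;> rfl

/-- A positive success probability of a general circuit is at least inverse exponential in the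
number of gates, as it is an integer times a power of `1 / 2`. -/
theorem half_pow_le_postProb (C : QCircuit) (h : 0 < C.postProb C.final) :
    (2 : ℝ)⁻¹ ^ C.gates.length ≤ C.postProb C.final := by
  classical
  obtain ⟨m, hm, f, e⟩ := exists_gaussian C.gates C.input
  have hκ : ‖invSqrtTwo ^ m‖ ^ 2 = (2 : ℝ)⁻¹ ^ m := by
    rw [← norm_pow, ← pow_mul, mul_comm m, pow_mul, invSqrtTwo_sq, norm_pow]
    norm_num
  have hsum : C.postProb C.final =
      (2 : ℝ)⁻¹ ^ m * ((∑ x with C.Selected x, (f x).norm : ℤ) : ℝ) := by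
    rw [QCircuit.final, e, Register.postProb]
    push_cast
    rw [Finset.mul_sum]
    refine Finset.sum_congr (by ext; simp) fun x _ => ?_
    rw [norm_mul, mul_pow, gaussian_norm_sq, hκ]
  rw [hsum] at h ⊢
  have hp : (0 : ℝ) < (2 : ℝ)⁻¹ ^ m := by positivity
  have h1 : (1 : ℤ) ≤ ∑ x with C.Selected x, (f x).norm :=
    Int.cast_pos.mp (pos_of_mul_pos_right h hp.le)
  have h2 : (1 : ℝ) ≤ ((∑ x with C.Selected x, (f x).norm : ℤ) : ℝ) := by exact_mod_cast h1
  calc (2 : ℝ)⁻¹ ^ C.gates.length ≤ (2 : ℝ)⁻¹ ^ m :=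
        pow_le_pow_of_le_one (by norm_num) (by norm_num) hm
    _ ≤ _ := le_mul_of_one_le_right hp.le h2

/-- Conditional probabilities do not depend on the normalization of the state. -/
theorem condProb_eq_of_scaled {R R' : Register} {ψ : State R.n} {ψ' : State R'.n} {s : ℝ}
    (hs : 0 < s) (hp : R'.postProb ψ' = s * R.postProb ψ)
    (hj : ∀ v, R'.jointProb ψ' v = s * R.jointProb ψ v) (v : Bool) :
    R'.condProb ψ' v = R.condProb ψ v := by
  rw [Register.condProb, Register.condProb, hp, hj, mul_div_mul_left _ _ hs.ne']

/-! ### From general circuits to exchange circuits -/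

/-- The state of a compiler after the entries of a register. -/
theorem foldl_entries {ι : Type} {step : Cfg → ι → Cfg} {E : ι → List Symbol} {m : ℕ}
    (h : ∀ C x, step C x = { C with r := (E x).reverse ++ C.r }.set .base (C.σ .base + m))
    (l : List ι) (C : Cfg) : l.foldl step C =
      { C with r := (l.flatMap E).reverse ++ C.r }.set .base (C.σ .base + m * l.length) := by
  induction l generalizing C with
  | nil => simp [Cfg.set]
  | cons x l ih =>
    rw [List.foldl_cons, ih, h]
    ext1
    · simp [Cfg.set]
    · simp [Cfg.set]
    · simp [Cfg.set]
    · simp only [Cfg.set, Function.update_self, Function.update_idem, List.length_cons]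
      congr 1
      ring

/-- The entries of a register. -/
def Register.entries (R : Register) : List (Bool × Symbol) :=
  List.ofFn fun q => (R.input q, R.role q)

/-- The exchange circuit that is denoted by a circuit whose angles are pairs of integers. -/
noncomputable def Circuit.denote (C : Circuit (ExchangeGate (ℤ × ℤ))) : XQPCircuit :=
  ⟨C.toRegister, C.gates.map ExchangeGate.denote⟩

/-- A gadget made of exchange gates gives an exchange circuit on the register `R` with ancillas, with
the probabilities of the final state `Ψ` on the register `R`. -/
theorem exists_exchangeCircuit (R : Register) {G : Gadget ℕ} {Ψ : Amp}
    (hG : Impl (Set.Iio R.n) G (lift (ket R.input)) Ψ) (hex : G.AllExchange) :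
    ∃ C : Circuit (ExchangeGate (ℤ × ℤ)),
      C.encode encodeExchangeGate = R.encode ++ ancCode (G fun k => R.n + k).2 ++
        (G fun k => R.n + k).1.flatMap RawGate.code ∧
      (∀ g ∈ C.gates, ∃ m : ℕ, denotedAngle g.angle = m * (Real.pi / 4)) ∧
      C.postProb C.denote.final = R.postProb (toState R.n Ψ) ∧
      ∀ v, C.jointProb C.denote.final v = R.jointProb (toState R.n Ψ) v := by
  obtain ⟨h1, h2, -⟩ := hG R.n (fun q hq => hq) (dependsBelow_lift _)
  obtain ⟨l, e1, e2, e3⟩ := exists_exchangeGates (n := R.n + (G fun k => R.n + k).2.length)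
    (G fun k => R.n + k).1 fun g hg => ⟨hex _ g hg, (h1 g hg).1, fun q hq => by
      rcases (h1 g hg).2 q hq with h | h
      · have : q < R.n := h
        omega
      · exact h.2⟩
  have hf : toState R.n (proj R.n (G fun k => R.n + k).2 (lift (Circuit.denote
      ⟨R.extend (G fun k => R.n + k).2, l⟩).final)) = toState R.n Ψ := by
    rw [← h2, ← lift_ket_extend]
    exact congrArg (fun Φ => toState R.n (proj R.n (G fun k => R.n + k).2 Φ)) (e3 _)
  refine ⟨⟨R.extend (G fun k => R.n + k).2, l⟩, ?_, e2, ?_, fun v => ?_⟩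
  · rw [Circuit.encode, Register.encode_extend]
    exact congrArg _ e1
  · exact (Register.postProb_extend R _ _).trans (congrArg R.postProb hf)
  · exact (Register.jointProb_extend R _ _ v).trans (congrArg (R.jointProb · v) hf)

/-- The gadget for a general circuit. -/
def dualRails (C : QCircuit) : Gadget ℕ :=
  Gadget.seqs ((C.gates.map QGate.raw).map dualRail)

theorem QGate.raw_ok {n : ℕ} (g : QGate n) :
    g.raw.IsUniversal ∧ g.raw.wires.Nodup ∧ ∀ q ∈ g.raw.wires, q < n := by
  cases g <;> simp_all [QGate.raw, RawGate.IsUniversal, RawGate.wires, Fin.val_inj]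

/-- The exchange circuit that simulates a general circuit: its description is what the compiler puts
out, and its probabilities are those of the general circuit up to a common factor `s`. -/
theorem exists_dualRailCircuit (C : QCircuit) : ∃ C' : Circuit (ExchangeGate (ℤ × ℤ)),
    C'.encode encodeExchangeGate = C.toRegister.dual.encode ++
      ancCode (dualRails C fun k => 2 * C.n + k).2 ++
      (dualRails C fun k => 2 * C.n + k).1.flatMap RawGate.code ∧
    (∀ g ∈ C'.gates, ∃ m : ℕ, denotedAngle g.angle = m * (Real.pi / 4)) ∧
    ∃ s : ℝ, ((2 : ℝ)⁻¹ ^ 56) ^ C.gates.length ≤ s ∧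
      C'.postProb C'.denote.final = s * C.postProb C.final ∧
      ∀ v, C'.jointProb C'.denote.final v = s * C.jointProb C.final v := by
  obtain ⟨c, hc, hG⟩ := exists_impl_dualRails (n := C.n) (gs := C.gates.map QGate.raw)
    (by simpa using fun g _ => g.raw_ok) (lift (ket C.input))
  rw [enc_lift_ket, enc_smul, ← lift_final_q] at hG
  obtain ⟨C', e1, e2, e3, e4⟩ := exists_exchangeCircuit C.toRegister.dual hG
    (Gadget.All.seqs (by simpa using fun g _ => Gadget.AllExchange.dualRail _))
  have hs : toState C.toRegister.dual.n (c • enc C.n (lift C.final)) =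
      c • toState C.toRegister.dual.n (enc C.n (lift C.final)) := rfl
  refine ⟨C', e1, e2, ‖c‖ ^ 2, ?_, ?_, fun v => ?_⟩
  · rw [List.length_map] at hc
    refine le_trans (le_of_eq ?_) (pow_le_pow_left₀ (by positivity) hc 2)
    rw [← pow_mul, ← pow_mul, ← pow_mul]
    congr 1
    ring
  · refine e3.trans ((congrArg _ hs).trans ?_)
    rw [Register.postProb_smul, Register.postProb_dual]
  · refine (e4 v).trans ((congrArg (C.toRegister.dual.jointProb · v) hs).trans ?_)
    rw [Register.jointProb_smul, Register.jointProb_dual]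

/-- The items of the description of a general circuit. -/
def gateItems (C : QCircuit) : List GateItem :=
  C.entries.map Sum.inl ++ C.gates.map fun g => Sum.inr g.raw

theorem encode_eq_gateItems (C : QCircuit) :
    C.encode QGate.encode = (gateItems C).flatMap GateItem.code := by
  rw [gateItems, List.flatMap_append, Circuit.encode, Register.encode_eq]
  congr 1
  · rw [Register.entries, List.flatMap_def, List.map_map, List.map_ofFn]
    rfl
  · rw [List.flatMap_map]
    exact congrArg (fun f => List.flatMap f C.gates) (funext QGate.encode_eq)

theorem length_gates_le (C : QCircuit) : C.gates.length ≤ (C.encode QGate.encode).length := by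
  have : ∀ gs : List (QGate C.n), gs.length ≤ (gs.flatMap QGate.encode).length := by
    intro gs
    induction gs with
    | nil => simp
    | cons g gs ih =>
      have : 1 ≤ g.encode.length := by cases g <;> simp [QGate.encode]
      rw [List.flatMap_cons, List.length_cons, List.length_append]
      omega
  rw [Circuit.encode, List.length_append]
  exact (this _).trans (Nat.le_add_left _ _)

/-- What a compiler has emitted after the entries `l` of a register and one gadget for all gates. -/
theorem emit_entries {C : Cfg} (hg : C.g = []) (G : Gadget ℕ) {l : List Symbol} {n : ℕ}
    (hr : C.r = l.reverse) (hn : C.σ .base = n) :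
    (C.emit G).r.reverse ++ (C.emit G).g.reverse =
      l ++ ancCode (G fun k => n + k).2 ++ (G fun k => n + k).1.flatMap RawGate.code := by
  subst hn
  simp [Cfg.emit, hg, hr]

theorem computable_dualRail {f : QCircuit → Circuit (ExchangeGate (ℤ × ℤ))}
    (hf : ∀ C, (f C).encode encodeExchangeGate = C.toRegister.dual.encode ++
      ancCode (dualRails C fun k => 2 * C.n + k).2 ++
      (dualRails C fun k => 2 * C.n + k).1.flatMap RawGate.code) :
    Nonempty (TM2ComputableInPolyTime (Circuit.encode QGate.encode)
      (Circuit.encode encodeExchangeGate) f) := by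
  obtain ⟨c, hc⟩ := handles_dualRail
  refine computable_of_handles gateItems rfl (fun C x hx => hc x ?_) encode_eq_gateItems
    fun C => ?_
  · rintro g rfl
    simp only [gateItems, List.mem_append, List.mem_map, reduceCtorEq, and_false, exists_false,
      Sum.inr.injEq, false_or] at hx
    obtain ⟨g', -, rfl⟩ := hx
    exact g'.isUniversal_raw
  · rw [hf, gateItems, List.foldl_append, List.foldl_map, List.foldl_map, foldl_entries
      (step := fun D x => dualRailStep D (.inl x)) (m := 2)
      (E := fun x : Bool × Symbol => [Symbol.bit x.1, x.2, .bit (!x.1), .free]) fun _ _ => rfl]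
    have : ∀ D : Cfg, C.gates.foldl (fun D g => dualRailStep D (.inr g.raw)) D =
        D.emit (dualRails C) := by
      intro D
      rw [dualRails, Cfg.emit_seqs, List.foldl_map, List.foldl_map]
      rfl
    rw [this]
    refine (emit_entries rfl _ ?_ ?_).symm
    · rw [Register.encode_dual]
      simp only [Cfg.set, Cfg.init, List.append_nil]
      rw [Register.entries, List.flatMap_def, List.map_ofFn]
      rfl
    · simp [Cfg.set, Cfg.init, Register.entries]

/-- The description of the simulating exchange circuit is exact, so it serves for every precision.
-/
theorem postBQP_subset : PostBQP ⊆ PostXQPAngle (Real.pi / 4) := by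
  rintro L ⟨C, hC, ε, h0, h1, hL⟩
  choose f hf1 hf2 s hs hp hj using exists_dualRailCircuit
  have hs' : ∀ C, 0 < s C := fun C => lt_of_lt_of_le (by positivity) (hs C)
  have hcond : ∀ w v, (f (C w)).condProb (f (C w)).denote.final v =
      (C w).condProb (C w).final v := fun w v =>
    condProb_eq_of_scaled (hs' _) (hp _) (hj _) v
  refine ⟨fun w => (f (C w)).denote, ⟨fun w _ => (f (C w)).gates, fun w k => ?_, ?_⟩, ?_, ?_, ε, h0,
    h1, fun w => ⟨?_, ?_, ?_⟩⟩
  · exact List.forall₂_map_right_iff.mpr (List.forall₂_same.mpr fun g _ =>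
      ⟨rfl, rfl, by simp [ExchangeGate.denote]⟩)
  -- the machine ignores the required precision
  · exact computable_comp computable_fst (computable_comp hC (computable_dualRail hf1))
  · obtain ⟨p, hp'⟩ := exists_output_bound hC.some
    -- each gate costs `2 ^ (-56)` for its gadget and `1 / 2` for the Gaussian integers
    refine ⟨57 * p, fun w => ?_⟩
    have hlen : (C w).gates.length ≤ p.eval w.length := (length_gates_le _).trans (hp' w)
    have hpost : (f (C w)).denote.toRegister.postProb (f (C w)).denote.final =
      s (C w) * (C w).postProb (C w).final := hp _
    rw [hpost]
    calc (2 : ℝ)⁻¹ ^ (57 * p).eval w.length ≤ (2 : ℝ)⁻¹ ^ (57 * (C w).gates.length) := by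
          refine pow_le_pow_of_le_one (by norm_num) (by norm_num) ?_
          rw [Polynomial.eval_mul, Polynomial.eval_ofNat]
          exact Nat.mul_le_mul_left _ hlen
      _ = ((2 : ℝ)⁻¹ ^ 56) ^ (C w).gates.length * (2 : ℝ)⁻¹ ^ (C w).gates.length := by
          rw [← pow_mul, ← pow_add]
          congr 1
          ring
      _ ≤ _ := mul_le_mul (hs _) (half_pow_le_postProb _ (hL w).1) (by positivity) (hs' _).le
  · intro w g hg
    obtain ⟨g', hg', rfl⟩ := List.mem_map.mp hg
    exact hf2 _ _ hg'
  · exact (mul_pos (hs' _) (hL w).1).trans_eq (hp _).symm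
  · exact fun hw => ((hL w).2.1 hw).trans_eq (hcond w _).symm
  · exact fun hw => ((hL w).2.2 hw).trans_eq (hcond w _).symm

namespace Impl

variable {U : Set ℕ} {Ψ : Amp}

/-! ### Arithmetic on amplitudes -/

/-- For `u = 0` the Toffoli gate does nothing and the two Hadamard gates cancel. For `u = 1` the
postselection of the second ancilla removes the branch in which the first one is `1`. -/
theorem double {u : ℕ} (hu : u ∈ U) : Impl U (Gadget.double u) Ψ fun s =>
    (if s u then 1 / 2 else 1) * Ψ s := by
  intro b hb hΨ
  have hub := hb u hu
  refine ⟨fun g hg => ?_, ?_, ?_⟩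
  · simp only [Gadget.double, List.mem_cons, List.not_mem_nil, or_false] at hg
    rcases hg with rfl | rfl | rfl
    · simp [RawGate.wires, Gadget.double]
    · refine ⟨by simp [RawGate.wires, hub.ne, (hub.trans b.lt_succ_self).ne], fun q hq => ?_⟩
      rcases (by simpa [RawGate.wires] using hq : q = u ∨ q = b ∨ q = b + 1) with rfl | rfl | rfl
      · exact .inl hu
      · exact .inr (by simp [Gadget.double])
      · exact .inr (by simp [Gadget.double])
    · simp [RawGate.wires, Gadget.double]
  · funext s
    have h2 := invSqrtTwo_sq
    have hb1 : Ψ (Function.update s b true) = Ψ s := hΨ.update le_rfl _ _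
    have hb0 : Ψ (Function.update s b false) = Ψ s := hΨ.update le_rfl _ _
    have hbs : ∀ s v, Ψ (Function.update s (b + 1) v) = Ψ s := hΨ.update (Nat.le_succ b)
    cases hs : s u
    · simp [Gadget.double, proj, prep, runGates, RawGate.act, projWire, prepWire, hub.ne,
        (hub.trans b.lt_succ_self).ne, hΨ.update, hs]
      linear_combination 2 * Ψ s * h2
    · simp [Gadget.double, proj, prep, runGates, RawGate.act, projWire, prepWire, hub.ne,
        (hub.trans b.lt_succ_self).ne, hΨ.update, hs]
      linear_combination Ψ s * h2
  · intro x y e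
    simp only [e u hub, hΨ e]

/-- The branches in which the first ancilla is `1` are those with `u = 0` before, which the
controlled NOT gate adds to `u = 1`; the branch with `u = 1` is removed by the second ancilla. -/
theorem addUp {u : ℕ} (hu : u ∈ U) : Impl U (Gadget.addUp u) Ψ fun s =>
    1 / 2 * (Ψ s + if s u then Ψ (Function.update s u false) else 0) := by
  intro b hb hΨ
  have hub := hb u hu
  refine ⟨fun g hg => ?_, ?_, ?_⟩
  · simp only [Gadget.addUp, List.mem_cons, List.not_mem_nil, or_false] at hg
    rcases hg with rfl | rfl | rfl | rfl
    · simp [RawGate.wires, Gadget.addUp]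
    · refine ⟨by simp [RawGate.wires, hub.ne, (hub.trans b.lt_succ_self).ne], fun q hq => ?_⟩
      rcases (by simpa [RawGate.wires] using hq : q = u ∨ q = b ∨ q = b + 1) with rfl | rfl | rfl
      · exact .inl hu
      · exact .inr (by simp [Gadget.addUp])
      · exact .inr (by simp [Gadget.addUp])
    · refine ⟨by simp [RawGate.wires, hub.ne'], fun q hq => ?_⟩
      rcases (by simpa [RawGate.wires] using hq : q = b ∨ q = u) with rfl | rfl
      · exact .inr (by simp [Gadget.addUp])
      · exact .inl hu
    · simp [RawGate.wires, Gadget.addUp]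
  · funext s
    have h2 := invSqrtTwo_sq
    cases hs : s u
    · simp [Gadget.addUp, proj, prep, runGates, RawGate.act, projWire, prepWire, hub.ne, hub.ne',
        (hub.trans b.lt_succ_self).ne, (hub.trans b.lt_succ_self).ne', hΨ.update, hs]
      linear_combination Ψ s * h2
    · have h1 : ∀ s v w, Ψ (Function.update (Function.update s b w) u v) =
          Ψ (Function.update s u v) := fun s v w => by
        rw [Function.update_comm hub.ne', hΨ.update le_rfl]
      have h1' : ∀ s v w, Ψ (Function.update (Function.update s (b + 1) w) u v) =
          Ψ (Function.update s u v) := fun s v w => by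
        rw [Function.update_comm (hub.trans b.lt_succ_self).ne', hΨ.update (Nat.le_succ b)]
      simp [Gadget.addUp, proj, prep, runGates, RawGate.act, projWire, prepWire, hub.ne, hub.ne',
        (hub.trans b.lt_succ_self).ne, (hub.trans b.lt_succ_self).ne', hΨ.update, hs, h1, h1']
      linear_combination (Ψ s + Ψ (Function.update s u false)) * h2
  · intro x y e
    have h3 : Ψ (Function.update x u false) = Ψ (Function.update y u false) := by
      refine hΨ fun k hk => ?_
      by_cases h : k = u
      · subst h; simp
      · simp [h, e k hk]
    simp only [e u hub, hΨ e, h3]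

/-- The controlled exchange of `i` and `j`. -/
theorem act_fredkin {c i j : ℕ} (hci : c ≠ i) (hij : i ≠ j) (Φ : Amp) :
    RawGate.act (.cnot j i) (RawGate.act (.toff c i j) (RawGate.act (.cnot j i) Φ)) =
      fun s => if s c then Φ (s ∘ Equiv.swap i j) else Φ s := by
  funext s
  have hs : s ∘ Equiv.swap i j = Function.update (Function.update s i (s j)) j (s i) := by
    funext k
    by_cases h1 : k = j
    · subst h1; simp
    · by_cases h2 : k = i
      · subst h2; simp [hij]
      · simp [Equiv.swap_apply_of_ne_of_ne h2 h1, h1, h2]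
  have hu : ∀ (t : ℕ → Bool) (k : ℕ) (v : Bool), t k = v → Function.update t k v = t := by
    rintro t k _ rfl
    exact Function.update_eq_self k t
  rw [hs]
  simp only [RawGate.act]
  cases hc : s c <;> cases hi : s i <;> cases hj : s j <;>
    simp [hc, hi, hj, hci, hij, hij.symm, hu, Function.update_comm hij.symm]

/-! ### The exchange gadget -/

/-- The joint amplitude of the three ancillas `b` (the control `c`), `b + 1` (`v`) and `b + 2` (`u`)
of the exchange gadget and the other wires. For `c = 0` the wire `v` has the value `1`, and the
values `1` and `0` of `u` have the amplitudes `α`, `p`; for `c = 1` the wire `u` has the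
value `1`, and the values `1` and `0` of `v` have the amplitudes `i β` and `i q`. -/
noncomputable def ancState (b : ℕ) (Ψ : Amp) (K α p β q : ℂ) : Amp := fun s =>
  K * (if s b then if s (b + 2) then Complex.I * (if s (b + 1) then β else q) else 0
    else if s (b + 1) then (if s (b + 2) then α else p) else 0) * Ψ s

/-- The gadget `G b` changes the coefficients of the ancillas `b`, `b + 1`, `b + 2` as stated, up to
a common factor that does not depend on `b`. -/
def Transforms (U : Set ℕ) (Ψ : Amp) (G : ℕ → Gadget ℕ) (α p β q α' p' β' q' : ℂ) : Prop :=
  ∀ K, K ≠ 0 → ∃ K', K' ≠ 0 ∧ ∀ b, DependsBelow b Ψ →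
    Impl (U ∪ Set.Ico b (b + 3)) (G b) (ancState b Ψ K α p β q) (ancState b Ψ K' α' p' β' q')

variable {α p β q α' p' β' q' α'' p'' β'' q'' : ℂ}

theorem Transforms.congr {G : ℕ → Gadget ℕ} (h : Transforms U Ψ G α p β q α' p' β' q')
    (hα : α' = α'') (hp : p' = p'') (hβ : β' = β'') (hq : q' = q'') :
    Transforms U Ψ G α p β q α'' p'' β'' q'' := hα ▸ hp ▸ hβ ▸ hq ▸ h

theorem Transforms.seq {G H : ℕ → Gadget ℕ} (h : Transforms U Ψ G α p β q α' p' β' q')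
    (h' : Transforms U Ψ H α' p' β' q' α'' p'' β'' q'') :
    Transforms U Ψ (fun b => Gadget.seq (G b) (H b)) α p β q α'' p'' β'' q'' := by
  intro K hK
  obtain ⟨K', hK', i⟩ := h K hK
  obtain ⟨K'', hK'', i'⟩ := h' K' hK'
  exact ⟨K'', hK'', fun b hb => (i b hb).seq (i' b hb)⟩

theorem Transforms.append {l l' : ℕ → List (Gadget ℕ)}
    (h : Transforms U Ψ (fun b => Gadget.seqs (l b)) α p β q α' p' β' q')
    (h' : Transforms U Ψ (fun b => Gadget.seqs (l' b)) α' p' β' q' α'' p'' β'' q'') :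
    Transforms U Ψ (fun b => Gadget.seqs (l b ++ l' b)) α p β q α'' p'' β'' q'' := by
  intro K hK
  obtain ⟨K', hK', i⟩ := h K hK
  obtain ⟨K'', hK'', i'⟩ := h' K' hK'
  exact ⟨K'', hK'', fun b hb => (i b hb).seqs_append (i' b hb)⟩

theorem Transforms.nil : Transforms U Ψ (fun _ => Gadget.nil) α p β q α p β q :=
  fun K hK => ⟨K, hK, fun _ _ => Impl.nil⟩

theorem mem_anc (U : Set ℕ) (b : ℕ) {k : ℕ} (hk : k < 3) : b + k ∈ U ∪ Set.Ico b (b + 3) :=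
  .inr ⟨by omega, by omega⟩

theorem transforms_double_snd : Transforms U Ψ (fun b => Gadget.double (b + 2)) α p β q α (2 * p) β q := by
  refine fun K hK => ⟨K / 2, by simpa using hK, fun b hΨ => (double (mem_anc U b (by omega))).congr ?_⟩
  funext s
  simp only [ancState]
  cases s b <;> cases s (b + 1) <;> cases s (b + 2) <;>
    simp only [Bool.false_eq_true, if_false, if_true] <;> ring

theorem transforms_double_fst : Transforms U Ψ (fun b => Gadget.double (b + 1)) α p β q α p β (2 * q) := by
  refine fun K hK => ⟨K / 2, by simpa using hK, fun b hΨ => (double (mem_anc U b (by omega))).congr ?_⟩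
  funext s
  simp only [ancState]
  cases s b <;> cases s (b + 1) <;> cases s (b + 2) <;>
    simp only [Bool.false_eq_true, if_false, if_true] <;> ring

theorem transforms_addUp_snd :
    Transforms U Ψ (fun b => Gadget.addUp (b + 2)) α p β q (α + p) p β q := by
  refine fun K hK => ⟨K / 2, by simpa using hK, fun b hΨ => (addUp (mem_anc U b (by omega))).congr ?_⟩
  funext s
  simp only [ancState, hΨ.update (show b ≤ b + 2 by omega)]
  cases h0 : s b <;> cases h1 : s (b + 1) <;> cases h2 : s (b + 2) <;>
    simp [h0, h1] <;> ring

theorem transforms_addUp_fst :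
    Transforms U Ψ (fun b => Gadget.addUp (b + 1)) α p β q α p (β + q) q := by
  refine fun K hK => ⟨K / 2, by simpa using hK, fun b hΨ => (addUp (mem_anc U b (by omega))).congr ?_⟩
  funext s
  simp only [ancState, hΨ.update (show b ≤ b + 1 by omega)]
  cases h0 : s b <;> cases h1 : s (b + 1) <;> cases h2 : s (b + 2) <;>
    simp [h0, h2] <;> ring

theorem transforms_digit_snd (d : Bool) :
    Transforms U Ψ (fun b => Gadget.digit (b + 2) d) α p β q (α + d.toNat * p) (2 * p) β q := by
  cases d
  · exact transforms_double_snd.congr (by simp) rfl rfl rfl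
  · exact transforms_addUp_snd.seq (transforms_double_snd.congr (by simp) rfl rfl rfl)

theorem transforms_digit_fst (d : Bool) :
    Transforms U Ψ (fun b => Gadget.digit (b + 1) d) α p β q α p (β + d.toNat * q) (2 * q) := by
  cases d
  · exact transforms_double_fst.congr rfl rfl (by simp) rfl
  · exact transforms_addUp_fst.seq (transforms_double_fst.congr rfl rfl (by simp) rfl)

theorem transforms_signFlip : Transforms U Ψ Gadget.signFlip α p β q α p (-β) (-q) := by
  refine fun K hK => ⟨K, hK, fun b hΨ => ?_⟩
  have hb : ∀ k ∈ (RawGate.phase b).wires, k ∈ U ∪ Set.Ico b (b + 3) := by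
    simp [RawGate.wires]
  refine (seqs_cons (gate (by simp [RawGate.wires]) hb) (seqs_cons
    (gate (by simp [RawGate.wires]) hb) nil)).congr ?_
  funext s
  have hI := Complex.I_mul_I
  simp only [ancState, RawGate.act]
  cases s b <;> cases s (b + 1) <;> cases s (b + 2) <;> simp
  · linear_combination K * Complex.I * q * Ψ s * hI
  · linear_combination K * Complex.I * β * Ψ s * hI

/-- The number with the given binary digits, the least significant one first. -/
def ofDigits (ds : List Bool) : ℕ := ds.foldr (fun d n => d.toNat + 2 * n) 0

theorem ofDigits_encodeNat (n : ℕ) : ofDigits (Computability.encodeNat n) = n := by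
  have h : ∀ m : PosNum, ofDigits (Computability.encodePosNum m) = m := by
    intro m
    induction m with
    | one => rfl
    | bit0 m ih =>
      rw [PosNum.cast_bit0, ← ih]
      simp [Computability.encodePosNum, ofDigits]
      ring
    | bit1 m ih =>
      rw [PosNum.cast_bit1, ← ih]
      simp [Computability.encodePosNum, ofDigits]
      ring
  have h' : ∀ m : Num, ofDigits (Computability.encodeNum m) = m := by
    intro m
    cases m with
    | zero => rfl
    | pos m => exact h m
  rw [Computability.encodeNat, h', Num.to_of_nat]

theorem transforms_digits_snd (ds : List Bool) :
    Transforms U Ψ (fun b => Gadget.seqs (ds.map (Gadget.digit (b + 2)))) α p β q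
      (α + ofDigits ds * p) (2 ^ ds.length * p) β q := by
  induction ds generalizing α p with
  | nil => exact Transforms.nil.congr (by simp [ofDigits]) (by simp) rfl rfl
  | cons d ds ih =>
    refine ((transforms_digit_snd d).seq ih).congr ?_ ?_ rfl rfl
    · simp only [ofDigits, List.foldr_cons]
      push_cast
      ring
    · rw [List.length_cons]
      ring

theorem transforms_digits_fst (ds : List Bool) :
    Transforms U Ψ (fun b => Gadget.seqs (ds.map (Gadget.digit (b + 1)))) α p β q
      α p (β + ofDigits ds * q) (2 ^ ds.length * q) := by
  induction ds generalizing β q with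
  | nil => exact Transforms.nil.congr rfl rfl (by simp [ofDigits]) (by simp)
  | cons d ds ih =>
    refine ((transforms_digit_fst d).seq ih).congr rfl rfl ?_ ?_
    · simp only [ofDigits, List.foldr_cons]
      push_cast
      ring
    · rw [List.length_cons]
      ring

/-- The sign of an integer; the sign of `0` is `1`. -/
def sgn (z : ℤ) : ℂ := if z < 0 then -1 else 1

theorem sgn_mul_natAbs (z : ℤ) : sgn z * (z.natAbs : ℂ) = z := by
  have h : ((z.natAbs : ℤ) : ℂ) = (z.natAbs : ℂ) := Int.cast_natCast _
  rw [← h, sgn]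
  split_ifs with hz
  · rw [Int.ofNat_natAbs_of_nonpos hz.le]
    push_cast
    ring
  · rw [Int.natAbs_of_nonneg (by omega), one_mul]

theorem sgn_mul_self (z : ℤ) : sgn z * sgn z = 1 := by
  rw [sgn]; split_ifs <;> norm_num

theorem transforms_sign (z : ℤ) : Transforms U Ψ
    (fun b => Gadget.seqs (if z < 0 then [Gadget.signFlip b] else [])) α p β q α p (sgn z * β)
      (sgn z * q) := by
  rw [sgn]
  split_ifs
  · exact (transforms_signFlip.seq Transforms.nil).congr rfl rfl (by ring) (by ring)
  · exact Transforms.nil.congr rfl rfl (by ring) (by ring)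

/-- The sign of the first integer is applied to the other branch, which changes the pair of
coefficients only by a common sign. -/
theorem transforms_integer_snd (z : ℤ) : ∃ n : ℕ, Transforms U Ψ
    (fun b => Gadget.seqs (Gadget.integer b (b + 2) z)) α p β q (α + z.natAbs * p) (2 ^ n * p)
      (sgn z * β) (sgn z * q) :=
  ⟨_, (transforms_sign z).append ((transforms_digits_snd _).congr
    (by rw [ofDigits_encodeNat]) rfl rfl rfl)⟩

theorem transforms_integer_fst (z : ℤ) : ∃ q', Transforms U Ψ
    (fun b => Gadget.seqs (Gadget.integer b (b + 1) z)) α p β q α p (sgn z * β + z.natAbs * (sgn z * q))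
      q' :=
  ⟨_, (transforms_sign z).append ((transforms_digits_fst _).congr rfl rfl
    (by rw [ofDigits_encodeNat]) rfl)⟩

/-- The pair of integers that determines the operator: `(0, 0)` counts as `(1, 0)`. -/
def effective (a b : ℤ) : ℤ × ℤ := if a = 0 ∧ b = 0 then (1, 0) else (a, b)

/-- The coefficients of `1` and `i E_ij` are multiples of the two integers. -/
theorem transforms_integers (x y : ℤ) :
    ∃ r : ℂ, r ≠ 0 ∧ ∃ p' q', Transforms U Ψ (fun b => Gadget.seqs (Gadget.integer b (b + 2) x ++
      Gadget.integer b (b + 1) y ++ if x = 0 ∧ y = 0 then [Gadget.digit (b + 2) true] else []))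
      0 1 0 1 (r * (effective x y).1) p' (r * (effective x y).2) q' := by
  obtain ⟨n, h1⟩ := transforms_integer_snd (U := U) (Ψ := Ψ) (α := 0) (p := 1) (β := 0) (q := 1) x
  obtain ⟨q', h2⟩ := transforms_integer_fst (U := U) (Ψ := Ψ) (α := 0 + x.natAbs * 1) (p := 2 ^ n * 1)
    (β := sgn x * 0) (q := sgn x * 1) y
  by_cases h : x = 0 ∧ y = 0
  · obtain ⟨rfl, rfl⟩ := h
    exact ⟨2 ^ n, by simp, _, _, (h1.append h2).append (((transforms_digit_snd true).seq
      Transforms.nil).congr (by simp [effective]) rfl (by simp [effective]) rfl)⟩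
  · simp only [if_neg h, List.append_nil]
    refine ⟨sgn x, fun h0 => by simpa [h0] using sgn_mul_self x, _, _,
      (h1.append h2).congr ?_ rfl ?_ rfl⟩
    · rw [effective, if_neg h]
      linear_combination sgn x * sgn_mul_natAbs x - (x.natAbs : ℂ) * sgn_mul_self x
    · rw [effective, if_neg h]
      linear_combination sgn x * sgn_mul_natAbs y

/-- The ancillas of the exchange gadget start in a superposition of `c = 0` (with `v = 1`, `u = 0`)
and `c = 1` (with `v = 0`, `u = 1`), the latter with the factor `i`. -/
theorem start {b : ℕ} (hΨ : DependsBelow b Ψ) : Impl (U ∪ Set.Ico b (b + 3))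
    (Gadget.seqs (Gadget.start b (b + 1) (b + 2))) (prep b [false, true, true] Ψ)
    (ancState b Ψ invSqrtTwo 0 1 0 1) := by
  have h0 : b ∈ U ∪ Set.Ico b (b + 3) := mem_anc U b (k := 0) (by omega)
  have h1 := mem_anc U b (k := 1) (by omega)
  have h2 := mem_anc U b (k := 2) (by omega)
  refine (seqs_cons (gate (by simp [RawGate.wires]) (by simp [RawGate.wires]))
    (seqs_cons (gate (by simp [RawGate.wires]) (by simp [RawGate.wires]))
    (seqs_cons (gate (by simp [RawGate.wires]) (by simp [RawGate.wires]))
    (seqs_cons (gate (by simp [RawGate.wires]) (by simp [RawGate.wires]))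
    nil)))).congr ?_
  funext s
  simp only [ancState, RawGate.act, prep, prepWire, Nat.add_assoc, Nat.reduceAdd]
  cases e0 : s b <;> cases e1 : s (b + 1) <;> cases e2 : s (b + 2) <;>
    (simp [e0, e1, e2, hΨ.update]; try ring)

/-- Only the amplitudes `α` and `i β`, for which `u = v = 1`, survive the postselection. The
exchange is applied in the branch `c = 1`, and the two branches are added up by the postselection of
`c` after a Hadamard gate. -/
theorem finish {b i j : ℕ} (hi : i ∈ U) (hj : j ∈ U) (hij : i ≠ j) (hib : i < b) (hjb : j < b)
    (hΨ : DependsBelow b Ψ) (K : ℂ) : ∃ Φ, Impl (U ∪ Set.Ico b (b + 3))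
      (Gadget.seqs (Gadget.finish b i j)) (ancState b Ψ K α p β q) Φ ∧
      proj b [false, true, true] Φ = fun s => K * invSqrtTwo * (α * Ψ s +
        Complex.I * β * Ψ (s ∘ Equiv.swap i j)) := by
  have h0 : b ∈ U ∪ Set.Ico b (b + 3) := mem_anc U b (k := 0) (by omega)
  have hi' : i ∈ U ∪ Set.Ico b (b + 3) := .inl hi
  have hj' : j ∈ U ∪ Set.Ico b (b + 3) := .inl hj
  have hw : ∀ g ∈ [RawGate.cnot j i, .toff b i j, .cnot j i, .had b],
      g.wires.Nodup ∧ ∀ q ∈ g.wires, q ∈ U ∪ Set.Ico b (b + 3) := by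
    have := hib.ne'
    have := hjb.ne'
    simp_all [RawGate.wires, hij.symm]
  simp only [List.forall_mem_cons] at hw
  obtain ⟨⟨w1, w1'⟩, ⟨w2, w2'⟩, -, ⟨w3, w3'⟩, -⟩ := hw
  refine ⟨_, seqs_cons (gate w1 w1') (seqs_cons (gate w2 w2') (seqs_cons (gate w1 w1')
    (seqs_cons (gate w3 w3') nil))), ?_⟩
  rw [act_fredkin hib.ne' hij]
  funext s
  have e : ∀ k : ℕ, b ≤ k → Equiv.swap i j k = k := fun k hk =>
    Equiv.swap_apply_of_ne_of_ne (by omega) (by omega)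
  have e1 := e (b + 1) (by omega)
  have e2 := e (b + 2) (by omega)
  have e0 := e b le_rfl
  have c0 := fun s v => update_comp_swap hib.ne' hjb.ne' s v
  have c1 := fun s v => update_comp_swap (show b + 1 ≠ i by omega) (show b + 1 ≠ j by omega) s v
  have c2 := fun s v => update_comp_swap (show b + 2 ≠ i by omega) (show b + 2 ≠ j by omega) s v
  simp [proj, projWire, RawGate.act, ancState, hΨ.update, e0, e1, e2, c0, c1, c2, Nat.add_assoc]
  ring

/-- The exchange gadget implements a nonzero multiple of `x + y i E_ij`. No approximation is
involved. -/
theorem exchange {i j : ℕ} (hi : i ∈ U) (hj : j ∈ U) (hij : i ≠ j) (x y : ℤ) : ∃ K : ℂ, K ≠ 0 ∧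
    Impl U (Gadget.exchange i j x y) Ψ fun s => K * ((effective x y).1 * Ψ s +
      Complex.I * (effective x y).2 * Ψ (s ∘ Equiv.swap i j)) := by
  obtain ⟨r, hr, p', q', h⟩ := transforms_integers (U := U) (Ψ := Ψ) x y
  obtain ⟨K, hK, hK'⟩ := h invSqrtTwo invSqrtTwo_ne_zero
  refine ⟨K * invSqrtTwo * r, by simp [hK, hr, invSqrtTwo_ne_zero], wrap fun b hb hΨ => ?_⟩
  obtain ⟨Φ, hΦ, e⟩ := finish (α := r * (effective x y).1) (p := p') (β := r * (effective x y).2)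
    (q := q') hi hj hij (hb i hi) (hb j hj) hΨ K
  refine ⟨Φ, ?_, e.trans ?_⟩
  · have := ((start hΨ).seqs_append (hK' b hΨ)).seqs_append hΦ
    simp only [← List.append_assoc] at this
    exact this
  · funext s
    ring

end Impl

/-! ### From exchange circuits to general circuits -/

/-- All gates of the gadget belong to the universal set. -/
abbrev Gadget.AllUniversal (G : Gadget ℕ) : Prop := G.All RawGate.IsUniversal

namespace Gadget.AllUniversal

theorem gate {g : RawGate ℕ} (hg : g.IsUniversal) : (Gadget.gate g).AllUniversal := fun a h hh => by
  rwa [List.mem_singleton.mp hh]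

theorem digit (u : ℕ) (d : Bool) : (Gadget.digit u d).AllUniversal := by
  intro a h hh
  cases d
  · simp only [Gadget.digit, Gadget.double, Bool.false_eq_true, if_false, List.mem_cons,
      List.not_mem_nil, or_false] at hh
    rcases hh with rfl | rfl | rfl <;> trivial
  · simp only [Gadget.digit, Gadget.double, Gadget.addUp, Gadget.seq, if_true, List.mem_append,
      List.mem_cons, List.not_mem_nil, or_false] at hh
    rcases hh with (rfl | rfl | rfl | rfl) | rfl | rfl | rfl <;> trivial

theorem integer (c u : ℕ) (z : ℤ) : ∀ G ∈ Gadget.integer c u z, G.AllUniversal := by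
  intro G hG
  rcases List.mem_append.mp hG with hG | hG
  · split_ifs at hG
    · rw [List.mem_singleton.mp hG]
      exact All.seqs (by simpa using gate (g := .phase c) trivial)
    · simp at hG
  · obtain ⟨d, -, rfl⟩ := List.mem_map.mp hG
    exact digit u d

theorem exchange (i j : ℕ) (a b : ℤ) : (Gadget.exchange i j a b).AllUniversal := by
  refine All.wrap fun p => All.seqs fun G hG => ?_
  simp only [List.mem_append] at hG
  rcases hG with (((hG | hG) | hG) | hG) | hG
  · simp only [Gadget.start, List.mem_cons, List.not_mem_nil, or_false] at hG
    rcases hG with rfl | rfl | rfl | rfl <;> exact gate trivial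
  · exact integer _ _ _ G hG
  · exact integer _ _ _ G hG
  · split_ifs at hG
    · rw [List.mem_singleton.mp hG]
      exact digit _ _
    · simp at hG
  · simp only [Gadget.finish, List.mem_cons, List.not_mem_nil, or_false] at hG
    rcases hG with rfl | rfl | rfl | rfl <;> exact gate trivial

end Gadget.AllUniversal

/-- A gadget made of gates of the universal set gives a general circuit on the register `R` with
ancillas, with the probabilities of the final state `Ψ` on the register `R`. -/
theorem exists_qCircuit (R : Register) {G : Gadget ℕ} {Ψ : Amp}
    (hG : Impl (Set.Iio R.n) G (lift (ket R.input)) Ψ) (hu : G.AllUniversal) :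
    ∃ C : QCircuit, C.encode QGate.encode = R.encode ++ ancCode (G fun k => R.n + k).2 ++
        (G fun k => R.n + k).1.flatMap RawGate.code ∧
      C.postProb C.final = R.postProb (toState R.n Ψ) ∧
      ∀ v, C.jointProb C.final v = R.jointProb (toState R.n Ψ) v := by
  obtain ⟨h1, h2, -⟩ := hG R.n (fun q hq => hq) (dependsBelow_lift _)
  obtain ⟨l, e⟩ := exists_qGates (n := R.n + (G fun k => R.n + k).2.length)
    (G fun k => R.n + k).1 fun g hg => ⟨hu _ g hg, (h1 g hg).1, fun q hq => by
      rcases (h1 g hg).2 q hq with h | h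
      · have : q < R.n := h
        omega
      · exact h.2⟩
  have hf : toState R.n (proj R.n (G fun k => R.n + k).2 (lift (QCircuit.final
      ⟨R.extend (G fun k => R.n + k).2, l⟩))) = toState R.n Ψ := by
    rw [← h2, ← lift_ket_extend]
    refine congrArg (fun Φ => toState R.n (proj R.n (G fun k => R.n + k).2 Φ))
      ((lift_final_q l _).trans ?_)
    rw [e]
    rfl
  refine ⟨⟨R.extend (G fun k => R.n + k).2, l⟩, ?_, ?_, fun v => ?_⟩
  · rw [Circuit.encode, Register.encode_extend]
    refine congrArg _ (Eq.trans ?_ (congrArg (List.flatMap RawGate.code) e))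
    rw [List.flatMap_map]
    exact congrArg (fun f => List.flatMap f l) (funext QGate.encode_eq)
  · exact (Register.postProb_extend R _ _).trans (congrArg R.postProb hf)
  · exact (Register.jointProb_extend R _ _ v).trans (congrArg (R.jointProb · v) hf)

/-- The pair of integers, up to a factor, is the pair of the cosine and the sine of the angle that
it denotes. -/
theorem exists_effective (a b : ℤ) : ∃ r : ℂ, r ≠ 0 ∧
    ((Impl.effective a b).1 : ℂ) = r * Real.cos (denotedAngle (a, b)) ∧
    ((Impl.effective a b).2 : ℂ) = r * Real.sin (denotedAngle (a, b)) := by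
  by_cases h : a = 0 ∧ b = 0
  · obtain ⟨rfl, rfl⟩ := h
    exact ⟨1, one_ne_zero, by simp [Impl.effective, denotedAngle], by simp [Impl.effective, denotedAngle]⟩
  · obtain ⟨z, hz⟩ : ∃ z : ℂ, z = (a : ℂ) + (b : ℂ) * Complex.I := ⟨_, rfl⟩
    have hre : z.re = a := by simp [hz]
    have him : z.im = b := by simp [hz]
    have hz0 : z ≠ 0 := fun h0 => h (by
      rw [h0] at hre him
      exact ⟨by exact_mod_cast hre.symm, by exact_mod_cast him.symm⟩)
    have hn : (‖z‖ : ℂ) ≠ 0 := by simpa using hz0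
    have hd : denotedAngle (a, b) = z.arg := by rw [hz]; rfl
    refine ⟨‖z‖, hn, ?_, ?_⟩
    · rw [hd, Complex.cos_arg hz0, hre, Impl.effective, if_neg h]
      push_cast
      field_simp
    · rw [hd, Complex.sin_arg, him, Impl.effective, if_neg h]
      push_cast
      field_simp

/-- The gadget for a gate of a description. -/
def exchangeGadget {n : ℕ} (g : ExchangeGate (ℤ × ℤ) n) : Gadget ℕ :=
  Gadget.exchange g.i g.j g.angle.1 g.angle.2

/-- The exchange gadget acts as the gate denoted by the description, up to a nonzero constant. No
bound on the constant is needed, since `PostBQP` only requires a positive success probability. -/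
theorem exists_impl_exchange {n : ℕ} (g : ExchangeGate (ℤ × ℤ) n) (c : ℂ) (ψ : State n) :
    ∃ K : ℂ, K ≠ 0 ∧ Impl (Set.Iio n) (exchangeGadget g) (c • lift ψ)
      ((K * c) • lift (g.denote.apply ψ)) := by
  obtain ⟨K, hK, h⟩ := Impl.exchange (U := Set.Iio n) (Ψ := c • lift ψ) (i := g.i) (j := g.j)
    g.i.2 g.j.2 (by simpa [Fin.val_inj] using g.ne) g.angle.1 g.angle.2
  obtain ⟨r, hr, h1, h2⟩ := exists_effective g.angle.1 g.angle.2
  refine ⟨K * r, mul_ne_zero hK hr, h.congr ?_⟩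
  funext s
  simp only [h1, h2, Pi.smul_apply, smul_eq_mul, lift, ExchangeGate.apply, ExchangeGate.denote,
    swap]
  rw [restrict_swap s g.i g.j]
  ring

theorem exists_impl_exchanges {n : ℕ} (gs : List (ExchangeGate (ℤ × ℤ) n)) (c : ℂ) (ψ : State n) :
    ∃ K : ℂ, K ≠ 0 ∧ Impl (Set.Iio n) (Gadget.seqs (gs.map exchangeGadget)) (c • lift ψ)
      ((K * c) • lift ((gs.map ExchangeGate.denote).foldl (fun ψ g => g.apply ψ) ψ)) := by
  induction gs generalizing c ψ with
  | nil => exact ⟨1, one_ne_zero, Impl.nil.congr (by rw [one_mul]; rfl)⟩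
  | cons g gs ih =>
    obtain ⟨K, hK, h⟩ := exists_impl_exchange g c ψ
    obtain ⟨K', hK', h'⟩ := ih (K * c) (g.denote.apply ψ)
    exact ⟨K' * K, mul_ne_zero hK' hK, (Impl.seqs_cons h h').congr (by rw [mul_assoc]; rfl)⟩

/-- The gadget for a description of an exchange circuit. -/
def exchangeGadgets (C : Circuit (ExchangeGate (ℤ × ℤ))) : Gadget ℕ :=
  Gadget.seqs (C.gates.map exchangeGadget)

/-- The general circuit that simulates an exchange circuit with denoted angles: its description is
what the compiler puts out, and its probabilities are those of the exchange circuit up to a common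
factor `s`. -/
theorem exists_generalCircuit (C : Circuit (ExchangeGate (ℤ × ℤ))) : ∃ C' : QCircuit,
    C'.encode QGate.encode = C.toRegister.encode ++
      ancCode (exchangeGadgets C fun k => C.n + k).2 ++
      (exchangeGadgets C fun k => C.n + k).1.flatMap RawGate.code ∧
    ∃ s : ℝ, 0 < s ∧ C'.postProb C'.final = s * C.postProb C.denote.final ∧
      ∀ v, C'.jointProb C'.final v = s * C.jointProb C.denote.final v := by
  obtain ⟨K, hK, hG⟩ := exists_impl_exchanges C.gates 1 (ket C.input)
  rw [one_smul, mul_one] at hG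
  obtain ⟨C', e1, e2, e3⟩ := exists_qCircuit C.toRegister hG (Gadget.All.seqs
    (List.forall_mem_map.mpr fun _ _ => Gadget.AllUniversal.exchange _ _ _ _))
  have hs : toState C.n (K • lift C.denote.final) = K • C.denote.final :=
    (rfl : _ = K • toState C.n (lift C.denote.final)).trans (congrArg _ (toState_lift _))
  refine ⟨C', e1, ‖K‖ ^ 2, by positivity, e2.trans ((congrArg _ hs).trans ?_), fun v =>
    (e3 v).trans ((congrArg (C.toRegister.jointProb · v) hs).trans ?_)⟩
  · exact Register.postProb_smul _ _ _
  · exact Register.jointProb_smul _ _ _ _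

/-- The items of the description of an exchange circuit. -/
def exchangeItems (C : Circuit (ExchangeGate (ℤ × ℤ))) : List ExchangeItem :=
  C.entries.map Sum.inl ++ C.gates.map fun g => Sum.inr (g.i.val, g.j.val, g.angle.1, g.angle.2)

theorem encode_eq_exchangeItems (C : Circuit (ExchangeGate (ℤ × ℤ))) :
    C.encode encodeExchangeGate = (exchangeItems C).flatMap ExchangeItem.code := by
  rw [exchangeItems, List.flatMap_append, Circuit.encode, Register.encode_eq]
  congr 1
  · rw [Register.entries, List.flatMap_def, List.map_map, List.map_ofFn]
    rfl
  · rw [List.flatMap_map]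
    rfl

theorem computable_exchange {f : Circuit (ExchangeGate (ℤ × ℤ)) → QCircuit}
    (hf : ∀ C, (f C).encode QGate.encode = C.toRegister.encode ++
      ancCode (exchangeGadgets C fun k => C.n + k).2 ++
      (exchangeGadgets C fun k => C.n + k).1.flatMap RawGate.code) :
    Nonempty (TM2ComputableInPolyTime (Circuit.encode encodeExchangeGate)
      (Circuit.encode QGate.encode) f) := by
  obtain ⟨c, hc⟩ := handles_exchangeItem
  refine computable_of_handles exchangeItems rfl (fun C x _ => hc x) encode_eq_exchangeItems
    fun C => ?_
  rw [hf, exchangeItems, List.foldl_append, List.foldl_map, List.foldl_map, foldl_entries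
    (step := fun D x => exchangeStep D (.inl x)) (m := 1)
    (E := fun x : Bool × Symbol => [Symbol.bit x.1, x.2]) fun _ _ => rfl]
  have : ∀ D : Cfg, C.gates.foldl (fun D g =>
      exchangeStep D (.inr (g.i.val, g.j.val, g.angle.1, g.angle.2))) D = D.emit (exchangeGadgets C) := by
    intro D
    rw [exchangeGadgets, Cfg.emit_seqs, List.foldl_map]
    rfl
  rw [this]
  refine (emit_entries rfl _ ?_ ?_).symm
  · rw [Register.encode_eq]
    simp only [Cfg.set, Cfg.init, List.append_nil]
    rw [Register.entries, List.flatMap_def, List.map_ofFn]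
    rfl
  · simp [Cfg.set, Cfg.init, Register.entries]

/-! ### Approximate angles -/

theorem abs_cos_sub_cos_le (x y : ℝ) :
    |Real.cos x - Real.cos y| ≤ ‖Complex.exp (x * Complex.I) - Complex.exp (y * Complex.I)‖ ∧
    |Real.sin x - Real.sin y| ≤ ‖Complex.exp (x * Complex.I) - Complex.exp (y * Complex.I)‖ := by
  have h1 := Complex.abs_re_le_norm (Complex.exp (x * Complex.I) - Complex.exp (y * Complex.I))
  have h2 := Complex.abs_im_le_norm (Complex.exp (x * Complex.I) - Complex.exp (y * Complex.I))
  rw [Complex.sub_re, Complex.exp_ofReal_mul_I_re, Complex.exp_ofReal_mul_I_re] at h1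
  rw [Complex.sub_im, Complex.exp_ofReal_mul_I_im, Complex.exp_ofReal_mul_I_im] at h2
  exact ⟨h1, h2⟩

theorem norm_lin_comb_le {c s : ℝ} {t M : ℝ} (hc : |c| ≤ t) (hs : |s| ≤ t) {u v : ℂ} (hu : ‖u‖ ≤ M)
    (hv : ‖v‖ ≤ M) : ‖(c : ℂ) * u + Complex.I * (s : ℂ) * v‖ ≤ 2 * (t * M) := by
  have ht : 0 ≤ t := (abs_nonneg c).trans hc
  refine (norm_add_le _ _).trans ?_
  rw [norm_mul, norm_mul, norm_mul, Complex.norm_I, one_mul, Complex.norm_real, Complex.norm_real]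
  have h1 : |c| * ‖u‖ ≤ t * M := mul_le_mul hc hu (norm_nonneg _) ht
  have h2 : |s| * ‖v‖ ≤ t * M := mul_le_mul hs hv (norm_nonneg _) ht
  simp only [Real.norm_eq_abs]
  linarith

theorem norm_apply_le {n : ℕ} (g : ExchangeGate ℝ n) {ψ : State n} {M : ℝ} (h : ∀ x, ‖ψ x‖ ≤ M)
    (x : Fin n → Bool) : ‖g.apply ψ x‖ ≤ 2 * M := by
  have := norm_lin_comb_le (Real.abs_cos_le_one g.angle) (Real.abs_sin_le_one g.angle) (h x)
    (h (x ∘ Equiv.swap g.i g.j))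
  rwa [one_mul] at this

theorem norm_apply_sub_le {n : ℕ} {d : ExchangeGate (ℤ × ℤ) n} {g : ExchangeGate ℝ n} {δ : ℝ}
    (hd : GateApprox δ d g) {φ ψ : State n} {e M : ℝ} (he : ∀ x, ‖φ x - ψ x‖ ≤ e)
    (hM : ∀ x, ‖ψ x‖ ≤ M) (x : Fin n → Bool) :
    ‖d.denote.apply φ x - g.apply ψ x‖ ≤ 2 * e + 2 * (δ * M) := by
  obtain ⟨hi, hj, hδ⟩ := hd
  obtain ⟨hc, hs⟩ := abs_cos_sub_cos_le (denotedAngle d.angle) g.angle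
  have h1 := norm_lin_comb_le (Real.abs_cos_le_one (denotedAngle d.angle))
    (Real.abs_sin_le_one (denotedAngle d.angle)) (he x) (he (x ∘ Equiv.swap g.i g.j))
  have h2 := norm_lin_comb_le (hc.trans hδ) (hs.trans hδ) (hM x) (hM (x ∘ Equiv.swap g.i g.j))
  rw [one_mul] at h1
  refine le_trans (le_of_eq (congrArg norm ?_)) ((norm_add_le _ _).trans (add_le_add h1 h2))
  simp only [ExchangeGate.apply, ExchangeGate.denote, swap, hi, hj]
  push_cast
  ring

/-- The sup norm and the sup distance at most double with every gate, apart from the errors of the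
angles. -/
theorem norm_foldl_sub_le {n : ℕ} {ds : List (ExchangeGate (ℤ × ℤ) n)}
    {gs : List (ExchangeGate ℝ n)} {δ : ℝ} (h : List.Forall₂ (GateApprox δ) ds gs) {φ ψ : State n}
    {e M : ℝ} (he : ∀ x, ‖φ x - ψ x‖ ≤ e) (hM : ∀ x, ‖ψ x‖ ≤ M) (x : Fin n → Bool) :
    ‖(ds.map ExchangeGate.denote).foldl (fun ψ g => g.apply ψ) φ x -
      gs.foldl (fun ψ g => g.apply ψ) ψ x‖ ≤ 2 ^ gs.length * (e + gs.length * (δ * M)) ∧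
    ‖gs.foldl (fun ψ g => g.apply ψ) ψ x‖ ≤ 2 ^ gs.length * M := by
  induction h generalizing φ ψ e M with
  | nil => simpa using ⟨he x, hM x⟩
  | cons hd _ ih =>
    obtain ⟨h1, h2⟩ := ih (norm_apply_sub_le hd he hM) (norm_apply_le _ hM)
    refine ⟨h1.trans (le_of_eq ?_), h2.trans (le_of_eq ?_)⟩
    · rw [List.length_cons]
      push_cast
      ring
    · rw [List.length_cons]
      ring

theorem abs_norm_sq_sub_le {u v : ℂ} {e M : ℝ} (h : ‖u - v‖ ≤ e) (hv : ‖v‖ ≤ M) :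
    |‖u‖ ^ 2 - ‖v‖ ^ 2| ≤ e * (2 * M + e) := by
  have h1 : |‖u‖ - ‖v‖| ≤ e := (abs_norm_sub_norm_le u v).trans h
  have h2 : ‖u‖ ≤ M + e := by linarith [abs_le.mp h1]
  have h3 : ‖u‖ ^ 2 - ‖v‖ ^ 2 = (‖u‖ - ‖v‖) * (‖u‖ + ‖v‖) := by ring
  rw [h3, abs_mul, abs_of_nonneg (by positivity : 0 ≤ ‖u‖ + ‖v‖)]
  exact mul_le_mul h1 (by linarith) (by positivity) ((abs_nonneg _).trans h1)

theorem abs_sum_norm_sq_sub_le {n : ℕ} (S : Finset (Fin n → Bool)) {φ ψ : State n} {e M : ℝ}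
    (h : ∀ x, ‖φ x - ψ x‖ ≤ e) (hM : ∀ x, ‖ψ x‖ ≤ M) :
    |∑ x ∈ S, ‖φ x‖ ^ 2 - ∑ x ∈ S, ‖ψ x‖ ^ 2| ≤ 2 ^ n * (e * (2 * M + e)) := by
  have h0 : 0 ≤ e * (2 * M + e) := (abs_nonneg _).trans
    (abs_norm_sq_sub_le (h fun _ => false) (hM fun _ => false))
  rw [← Finset.sum_sub_distrib]
  refine (Finset.abs_sum_le_sum_abs _ _).trans
    ((Finset.sum_le_sum fun x _ => abs_norm_sq_sub_le (h x) (hM x)).trans ?_)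
  rw [Finset.sum_const, nsmul_eq_mul]
  refine mul_le_mul_of_nonneg_right ?_ h0
  have : S.card ≤ 2 ^ n := (Finset.card_le_univ S).trans (by simp)
  exact_mod_cast this

theorem Register.abs_postProb_sub_le (R : Register) {φ ψ : State R.n} {e M : ℝ}
    (h : ∀ x, ‖φ x - ψ x‖ ≤ e) (hM : ∀ x, ‖ψ x‖ ≤ M) :
    |R.postProb φ - R.postProb ψ| ≤ 2 ^ R.n * (e * (2 * M + e)) :=
  abs_sum_norm_sq_sub_le _ h hM

theorem Register.abs_jointProb_sub_le (R : Register) {φ ψ : State R.n} {e M : ℝ}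
    (h : ∀ x, ‖φ x - ψ x‖ ≤ e) (hM : ∀ x, ‖ψ x‖ ≤ M) (v : Bool) :
    |R.jointProb φ v - R.jointProb ψ v| ≤ 2 ^ R.n * (e * (2 * M + e)) :=
  abs_sum_norm_sq_sub_le _ h hM

/-- Robustness of the conditional probabilities: errors that are small compared to the success
probability increase the error tolerance only a little. -/
theorem le_condProb_of_close {R : Register} {φ ψ : State R.n} {η ε ε' : ℝ} {v : Bool}
    (hp : |R.postProb φ - R.postProb ψ| ≤ η) (hj : |R.jointProb φ v - R.jointProb ψ v| ≤ η)
    (hε : 0 < ε) (hε' : ε < ε') (hε₁ : ε' < 1) (hpos : 0 < R.postProb ψ)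
    (hη : 2 * η ≤ (ε' - ε) * R.postProb ψ) (h : 1 - ε ≤ R.condProb ψ v) :
    0 < R.postProb φ ∧ 1 - ε' ≤ R.condProb φ v := by
  obtain ⟨hp1, hp2⟩ := abs_le.mp hp
  obtain ⟨hj1, hj2⟩ := abs_le.mp hj
  have hη0 : 0 ≤ η := (abs_nonneg _).trans hp
  rw [Register.condProb, le_div_iff₀ hpos] at h
  have hpos' : 0 < R.postProb φ := by nlinarith
  refine ⟨hpos', ?_⟩
  rw [Register.condProb, le_div_iff₀ hpos']
  nlinarith

/-- Bound on the error of the probabilities after `N` gates on `n` qubits with errors `2 ^ (-k)`. By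
`norm_foldl_sub_le`, the error of an amplitude is at most `2 ^ N N 2 ^ (-k)`, the amplitudes are at
most `2 ^ N`, and there are at most `2 ^ n` outcomes; the factor `N` is bounded by `2 ^ N`. -/
theorem error_bound_le {n N m k : ℕ} (hk : n + 3 * N + 2 + m ≤ k) :
    (2 : ℝ) ^ n * (2 ^ N * (0 + N * ((2 : ℝ)⁻¹ ^ k * 1)) *
      (2 * (2 ^ N * 1) + 2 ^ N * (0 + N * ((2 : ℝ)⁻¹ ^ k * 1)))) ≤ 2⁻¹ ^ m := by
  obtain ⟨δ, hδ⟩ : ∃ δ, δ = (2 : ℝ)⁻¹ ^ k := ⟨_, rfl⟩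
  obtain ⟨X, hX⟩ : ∃ X, X = (2 : ℝ) ^ N := ⟨_, rfl⟩
  obtain ⟨Y, hY⟩ : ∃ Y, Y = (2 : ℝ) ^ n := ⟨_, rfl⟩
  obtain ⟨T, hT⟩ : ∃ T, T = (2 : ℝ)⁻¹ ^ m := ⟨_, rfl⟩
  have hδ0 : 0 < δ := by rw [hδ]; positivity
  have hX1 : 1 ≤ X := by rw [hX]; exact one_le_pow₀ (by norm_num)
  have hY1 : 1 ≤ Y := by rw [hY]; exact one_le_pow₀ (by norm_num)
  have hT1 : T ≤ 1 := by rw [hT]; exact pow_le_one₀ (by norm_num) (by norm_num)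
  have hN : (N : ℝ) ≤ X := by
    rw [hX]
    exact_mod_cast Nat.lt_two_pow_self.le
  have hmain : Y * X ^ 3 * 4 * δ ≤ T := by
    have h1 : δ ≤ (2 : ℝ)⁻¹ ^ (n + 3 * N + 2 + m) := by
      rw [hδ]
      exact pow_le_pow_of_le_one (by norm_num) (by norm_num) hk
    have h2 : Y * X ^ 3 * 4 * (2 : ℝ)⁻¹ ^ (n + 3 * N + 2 + m) = T := by
      rw [hX, hY, hT, pow_add, pow_add, pow_add, ← pow_mul, mul_comm 3 N, inv_pow, inv_pow]
      field_simp
      norm_num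
    calc Y * X ^ 3 * 4 * δ ≤ Y * X ^ 3 * 4 * (2 : ℝ)⁻¹ ^ (n + 3 * N + 2 + m) := by gcongr
      _ = T := h2
  rw [← hδ, ← hX, ← hY, ← hT]
  have he : X * (0 + N * (δ * 1)) ≤ X ^ 2 * δ := by
    rw [zero_add, mul_one, pow_two, mul_assoc]
    gcongr
  have he0 : 0 ≤ X * (0 + N * (δ * 1)) := by positivity
  have hX0 : X ^ 2 * δ ≤ Y * X ^ 3 * 4 * δ := by
    have h3 : X ^ 2 ≤ X ^ 3 := pow_le_pow_right₀ hX1 (by norm_num)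
    have h4 : X ^ 3 ≤ Y * X ^ 3 := le_mul_of_one_le_left (by positivity) hY1
    have h5 : X ^ 2 ≤ Y * X ^ 3 * 4 := by linarith [show 0 ≤ Y * X ^ 3 by positivity]
    gcongr
  calc Y * (X * (0 + N * (δ * 1)) * (2 * (X * 1) + X * (0 + N * (δ * 1))))
      ≤ Y * (X ^ 2 * δ * (2 * (X * 1) + X ^ 2 * δ)) := by gcongr
    _ ≤ Y * (X ^ 2 * δ * (2 * (X * 1) + 2 * X)) :=
        mul_le_mul_of_nonneg_left (mul_le_mul_of_nonneg_left (by linarith) (by positivity))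
          (by positivity)
    _ = Y * X ^ 3 * 4 * δ := by ring
    _ ≤ T := hmain

/-- The length of a description bounds the number of gates and the number of qubits. -/
theorem length_le_encode (C : Circuit (ExchangeGate (ℤ × ℤ))) :
    C.gates.length ≤ (C.encode encodeExchangeGate).length ∧
      C.n ≤ (C.encode encodeExchangeGate).length := by
  have h : ∀ gs : List (ExchangeGate (ℤ × ℤ) C.n),
      gs.length ≤ (gs.flatMap encodeExchangeGate).length := by
    intro gs
    induction gs with
    | nil => simp
    | cons g gs ih =>
      have : 1 ≤ (encodeExchangeGate g).length := by simp [encodeExchangeGate]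
      rw [List.flatMap_cons, List.length_cons, List.length_append]
      omega
  have h' : C.toRegister.encode.length = C.n * 2 := by
    simp [Register.encode_eq, List.length_flatten, List.map_ofFn, Function.comp_def]
  rw [Circuit.encode, List.length_append]
  have := h C.gates
  omega

/-- The angles are computed to a polynomial precision, and the circuit with these angles is
simulated exactly. -/
theorem postXQP_subset : PostXQP ⊆ PostBQP := by
  rintro L ⟨C, ⟨D, hD, hTM⟩, ⟨q, hq⟩, -, ε, h0, h1, hL⟩
  choose f hf s hs hp hj using exists_generalCircuit
  -- `p` bounds the length of descriptions, hence the numbers of qubits and of gates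
  obtain ⟨p, hp'⟩ := exists_output_bound hTM.some
  -- the new error tolerance is halfway between `ε` and `1 / 2`
  obtain ⟨J, hJ⟩ := exists_pow_lt_of_lt_one (show (0 : ℝ) < ((ε + 1 / 2) / 2 - ε) / 2 by linarith)
    (show (2 : ℝ)⁻¹ < 1 by norm_num)
  -- the precision required by `error_bound_le` for an error of `2 ^ (-q - J)`
  obtain ⟨c, d, hcd⟩ := exists_poly_le (4 * p + q + Polynomial.C (J + 2))
  have key : ∀ w v, 1 - ε ≤ (C w).condProb (C w).final v →
      0 < (f ⟨(C w).toRegister, D w (c * (w.length + 1) ^ d)⟩).postProb (f _).final ∧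
      1 - (ε + 1 / 2) / 2 ≤ (f ⟨(C w).toRegister, D w (c * (w.length + 1) ^ d)⟩).condProb
        (f _).final v := by
    intro w v hv
    obtain ⟨k, hk⟩ : ∃ k, k = c * (w.length + 1) ^ d := ⟨_, rfl⟩
    rw [← hk]
    -- the numbers of qubits and of gates do not depend on the precision, so precision `0` serves
    have hlen := length_le_encode ⟨(C w).toRegister, D w 0⟩
    have hpw : ((⟨(C w).toRegister, D w 0⟩ : Circuit (ExchangeGate (ℤ × ℤ))).encode
        encodeExchangeGate).length ≤ p.eval w.length := by
      refine (hp' (w, 0)).trans (le_of_eq ?_)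
      exact congrArg (fun l => p.eval (List.length l)) (encodePair_eq w 0) |>.trans (by simp)
    have hN : (C w).gates.length ≤ p.eval w.length :=
      ((hD w 0).length_eq.symm.le.trans hlen.1).trans hpw
    have hn : (C w).n ≤ p.eval w.length := hlen.2.trans hpw
    have hkw : (C w).n + 3 * (C w).gates.length + 2 + (q.eval w.length + J) ≤ k := by
      have := hcd w.length
      simp only [Polynomial.eval_add, Polynomial.eval_mul, Polynomial.eval_ofNat,
        Polynomial.eval_C, ← hk] at this
      omega
    have hket : ∀ x, ‖ket (C w).input x‖ ≤ 1 := by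
      intro x
      rw [ket]
      split_ifs <;> simp
    obtain ⟨φ, hφ⟩ : ∃ φ : State (C w).n,
      φ = (Circuit.denote ⟨(C w).toRegister, D w k⟩).final := ⟨_, rfl⟩
    have hclose : ∀ x, ‖φ x - (C w).final x‖ ≤ 2 ^ (C w).gates.length *
        (0 + (C w).gates.length * ((2 : ℝ)⁻¹ ^ k * 1)) ∧
        ‖(C w).final x‖ ≤ 2 ^ (C w).gates.length * 1 := by
      rw [hφ]
      exact norm_foldl_sub_le (hD w k) (φ := ket (C w).input) (fun x => by simp) hket
    have hpost := ((C w).toRegister.abs_postProb_sub_le (fun x => (hclose x).1)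
      fun x => (hclose x).2).trans (error_bound_le hkw)
    have hjoint := ((C w).toRegister.abs_jointProb_sub_le (fun x => (hclose x).1)
      (fun x => (hclose x).2) v).trans (error_bound_le hkw)
    have hη : 2 * (2 : ℝ)⁻¹ ^ (q.eval w.length + J) ≤
        ((ε + 1 / 2) / 2 - ε) * (C w).postProb (C w).final := by
      have := hq w
      rw [pow_add]
      have h3 : (2 : ℝ)⁻¹ ^ q.eval w.length * 2⁻¹ ^ J ≤
          (C w).postProb (C w).final * (((ε + 1 / 2) / 2 - ε) / 2) :=
        mul_le_mul this hJ.le (by positivity) (hL w).1.le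
      linarith
    obtain ⟨r1, r2⟩ := le_condProb_of_close hpost hjoint h0
      (show ε < (ε + 1 / 2) / 2 by linarith) (by linarith) (hL w).1 hη hv
    rw [hφ] at r1 r2
    refine ⟨(mul_pos (hs _) r1).trans_eq (hp ⟨(C w).toRegister, D w k⟩).symm, r2.trans_eq ?_⟩
    exact (condProb_eq_of_scaled (hs _) (hp ⟨(C w).toRegister, D w k⟩)
      (hj ⟨(C w).toRegister, D w k⟩) v).symm
  refine ⟨fun w => f ⟨(C w).toRegister, D w (c * (w.length + 1) ^ d)⟩, ?_, (ε + 1 / 2) / 2,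
    by linarith, by linarith, fun w => ⟨?_, ?_, ?_⟩⟩
  · have h1 := computable_comp hTM (computable_exchange hf)
    have h2 := computable_comp (computable_precision c d) h1
    exact h2
  · by_cases hw : w ∈ L
    · exact (key w true ((hL w).2.1 hw)).1
    · exact (key w false ((hL w).2.2 hw)).1
  · exact fun hw => (key w true ((hL w).2.1 hw)).2
  · exact fun hw => (key w false ((hL w).2.2 hw)).2

end XQP

theorem theorem1 :
    XQP.PostXQPAngle (Real.pi / 4) = XQP.PostXQP ∧ XQP.PostXQP = XQP.PostBQP := by
  have h : XQP.PostXQPAngle (Real.pi / 4) ⊆ XQP.PostXQP := by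
    rintro L ⟨C, hu, hi, -, hd⟩
    exact ⟨C, hu, hi, fun _ _ _ => trivial, hd⟩
  have h₁ := XQP.postXQP_subset
  have h₂ := XQP.postBQP_subset
  exact ⟨h.antisymm (h₁.trans h₂), h₁.antisymm (h₂.trans h)⟩
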